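/- Let $n\ge 1$ and $g \geq 0$. Let $H(g)$ be the $2g$-dimensional rational vector space with basis $e_1,\dots,e_g,f_1,\dots,f_g$ and the nonsingular $(-1)^n$-symmetric pairing $\lambda$ with $\lambda(e_i,f_j)=\delta_{ij}$, $\lambda(e_i,e_j)=\lambda(f_i,f_j)=0$. Write $\{a_i\}$ for this basis, $\{a_i^\#\}$ for the dual basis characterised by $\lambda(a_i^\#,a_j)=\delta_{ij}$, and $\omega=\sum_i a_i\otimes a_i^\#$. Let $\mathcal V$ be a commutative graded $\mathbb Q$-algebra concentrated in even non-negative degrees, and let $e\in\mathcal V_{2n}$. A *labelled partition* of a finite set $S$ is a finite multiset of pairs $(P,c)$, called parts, of a (possibly empty) subset $P\subseteq S$ and a homogeneous label $c\in\mathcal V$, such that each element of $S$ lies in exactly one part, and such that every part has positive degree $|c|+n(|P|-2)>0$. The degree of a labelled partition is the sum of the degrees of its parts. Let $\mathcal P(S,\mathcal V)'_{\ge0}$ be the graded vector space spanned by the labelled partitions of $S$, modulo linearity in the label of each part. Bijections act on it by relabelling. If $x\ne y$ are elements of $S$, then contraction along $(x,y)$ is the linear map $\mathcal P(S,\mathcal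 V)'_{\geq 0}\to\mathcal P(S\setminus\{x,y\},\mathcal V)'_{\geq 0}$ which removes $x$ and $y$ and multiplies the label by $e$ if they lie in the same part, and which removes them, merges the two parts and multiplies the labels if they lie in different parts. On $\det(\mathbb Q^S)^{\otimes n}$ bijections act naturally and contraction along $(x,y)$ is the $n$th power of the inverse of $x\wedge y\wedge-$. Thus $\mathcal P(-,\mathcal V)'_{\ge0}\otimes{\det}^{\otimes n}$ is a functor on the downward Brauer category $\mathsf{dBr}$ if $n$ is even, and on the downward signed Brauer category $\mathsf{dsBr}$ if $n$ is odd (the morphisms are generated by bijections and contractions of ordered pairs). Let $K^\vee$ be the contravariant functor on the same category given by $K^\vee(S)=H(g)^{\otimes S}$, where bijections act by permuting factors and contraction along $(x,y)$ acts by inserting $\omega$ in the factors $x,y$. Let $$R^{\mathcal V}=K^\vee\otimes^{\mathsf{d(s)Br}}\bigl(\mathcal P(-,\mathcal V)'_{\ge0}\otimes{\det}^{\otimes n}\bigr)$$ be the coend, i.e. the quotient of $\bigoplus_{m\ge 0}K^\vee(S_m)\otimes\mathcal P(S_m,\mathcal V)'_{\ge0}\otimes\det(\mathbb Q^{S_m})^{\otimes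 n}$, with $S_m=\{1,\dots,m\}$, by the relations $K^\vee(\varphi)(\xi)\otimes x\sim\xi\otimes\varphi_*(x)$ for all morphisms $\varphi$ between the sets $S_m$. It is a graded ring (with $H(g)$ in degree $0$), the product being induced by the tensor product, the disjoint union of labelled partitions and the exterior product. For homogeneous $c\in\mathcal V$ with $|c|+n(r-2)>0$ let $\kappa_c(v_1\otimes\cdots\otimes v_r)\in R^{\mathcal V}$, of degree $|c|+n(r-2)$, be the class of $(v_1\otimes\cdots\otimes v_r)\otimes\{(\{1,\dots,r\},c)\}\otimes(1\wedge\cdots\wedge r)^{\otimes n}$, and write $\kappa_c$ for this class if $r=0$. **Theorem.** For every $n\ge1$ and every $d\ge0$ there is a $g_0$ such that for all $g\ge g_0$ the following holds. Let $\mathcal V$ be a commutative graded $\mathbb Q$-algebra concentrated in even non-negative degrees, such that $\mathcal V=\mathbb Q\{1\}\oplus\mathcal V_{>n}$ with $1 \neq 0$, and let $e\in\mathcal V_{2n}$. Then in degrees $\le d$ the ring $R^{\mathcal V}$ is the graded-commutative $\mathbb{Q}$-algebra generated by the classes - (a) $\kappa_c$ for homogeneous $c\in\mathcal V_{>2n}$,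 of degree $|c|-2n$, - (b) $\kappa_c(v_1)$ for homogeneous $c\in\mathcal V_{>n}$ and $v_1\in H(g)$, of degree $|c|-n$, - (c) $\kappa_1(v_1\otimes v_2\otimes v_3)$ for $v_1,v_2,v_3\in H(g)$, of degree $n$, with relations given by linearity in $c$ and in each $v_i$, and the following, for all $v_i\in H(g)$, permutations $\sigma$ of $\{1,2,3\}$, and homogeneous $x,y\in\mathcal V_{>n}$: - ($\alpha$) $\kappa_1(v_{\sigma(1)}\otimes v_{\sigma(2)}\otimes v_{\sigma(3)})=\mathrm{sign}(\sigma)^n\cdot\kappa_1(v_1\otimes v_2\otimes v_3)$, - ($\beta$) $\kappa_{x\cdot y}=\sum_i\kappa_x(a_i)\cdot\kappa_y(a_i^\#)$, - ($\gamma$) $\kappa_{x\cdot y}(v_1)=\sum_{i,j}\kappa_1(v_1\otimes a_j\otimes a_i)\cdot\kappa_x(a_i^\#)\cdot\kappa_y(a_j^\#)$, - ($\delta$) $\sum_i\kappa_1(v_1\otimes a_i\otimes a_i^\#)=\kappa_e(v_1)$, - ($\epsilon$) $\sum_i\kappa_1(v_1\otimes v_2\otimes a_i)\cdot\kappa_1(a_i^\#\otimes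 v_5\otimes v_6)=\sum_i\kappa_1(v_1\otimes v_5\otimes a_i)\cdot\kappa_1(a_i^\#\otimes v_6\otimes v_2)$. That is, if $R_{\mathrm{pres}}$ is the graded-commutative $\mathbb Q$-algebra with this presentation, then there is a homomorphism of $\mathbb Q$-algebras $R_{\mathrm{pres}}\to R^{\mathcal V}$ which sends each generator to the class that it denotes, and it restricts to a bijection from the degree $k$ part of $R_{\mathrm{pres}}$ to the degree $k$ part of $R^{\mathcal V}$ for each $k\le d$. -/

import Mathlib

open scoped TensorProduct DirectSum

noncomputable section

namespace TwistedMMM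

universe u

/-! ### The form `H(g)` -/

/-- The rational vector space `H(g)` of dimension `2g`, with standard basis
`e₁, …, e_g, f₁, …, f_g` (indexed by `Sum.inl`, `Sum.inr`). -/
abbrev Hyp (g : ℕ) : Type := Fin g ⊕ Fin g → ℚ

/-- The nonsingular `(-1)^n`-symmetric pairing `λ` on `H(g)`: `λ(eᵢ, fⱼ) = δᵢⱼ`,
`λ(fⱼ, eᵢ) = (-1)^n δᵢⱼ`, `λ(eᵢ, eⱼ) = λ(fᵢ, fⱼ) = 0`. -/
def pairing (n g : ℕ) (v w : Hyp g) : ℚ :=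
  ∑ i, (v (.inl i) * w (.inr i) + (-1) ^ n * (v (.inr i) * w (.inl i)))

/-- The basis `aᵢ` of `H(g)`. -/
def bas (g : ℕ) (i : Fin g ⊕ Fin g) : Hyp g := Pi.single i 1

/-- The dual basis `aᵢ^#` of `H(g)`, characterised by `λ(aᵢ^#, aⱼ) = δᵢⱼ`. The form dual to `λ` is
`ω = ∑ᵢ aᵢ ⊗ aᵢ^#`. -/
def sharp (n g : ℕ) : Fin g ⊕ Fin g → Hyp g
  | .inl i => (-1 : ℚ) ^ n • bas g (.inr i)
  | .inr i => bas g (.inl i)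

theorem pairing_sharp (n g : ℕ) (i j : Fin g ⊕ Fin g) :
    pairing n g (sharp n g i) (bas g j) = if i = j then 1 else 0 := by
  have h : ((-1 : ℚ) ^ n) * (-1) ^ n = 1 := by
    rw [← mul_pow]; norm_num
  rcases i with i | i <;> rcases j with j | j <;>
    simp [pairing, sharp, bas, Pi.single_apply, h, eq_comm]

/-! ### Labelled partitions -/

/-- A part of a labelled partition of `S`: a (possibly empty) subset of `S`, together with a label
in `V` and the degree of the label. -/
@[ext]
structure Part (V : Type u) (S : Type) where
  carrier : Finset S
  deg : ℕ
  label : V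

/-- The image of a labelled part under an injection. -/
def Part.map {V : Type u} {S T : Type} (f : S ↪ T) (P : Part V S) : Part V T :=
  ⟨P.carrier.map f, P.deg, P.label⟩

theorem Part.map_map {V : Type u} {S T U : Type} (f : S ↪ T) (f' : T ↪ U) (P : Part V S) :
    (P.map f).map f' = P.map (f.trans f') := by
  simp [Part.map, Finset.map_map]

/-- `X` is a partition of `S` into (possibly empty, unordered) parts, each labelled by a homogeneous
element of `V`, such that every part `P` with label `c` has positive degree `|c| + n(|P| - 2)`.
When `V = ℚ{1} ⊕ V_{>n}` this excludes exactly the parts of size `0` with label of degree `≤ 2n`,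
the parts of size `1` with label of degree `≤ n`, and the parts of size `2` labelled by scalars. -/
structure IsLabelled (n : ℕ) {V : Type u} [CommRing V] [Algebra ℚ V] (𝒱 : ℕ → Submodule ℚ V)
    {S : Type} [DecidableEq S] (X : Multiset (Part V S)) : Prop where
  partition : ∀ s : S, X.countP (fun P => s ∈ P.carrier) = 1
  homogeneous : ∀ P ∈ X, P.label ∈ 𝒱 P.deg
  allowed : ∀ P ∈ X, 2 * n < P.deg + n * P.carrier.card

section

variable (n : ℕ) {V : Type u} [CommRing V] [Algebra ℚ V] (𝒱 : ℕ → Submodule ℚ V)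

/-- The set of labelled partitions of `S`. -/
abbrev LabPart (S : Type) [DecidableEq S] : Type u :=
  {X : Multiset (Part V S) // IsLabelled n 𝒱 X}

/-- The degree `∑ (|c| + n(|P| - 2))` of a labelled partition (no subtraction below truncates). -/
def LabPart.degree {n : ℕ} {𝒱 : ℕ → Submodule ℚ V} {S : Type} [DecidableEq S]
    (X : LabPart n 𝒱 S) : ℕ :=
  (X.1.map fun P => P.deg + n * P.carrier.card - 2 * n).sum

/-- Linearity of labelled partitions in the label of each part. -/
def labelRel (S : Type) [DecidableEq S] : Set (LabPart n 𝒱 S →₀ ℚ) :=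
  {z | ∃ (A : Finset S) (d : ℕ) (c c' : V) (q q' : ℚ) (X : Multiset (Part V S))
      (h : IsLabelled n 𝒱 (⟨A, d, c⟩ ::ₘ X)) (h' : IsLabelled n 𝒱 (⟨A, d, c'⟩ ::ₘ X))
      (h'' : IsLabelled n 𝒱 (⟨A, d, q • c + q' • c'⟩ ::ₘ X)),
      z = Finsupp.single ⟨_, h''⟩ 1 - q • Finsupp.single ⟨_, h⟩ 1 - q' • Finsupp.single ⟨_, h'⟩ 1}

/-- The vector space `𝒫(S, 𝒱)'_{≥0}` spanned by labelled partitions of `S`, modulo linearity in the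
labels. -/
abbrev PMod (S : Type) [DecidableEq S] : Type u :=
  (LabPart n 𝒱 S →₀ ℚ) ⧸ Submodule.span ℚ (labelRel n 𝒱 S)

/-- The class of a labelled partition. -/
def PMod.of {n : ℕ} {𝒱 : ℕ → Submodule ℚ V} {S : Type} [DecidableEq S] (X : LabPart n 𝒱 S) :
    PMod n 𝒱 S :=
  Submodule.Quotient.mk (Finsupp.single X 1)

variable {n 𝒱}

/-- Relabelling of a labelled partition along a bijection. -/
def LabPart.map {S T : Type} [DecidableEq S] [DecidableEq T] (σ : S ≃ T) (X : LabPart n 𝒱 S) :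
    LabPart n 𝒱 T :=
  ⟨X.1.map (Part.map σ.toEmbedding), by
    refine ⟨fun t => ?_, ?_, ?_⟩
    · rw [Multiset.countP_map, ← X.2.partition (σ.symm t), Multiset.countP_eq_card_filter]
      congr 2
      ext P
      simp [Part.map, Finset.mem_map_equiv]
    · intro P hP
      obtain ⟨Q, hQ, rfl⟩ := Multiset.mem_map.1 hP
      exact X.2.homogeneous Q hQ
    · intro P hP
      obtain ⟨Q, hQ, rfl⟩ := Multiset.mem_map.1 hP
      simpa [Part.map] using X.2.allowed Q hQ⟩

/-- Disjoint union of labelled partitions of `{0, …, k-1}` and `{0, …, m-1}`, as a labelled partition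
of `{0, …, k+m-1}`. -/
def LabPart.union {k m : ℕ} (X : LabPart n 𝒱 (Fin k)) (Y : LabPart n 𝒱 (Fin m)) :
    LabPart n 𝒱 (Fin (k + m)) :=
  ⟨X.1.map (Part.map (Fin.castAddEmb m)) + Y.1.map (Part.map (Fin.natAddEmb k)), by
    refine ⟨fun t => ?_, ?_, ?_⟩
    · rw [Multiset.countP_add, Multiset.countP_map, Multiset.countP_map]
      refine Fin.addCases (fun i => ?_) (fun j => ?_) t
      · have h1 : (X.1.filter fun P =>
            Fin.castAdd m i ∈ (Part.map (Fin.castAddEmb m) P).carrier).card = 1 := by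
          rw [← X.2.partition i, Multiset.countP_eq_card_filter]
          congr 2
          ext P
          simp [Part.map]
        have h2 : (Y.1.filter fun P =>
            Fin.castAdd m i ∈ (Part.map (Fin.natAddEmb k) P).carrier) = 0 := by
          rw [Multiset.filter_eq_nil]
          intro P _
          simp only [Part.map, Finset.mem_map, not_exists, not_and]
          intro x _ hx
          have := congrArg Fin.val hx
          simp at this
          omega
        rw [h1, h2]; rfl
      · have h1 : (Y.1.filter fun P =>
            Fin.natAdd k j ∈ (Part.map (Fin.natAddEmb k) P).carrier).card = 1 := by
          rw [← Y.2.partition j, Multiset.countP_eq_card_filter]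
          congr 2
          ext P
          simp [Part.map]
        have h2 : (X.1.filter fun P =>
            Fin.natAdd k j ∈ (Part.map (Fin.castAddEmb m) P).carrier) = 0 := by
          rw [Multiset.filter_eq_nil]
          intro P _
          simp only [Part.map, Finset.mem_map, not_exists, not_and]
          intro x _ hx
          have := congrArg Fin.val hx
          simp at this
          omega
        rw [h1, h2]; rfl
    · intro P hP
      rcases Multiset.mem_add.1 hP with hP | hP <;>
        obtain ⟨Q, hQ, rfl⟩ := Multiset.mem_map.1 hP
      · exact X.2.homogeneous Q hQ
      · exact Y.2.homogeneous Q hQ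
    · intro P hP
      rcases Multiset.mem_add.1 hP with hP | hP <;>
        obtain ⟨Q, hQ, rfl⟩ := Multiset.mem_map.1 hP
      · simpa [Part.map] using X.2.allowed Q hQ
      · simpa [Part.map] using Y.2.allowed Q hQ⟩

theorem PMod.of_linear {S : Type} [DecidableEq S] {A : Finset S} {d : ℕ} {c c' : V} {q q' : ℚ}
    {X : Multiset (Part V S)} (Z Z' Z'' : LabPart n 𝒱 S) (h : Z.1 = ⟨A, d, c⟩ ::ₘ X)
    (h' : Z'.1 = ⟨A, d, c'⟩ ::ₘ X) (h'' : Z''.1 = ⟨A, d, q • c + q' • c'⟩ ::ₘ X) :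
    PMod.of Z'' = q • PMod.of Z + q' • PMod.of Z' := by
  obtain ⟨Z, hZ⟩ := Z
  obtain ⟨Z', hZ'⟩ := Z'
  obtain ⟨Z'', hZ''⟩ := Z''
  dsimp only at h h' h''
  subst h h' h''
  rw [← sub_eq_zero, ← sub_sub]
  exact (Submodule.Quotient.mk_eq_zero _).2
    (Submodule.subset_span ⟨A, d, c, c', q, q', X, hZ, hZ', hZ'', rfl⟩)

/-- A function on labelled partitions which is linear in the labels extends to a linear map. -/
def PMod.lift {S : Type} [DecidableEq S] {M : Type*} [AddCommGroup M] [Module ℚ M]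
    (F : LabPart n 𝒱 S → M)
    (hF : ∀ (A : Finset S) (d : ℕ) (c c' : V) (q q' : ℚ) (X : Multiset (Part V S))
      (h : IsLabelled n 𝒱 (⟨A, d, c⟩ ::ₘ X)) (h' : IsLabelled n 𝒱 (⟨A, d, c'⟩ ::ₘ X))
      (h'' : IsLabelled n 𝒱 (⟨A, d, q • c + q' • c'⟩ ::ₘ X)),
      F ⟨_, h''⟩ = q • F ⟨_, h⟩ + q' • F ⟨_, h'⟩) : PMod n 𝒱 S →ₗ[ℚ] M :=
  Submodule.liftQ _ (Finsupp.linearCombination ℚ F) (by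
    rw [Submodule.span_le]
    rintro z ⟨A, d, c, c', q, q', X, h, h', h'', rfl⟩
    rw [SetLike.mem_coe, LinearMap.mem_ker, map_sub, map_sub, map_smul, map_smul,
      Finsupp.linearCombination_single, Finsupp.linearCombination_single,
      Finsupp.linearCombination_single, hF A d c c' q q' X h h' h'']
    simp)

theorem PMod.lift_of {S : Type} [DecidableEq S] {M : Type*} [AddCommGroup M] [Module ℚ M]
    (F : LabPart n 𝒱 S → M) (hF) (X : LabPart n 𝒱 S) :
    PMod.lift F hF (PMod.of X) = F X := by
  rw [PMod.lift, PMod.of, Submodule.liftQ_apply, Finsupp.linearCombination_single, one_smul]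

theorem PMod.ext_of {S : Type} [DecidableEq S] {M : Type*} [AddCommGroup M] [Module ℚ M]
    {f f' : PMod n 𝒱 S →ₗ[ℚ] M} (h : ∀ X, f (PMod.of X) = f' (PMod.of X)) : f = f' := by
  apply Submodule.linearMap_qext
  apply Finsupp.lhom_ext'
  intro X
  apply LinearMap.ext_ring
  exact h X

/-- The linear map `𝒫(S, 𝒱)'_{≥0} → 𝒫(T, 𝒱)'_{≥0}` induced by a bijection. -/
def PMod.map {S T : Type} [DecidableEq S] [DecidableEq T] (σ : S ≃ T) :
    PMod n 𝒱 S →ₗ[ℚ] PMod n 𝒱 T :=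
  PMod.lift (fun X => PMod.of (X.map σ)) (by
    intro A d c c' q q' X h h' h''
    apply PMod.of_linear (A := A.map σ.toEmbedding) (d := d) (c := c) (c' := c')
      (X := X.map (Part.map σ.toEmbedding)) <;> simp [LabPart.map, Part.map])

theorem PMod.map_of {S T : Type} [DecidableEq S] [DecidableEq T] (σ : S ≃ T)
    (X : LabPart n 𝒱 S) : PMod.map σ (PMod.of X) = PMod.of (X.map σ) :=
  PMod.lift_of _ _ _

/-- The bilinear map `𝒫(S, 𝒱)'_{≥0} × 𝒫(T, 𝒱)'_{≥0} → 𝒫(S ⊔ T, 𝒱)'_{≥0}` given by disjoint union of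
labelled partitions. -/
def PMod.union (k m : ℕ) :
    PMod n 𝒱 (Fin k) →ₗ[ℚ] PMod n 𝒱 (Fin m) →ₗ[ℚ] PMod n 𝒱 (Fin (k + m)) :=
  PMod.lift (fun X => PMod.lift (fun Y => PMod.of (X.union Y)) (by
      intro A d c c' q q' Y h h' h''
      apply PMod.of_linear (A := A.map (Fin.natAddEmb k)) (d := d) (c := c) (c' := c')
        (X := X.1.map (Part.map (Fin.castAddEmb m)) + Y.map (Part.map (Fin.natAddEmb k))) <;>
        simp [LabPart.union, Part.map])) (by
    intro A d c c' q q' X h h' h''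
    apply PMod.ext_of
    intro Y
    simp only [LinearMap.add_apply, LinearMap.smul_apply, PMod.lift_of]
    apply PMod.of_linear (A := A.map (Fin.castAddEmb m)) (d := d) (c := c) (c' := c')
      (X := X.map (Part.map (Fin.castAddEmb m)) + Y.1.map (Part.map (Fin.natAddEmb k))) <;>
      simp [LabPart.union, Part.map])

theorem PMod.union_of {k m : ℕ} (X : LabPart n 𝒱 (Fin k)) (Y : LabPart n 𝒱 (Fin m)) :
    PMod.union k m (PMod.of X) (PMod.of Y) = PMod.of (X.union Y) := by
  rw [PMod.union, PMod.lift_of, PMod.lift_of]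

end

/-! ### The coend `R^𝒱` -/

section

/-- The order preserving injection `{0, …, m-1} → {0, …, m+1}` whose image misses the two adjacent
elements `p` and `p + 1`. -/
def skip {m k : ℕ} (h : k = m + 2) (p : ℕ) : Fin m ↪ Fin k :=
  ⟨fun i => ⟨if (i : ℕ) < p then i else i + 2, by split_ifs <;> omega⟩, by
    intro i j hij
    have := congrArg Fin.val hij
    dsimp only at this
    ext
    split_ifs at this <;> omega⟩

theorem skip_val {m k : ℕ} (h : k = m + 2) (p : ℕ) (i : Fin m) :
    (skip h p i : ℕ) = if (i : ℕ) < p then (i : ℕ) else i + 2 := rfl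

/-- The family `v₀, …, v_{p-1}, x, y, v_p, …, v_{m-1}`. -/
def insertPair {m k g : ℕ} (h : k = m + 2) (p : ℕ) (hp : p ≤ m) (v : Fin m → Hyp g) (x y : Hyp g) :
    Fin k → Hyp g := fun i =>
  if h₁ : (i : ℕ) < p then v ⟨i, by omega⟩
  else if h₂ : (i : ℕ) = p then x
  else if h₃ : (i : ℕ) = p + 1 then y
  else v ⟨i - 2, by omega⟩

variable {V : Type u} [CommRing V] [Algebra ℚ V]

/-- The effect on labelled partitions of the morphism of the downward Brauer category which matches
the adjacent elements `x = p` and `y = p + 1` of `{0, …, m+1}` (and is the inclusion `skip` on the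
other elements). If `x` and `y` lie in the same part, they are removed from it, and its label is
multiplied by `e`; if they lie in different parts, they are removed and the parts are merged, and the
labels are multiplied. -/
def Contracts (n : ℕ) (e : V) {m k : ℕ} (h : k = m + 2) (p : ℕ) (hp : p ≤ m)
    (X : Multiset (Part V (Fin k))) (X' : Multiset (Part V (Fin m))) : Prop :=
  (∃ (A : Finset (Fin m)) (d : ℕ) (c : V) (Y : Multiset (Part V (Fin m))),
    X = ⟨{⟨p, by omega⟩, ⟨p + 1, by omega⟩} ∪ A.map (skip h p), d, c⟩ ::ₘ
      Y.map (Part.map (skip h p)) ∧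
    X' = ⟨A, 2 * n + d, e * c⟩ ::ₘ Y) ∨
  (∃ (A B : Finset (Fin m)) (d d' : ℕ) (c c' : V) (Y : Multiset (Part V (Fin m))),
    X = ⟨{⟨p, by omega⟩} ∪ A.map (skip h p), d, c⟩ ::ₘ
      ⟨{⟨p + 1, by omega⟩} ∪ B.map (skip h p), d', c'⟩ ::ₘ Y.map (Part.map (skip h p)) ∧
    X' = ⟨A ∪ B, d + d', c * c'⟩ ::ₘ Y)

variable (n : ℕ) (𝒱 : ℕ → Submodule ℚ V) (e : 𝒱 (2 * n)) (g : ℕ)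

/-- `K^∨(S) ⊗ 𝒫(S, 𝒱)'_{≥0} ⊗ det(ℚ^S)^{⊗ n}` with `S = {0, …, m-1}`. Here `K^∨(S)` is
`H(g)^{⊗ S}` (`H(g)` being identified with its dual), and `det(ℚ^S)^{⊗ n}` is identified with `ℚ` by
its generator `(0 ∧ 1 ∧ ⋯ ∧ (m-1))^{⊗ n}`. -/
def TermMod (m : ℕ) : Type u := (⨂[ℚ]^m (Hyp g)) ⊗[ℚ] PMod n 𝒱 (Fin m)

instance (m : ℕ) : AddCommGroup (TermMod n 𝒱 g m) :=
  inferInstanceAs (AddCommGroup ((⨂[ℚ]^m (Hyp g)) ⊗[ℚ] PMod n 𝒱 (Fin m)))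

instance (m : ℕ) : Module ℚ (TermMod n 𝒱 g m) :=
  inferInstanceAs (Module ℚ ((⨂[ℚ]^m (Hyp g)) ⊗[ℚ] PMod n 𝒱 (Fin m)))

/-- The direct sum of the spaces `K^∨(S) ⊗ 𝒫(S, 𝒱)'_{≥0} ⊗ det(ℚ^S)^{⊗ n}` over the objects
`S = {0, …, m-1}`. -/
abbrev CoendSum : Type u := ⨁ m : ℕ, TermMod n 𝒱 g m

variable {n 𝒱 g}

/-- The element `(v₀ ⊗ ⋯ ⊗ v_{m-1}) ⊗ X ⊗ (0 ∧ ⋯ ∧ (m-1))^{⊗ n}` of `TermMod`. -/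
def TermMod.mk {m : ℕ} (v : Fin m → Hyp g) (X : LabPart n 𝒱 (Fin m)) : TermMod n 𝒱 g m :=
  PiTensorProduct.tprod ℚ v ⊗ₜ[ℚ] PMod.of X

theorem TermMod.ext {m : ℕ} {M : Type*} [AddCommGroup M] [Module ℚ M]
    {f f' : TermMod n 𝒱 g m →ₗ[ℚ] M} (h : ∀ v X, f (TermMod.mk v X) = f' (TermMod.mk v X)) :
    f = f' := by
  refine TensorProduct.ext (M := ⨂[ℚ]^m (Hyp g)) (N := PMod n 𝒱 (Fin m)) ?_
  refine PiTensorProduct.ext (MultilinearMap.ext fun v => ?_)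
  exact PMod.ext_of (fun X => h v X)

/-- The element `(v₀ ⊗ ⋯ ⊗ v_{m-1}) ⊗ X ⊗ (0 ∧ ⋯ ∧ (m-1))^{⊗ n}`. -/
def term {m : ℕ} (v : Fin m → Hyp g) (X : LabPart n 𝒱 (Fin m)) : CoendSum n 𝒱 g :=
  DirectSum.lof ℚ ℕ (TermMod n 𝒱 g) m (TermMod.mk v X)

/-- The relations `K^∨(φ)(ξ) ⊗ x ∼ ξ ⊗ φ_*(x)` which define the coend over the downward (signed)
Brauer category, for `φ` in a set of morphisms which generates this category. -/
inductive CoendRel : CoendSum n 𝒱 g → Prop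
  /-- `φ` is a bijection `σ`, which acts on `det^{⊗ n}` by `sign(σ)^n`. -/
  | bij {m : ℕ} (σ : Equiv.Perm (Fin m)) (v : Fin m → Hyp g) (X : LabPart n 𝒱 (Fin m)) :
      CoendRel (term (v ∘ σ) X - ((Equiv.Perm.sign σ : ℤ) : ℚ) ^ n • term v (X.map σ))
  /-- `φ` matches the adjacent elements `p` and `p + 1`: `K^∨(φ)` inserts `ω = ∑ aᵢ ⊗ aᵢ^#`, and
  `φ` acts on `det^{⊗ n}` by `(p ∧ (p+1) ∧ -)⁻¹`, so preserves the chosen generators. -/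
  | contract {m k : ℕ} (h : k = m + 2) (p : ℕ) (hp : p ≤ m) (v : Fin m → Hyp g)
      (X : LabPart n 𝒱 (Fin k)) (X' : LabPart n 𝒱 (Fin m))
      (hX : Contracts n (e : V) h p hp X.1 X'.1) :
      CoendRel ((∑ i, term (insertPair h p hp v (bas g i) (sharp n g i)) X) - term v X')

variable (n 𝒱 g)

/-- The subspace spanned by the relations of the coend. -/
def coendSub : Submodule ℚ (CoendSum n 𝒱 g) := Submodule.span ℚ {z | CoendRel e z}

/-- The coend `R^𝒱 = K^∨ ⊗^{d(s)Br} (𝒫(-, 𝒱)'_{≥0} ⊗ det^{⊗ n})`. -/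
def RV : Type u := CoendSum n 𝒱 g ⧸ coendSub n 𝒱 e g

instance : AddCommGroup (RV n 𝒱 e g) :=
  inferInstanceAs (AddCommGroup (CoendSum n 𝒱 g ⧸ coendSub n 𝒱 e g))

instance : Module ℚ (RV n 𝒱 e g) :=
  inferInstanceAs (Module ℚ (CoendSum n 𝒱 g ⧸ coendSub n 𝒱 e g))

variable {n 𝒱 g}

/-- The class in `R^𝒱` of `(v₀ ⊗ ⋯ ⊗ v_{m-1}) ⊗ X ⊗ (0 ∧ ⋯ ∧ (m-1))^{⊗ n}`. -/
def cls {m : ℕ} (v : Fin m → Hyp g) (X : LabPart n 𝒱 (Fin m)) : RV n 𝒱 e g :=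
  (coendSub n 𝒱 e g).mkQ (term v X)

theorem PMod.span_of {S : Type} [DecidableEq S] :
    Submodule.span ℚ (Set.range (PMod.of : LabPart n 𝒱 S → PMod n 𝒱 S)) = ⊤ := by
  rw [Submodule.eq_top_iff']
  intro x
  have : (Submodule.span ℚ (Set.range (PMod.of : LabPart n 𝒱 S → PMod n 𝒱 S))).mkQ =
      0 := by
    apply PMod.ext_of
    intro X
    rw [Submodule.mkQ_apply, Submodule.Quotient.mk_eq_zero _ |>.2]
    · rfl
    · exact Submodule.subset_span ⟨X, rfl⟩
  rw [← Submodule.Quotient.mk_eq_zero, ← Submodule.mkQ_apply, this]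
  rfl

theorem span_term :
    Submodule.span ℚ {z : CoendSum n 𝒱 g | ∃ (m : ℕ) (v : Fin m → Hyp g) (X : LabPart n 𝒱 (Fin m)),
      z = term v X} = ⊤ := by
  rw [Submodule.eq_top_iff']
  intro x
  set N := Submodule.span ℚ {z : CoendSum n 𝒱 g | ∃ (m : ℕ) (v : Fin m → Hyp g)
    (X : LabPart n 𝒱 (Fin m)), z = term v X} with hN
  have : N.mkQ = 0 := by
    apply DirectSum.linearMap_ext
    intro m
    apply TermMod.ext
    intro v X
    exact (Submodule.Quotient.mk_eq_zero _).2 (Submodule.subset_span ⟨m, v, X, rfl⟩)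
  rw [← Submodule.Quotient.mk_eq_zero, ← Submodule.mkQ_apply, this]
  rfl

theorem RV.induction {P : RV n 𝒱 e g → Prop} (x : RV n 𝒱 e g)
    (hcls : ∀ (m : ℕ) (v : Fin m → Hyp g) (X : LabPart n 𝒱 (Fin m)), P (cls e v X))
    (hzero : P 0) (hadd : ∀ x y, P x → P y → P (x + y)) (hsmul : ∀ (q : ℚ) x, P x → P (q • x)) :
    P x := by
  obtain ⟨z, rfl⟩ := (coendSub n 𝒱 e g).mkQ_surjective x
  have hz : z ∈ Submodule.span ℚ {z : CoendSum n 𝒱 g | ∃ (m : ℕ) (v : Fin m → Hyp g)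
    (X : LabPart n 𝒱 (Fin m)), z = term v X} := by rw [span_term]; exact Submodule.mem_top
  induction hz using Submodule.span_induction with
  | mem z hz => obtain ⟨m, v, X, rfl⟩ := hz; exact hcls m v X
  | zero => exact hzero
  | add x y _ _ hx hy => exact hadd _ _ hx hy
  | smul q x _ hx => exact hsmul _ _ hx

/-- The product before passing to the coend, on the summands indexed by `k` and `m`: the tensor product
of the strong monoidality of `K^∨` and the lax monoidality of `𝒫(-, 𝒱)'_{≥0} ⊗ det^{⊗ n}`, given by
disjoint union and exterior product. -/
def TermMod.mul (k m : ℕ) :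
    TermMod n 𝒱 g k →ₗ[ℚ] TermMod n 𝒱 g m →ₗ[ℚ] TermMod n 𝒱 g (k + m) :=
  TensorProduct.map₂
    ((TensorProduct.mk ℚ (⨂[ℚ]^k (Hyp g)) (⨂[ℚ]^m (Hyp g))).compr₂
      (TensorPower.mulEquiv (R := ℚ) (M := Hyp g) (n := k) (m := m)).toLinearMap)
    (PMod.union k m)

theorem TermMod.mul_mk {k m : ℕ} (v : Fin k → Hyp g) (w : Fin m → Hyp g)
    (X : LabPart n 𝒱 (Fin k)) (Y : LabPart n 𝒱 (Fin m)) :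
    TermMod.mul k m (TermMod.mk v X) (TermMod.mk w Y) =
      TermMod.mk (Fin.append v w) (X.union Y) := by
  have h := TensorProduct.map₂_apply_tmul
    (f := (TensorProduct.mk ℚ (⨂[ℚ]^k (Hyp g)) (⨂[ℚ]^m (Hyp g))).compr₂
      (TensorPower.mulEquiv (R := ℚ) (M := Hyp g) (n := k) (m := m)).toLinearMap)
    (g := PMod.union k m) (PiTensorProduct.tprod ℚ v) (PMod.of X)
  have h' := LinearMap.congr_fun h (PiTensorProduct.tprod ℚ w ⊗ₜ[ℚ] PMod.of Y)
  rw [TensorProduct.map_tmul, PMod.union_of] at h'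
  refine h'.trans ?_
  exact congrArg (fun t => t ⊗ₜ[ℚ] PMod.of (X.union Y)) (TensorPower.tprod_mul_tprod ℚ v w)

/-- The product before passing to the coend. -/
def mulSum : CoendSum n 𝒱 g →ₗ[ℚ] CoendSum n 𝒱 g →ₗ[ℚ] CoendSum n 𝒱 g :=
  DirectSum.toModule ℚ ℕ _ fun k => LinearMap.flip <| DirectSum.toModule ℚ ℕ _ fun m =>
    LinearMap.flip <| (TermMod.mul k m).compr₂ (DirectSum.lof ℚ ℕ (TermMod n 𝒱 g) (k + m))

theorem mulSum_term {k m : ℕ} (v : Fin k → Hyp g) (w : Fin m → Hyp g) (X : LabPart n 𝒱 (Fin k))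
    (Y : LabPart n 𝒱 (Fin m)) :
    mulSum (term v X) (term w Y) = term (Fin.append v w) (X.union Y) := by
  simp only [mulSum, term, DirectSum.toModule_lof, LinearMap.flip_apply, LinearMap.compr₂_apply,
    TermMod.mul_mk]

/-! ### The ring structure on `R^𝒱` -/

theorem term_congr {k m : ℕ} (h : k = m) {v : Fin k → Hyp g} {w : Fin m → Hyp g}
    {X : LabPart n 𝒱 (Fin k)} {Y : LabPart n 𝒱 (Fin m)} (hv : v = w ∘ Fin.cast h)
    (hX : X.1.map (Part.map (finCongr h).toEmbedding) = Y.1) :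
    term v X = term w Y := by
  subst h
  have h1 : (Part.map (finCongr (rfl : k = k)).toEmbedding : Part V (Fin k) → Part V (Fin k)) =
      id := by
    funext P
    ext <;> simp [Part.map]
  rw [h1, Multiset.map_id] at hX
  rw [Subtype.ext hX, hv]
  rfl

theorem term_bij_mem {m : ℕ} (σ : Equiv.Perm (Fin m)) (v : Fin m → Hyp g)
    (X Y : LabPart n 𝒱 (Fin m)) (hY : X.1.map (Part.map σ.toEmbedding) = Y.1) :
    term (v ∘ σ) X - ((Equiv.Perm.sign σ : ℤ) : ℚ) ^ n • term v Y ∈ coendSub n 𝒱 e g := by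
  have : X.map σ = Y := Subtype.ext hY
  subst this
  exact Submodule.subset_span (CoendRel.bij σ v X)

theorem mulSum_left_mem (x z : CoendSum n 𝒱 g) (hz : z ∈ coendSub n 𝒱 e g) :
    mulSum x z ∈ coendSub n 𝒱 e g := by
  have hx : x ∈ Submodule.span ℚ {z : CoendSum n 𝒱 g | ∃ (m : ℕ) (v : Fin m → Hyp g)
    (X : LabPart n 𝒱 (Fin m)), z = term v X} := by rw [span_term]; exact Submodule.mem_top
  induction hx using Submodule.span_induction with
  | zero => rw [map_zero]; exact Submodule.zero_mem _
  | add x y _ _ hx hy => rw [map_add]; exact Submodule.add_mem _ hx hy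
  | smul q x _ hx => rw [map_smul]; exact Submodule.smul_mem _ _ hx
  | mem x hx =>
    obtain ⟨j, w, Y, rfl⟩ := hx
    induction hz using Submodule.span_induction with
    | zero => rw [map_zero]; exact Submodule.zero_mem _
    | add x y _ _ hx hy => rw [map_add]; exact Submodule.add_mem _ hx hy
    | smul q x _ hx => rw [map_smul]; exact Submodule.smul_mem _ _ hx
    | mem z hz =>
      cases hz with
      | @bij m σ v X =>
        rw [map_sub, map_smul, mulSum_term, mulSum_term]
        have := term_bij_mem e (finSumFinEquiv.permCongr (Equiv.sumCongr (1 : Equiv.Perm (Fin j)) σ))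
          (Fin.append w v) (Y.union X) (Y.union (X.map σ)) (by
            simp only [LabPart.union, LabPart.map, Multiset.map_add, Multiset.map_map,
              Function.comp_def, Part.map_map]
            congr 2
            · funext P
              congr 1
              ext i
              simp
            · funext P
              congr 1
              ext i
              simp)
        rw [Equiv.Perm.sign_permCongr] at this
        have hs : Equiv.Perm.sign (Equiv.sumCongr (1 : Equiv.Perm (Fin j)) σ) =
            Equiv.Perm.sign σ := by
          have := Equiv.Perm.sign_sumCongr (1 : Equiv.Perm (Fin j)) σ
          rwa [Equiv.Perm.sign_one, one_mul] at this
        rw [hs] at this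
        convert this using 2
        congr 1
        funext i
        refine Fin.addCases (fun i => ?_) (fun i => ?_) i <;> simp
      | @contract m k h p hp v X X' hX =>
        rw [map_sub, map_sum]
        simp only [mulSum_term]
        have h' : j + k = (j + m) + 2 := by omega
        have key : ∀ x y, Fin.append w (insertPair h p hp v x y) =
            insertPair h' (j + p) (by omega) (Fin.append w v) x y := by
          intro x y
          funext i
          refine Fin.addCases (fun i => ?_) (fun i => ?_) i
          · simp only [Fin.append_left, insertPair, Fin.val_castAdd]
            rw [dif_pos (by omega)]
            exact (Fin.append_left w v i).symm
          · simp only [Fin.append_right, insertPair, Fin.val_natAdd]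
            split_ifs <;> first | omega | rfl | skip
            · rw [← Fin.append_right w v]; rfl
            · rw [← Fin.append_right w v]
              congr 1
              ext
              simp
              omega
        simp only [key]
        refine Submodule.subset_span (CoendRel.contract h' (j + p) (by omega) _ _ _ ?_)
        have e1 : (skip h p).trans (Fin.natAddEmb j) =
            (Fin.natAddEmb j).trans (skip h' (j + p)) := by
          ext i
          simp only [skip_val, Function.Embedding.trans_apply, Fin.natAddEmb_apply, Fin.val_natAdd]
          split_ifs <;> omega
        have e2 : Fin.castAddEmb k = (Fin.castAddEmb m).trans (skip h' (j + p)) := by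
          ext i
          simp only [skip_val, Function.Embedding.trans_apply, Fin.castAddEmb_apply, Fin.val_castAdd]
          split_ifs <;> omega
        rcases hX with ⟨A, d, c, Z, hX, hX'⟩ | ⟨A, B, d, d', c, c', Z, hX, hX'⟩
        · refine Or.inl ⟨A.map (Fin.natAddEmb j), d, c, Y.1.map (Part.map (Fin.castAddEmb m)) +
            Z.map (Part.map (Fin.natAddEmb j)), ?_, ?_⟩
          · simp only [LabPart.union, hX, Multiset.map_add, Multiset.map_map,
              Function.comp_def, Multiset.map_cons, Multiset.add_cons, Part.map, e1, e2,
              Finset.map_map, Finset.map_union, Finset.map_insert, Finset.map_singleton]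
            rfl
          · simp only [LabPart.union, hX', Multiset.map_cons, Multiset.add_cons, Part.map]
        · refine Or.inr ⟨A.map (Fin.natAddEmb j), B.map (Fin.natAddEmb j), d, d', c, c',
            Y.1.map (Part.map (Fin.castAddEmb m)) + Z.map (Part.map (Fin.natAddEmb j)), ?_, ?_⟩
          · simp only [LabPart.union, hX, Multiset.map_add, Multiset.map_map,
              Function.comp_def, Multiset.map_cons, Multiset.add_cons, Part.map, e1, e2,
              Finset.map_map, Finset.map_union, Finset.map_singleton]
            rfl
          · simp only [LabPart.union, hX', Multiset.map_cons, Multiset.add_cons, Part.map,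
              Finset.map_union]

theorem mulSum_right_mem (x z : CoendSum n 𝒱 g) (hz : z ∈ coendSub n 𝒱 e g) :
    mulSum z x ∈ coendSub n 𝒱 e g := by
  have hx : x ∈ Submodule.span ℚ {z : CoendSum n 𝒱 g | ∃ (m : ℕ) (v : Fin m → Hyp g)
    (X : LabPart n 𝒱 (Fin m)), z = term v X} := by rw [span_term]; exact Submodule.mem_top
  induction hx using Submodule.span_induction with
  | zero => rw [map_zero]; exact Submodule.zero_mem _
  | add x y _ _ hx hy => rw [map_add]; exact Submodule.add_mem _ hx hy
  | smul q x _ hx => rw [map_smul]; exact Submodule.smul_mem _ _ hx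
  | mem x hx =>
    obtain ⟨j, w, Y, rfl⟩ := hx
    induction hz using Submodule.span_induction with
    | zero => rw [map_zero, LinearMap.zero_apply]; exact Submodule.zero_mem _
    | add x y _ _ hx hy => rw [map_add, LinearMap.add_apply]; exact Submodule.add_mem _ hx hy
    | smul q x _ hx => rw [map_smul, LinearMap.smul_apply]; exact Submodule.smul_mem _ _ hx
    | mem z hz =>
      cases hz with
      | @bij m σ v X =>
        rw [map_sub, map_smul, LinearMap.sub_apply, LinearMap.smul_apply, mulSum_term, mulSum_term]
        have := term_bij_mem e (finSumFinEquiv.permCongr (Equiv.sumCongr σ (1 : Equiv.Perm (Fin j))))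
          (Fin.append v w) (X.union Y) ((X.map σ).union Y) (by
            simp only [LabPart.union, LabPart.map, Multiset.map_add, Multiset.map_map,
              Function.comp_def, Part.map_map]
            congr 2
            · funext P
              congr 1
              ext i
              simp
            · funext P
              congr 1
              ext i
              simp)
        rw [Equiv.Perm.sign_permCongr] at this
        have hs : Equiv.Perm.sign (Equiv.sumCongr σ (1 : Equiv.Perm (Fin j))) =
            Equiv.Perm.sign σ := by
          have := Equiv.Perm.sign_sumCongr σ (1 : Equiv.Perm (Fin j))
          rwa [Equiv.Perm.sign_one, mul_one] at this
        rw [hs] at this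
        convert this using 2
        congr 1
        funext i
        refine Fin.addCases (fun i => ?_) (fun i => ?_) i <;> simp
      | @contract m k h p hp v X X' hX =>
        rw [map_sub, map_sum, LinearMap.sub_apply, LinearMap.sum_apply]
        simp only [mulSum_term]
        have h' : k + j = (m + j) + 2 := by omega
        have key : ∀ x y, Fin.append (insertPair h p hp v x y) w =
            insertPair h' p (by omega) (Fin.append v w) x y := by
          intro x y
          funext i
          refine Fin.addCases (fun i => ?_) (fun i => ?_) i
          · simp only [Fin.append_left, insertPair, Fin.val_castAdd]
            split_ifs <;> first | omega | rfl | skip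
            · rw [← Fin.append_left v w]; rfl
            · rw [← Fin.append_left v w]; rfl
          · simp only [Fin.append_right, insertPair, Fin.val_natAdd]
            rw [dif_neg (by omega), dif_neg (by omega), dif_neg (by omega), ← Fin.append_right v w]
            congr 1
            ext
            simp
            omega
        simp only [key]
        refine Submodule.subset_span (CoendRel.contract h' p (by omega) _ _ _ ?_)
        have e1 : (skip h p).trans (Fin.castAddEmb j) =
            (Fin.castAddEmb j).trans (skip h' p) := by
          ext i
          simp only [skip_val, Function.Embedding.trans_apply, Fin.castAddEmb_apply, Fin.val_castAdd]
        have e2 : Fin.natAddEmb k = (Fin.natAddEmb m).trans (skip h' p) := by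
          ext i
          simp only [skip_val, Function.Embedding.trans_apply, Fin.natAddEmb_apply, Fin.val_natAdd]
          split_ifs <;> omega
        rcases hX with ⟨A, d, c, Z, hX, hX'⟩ | ⟨A, B, d, d', c, c', Z, hX, hX'⟩
        · refine Or.inl ⟨A.map (Fin.castAddEmb j), d, c, Z.map (Part.map (Fin.castAddEmb j)) +
            Y.1.map (Part.map (Fin.natAddEmb m)), ?_, ?_⟩
          · simp only [LabPart.union, hX, Multiset.map_add, Multiset.map_map,
              Function.comp_def, Multiset.map_cons, Multiset.cons_add, Part.map, e1, e2,
              Finset.map_map, Finset.map_union, Finset.map_insert, Finset.map_singleton]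
            rfl
          · simp only [LabPart.union, hX', Multiset.map_cons, Multiset.cons_add, Part.map]
        · refine Or.inr ⟨A.map (Fin.castAddEmb j), B.map (Fin.castAddEmb j), d, d', c, c',
            Z.map (Part.map (Fin.castAddEmb j)) + Y.1.map (Part.map (Fin.natAddEmb m)), ?_, ?_⟩
          · simp only [LabPart.union, hX, Multiset.map_add, Multiset.map_map,
              Function.comp_def, Multiset.map_cons, Multiset.cons_add, Part.map, e1, e2,
              Finset.map_map, Finset.map_union, Finset.map_singleton]
            rfl
          · simp only [LabPart.union, hX', Multiset.map_cons, Multiset.cons_add, Part.map,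
              Finset.map_union]

/-- The product on `R^𝒱`. -/
def mulRV : RV n 𝒱 e g →ₗ[ℚ] RV n 𝒱 e g →ₗ[ℚ] RV n 𝒱 e g :=
  Submodule.liftQ (coendSub n 𝒱 e g)
    (LinearMap.flip (Submodule.liftQ (coendSub n 𝒱 e g)
      (LinearMap.flip (mulSum.compr₂ (coendSub n 𝒱 e g).mkQ)) (by
        intro z hz
        rw [LinearMap.mem_ker]
        refine LinearMap.ext fun x => ?_
        exact (Submodule.Quotient.mk_eq_zero _).2 (mulSum_left_mem e x z hz)))) (by
    intro z hz
    rw [LinearMap.mem_ker]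
    refine LinearMap.ext fun x => ?_
    obtain ⟨x, rfl⟩ := (coendSub n 𝒱 e g).mkQ_surjective x
    exact (Submodule.Quotient.mk_eq_zero _).2 (mulSum_right_mem e x z hz))

/-- The empty labelled partition of the empty set. -/
def emptyPart : LabPart n 𝒱 (Fin 0) :=
  ⟨0, ⟨fun s => s.elim0, fun _ h => absurd h (Multiset.notMem_zero _),
    fun _ h => absurd h (Multiset.notMem_zero _)⟩⟩

variable {e}

instance : Mul (RV n 𝒱 e g) := ⟨fun x y => mulRV e x y⟩

instance : One (RV n 𝒱 e g) := ⟨cls e Fin.elim0 emptyPart⟩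

theorem mul_def (x y : RV n 𝒱 e g) : x * y = mulRV e x y := rfl

theorem cls_mul {k m : ℕ} (v : Fin k → Hyp g) (w : Fin m → Hyp g) (X : LabPart n 𝒱 (Fin k))
    (Y : LabPart n 𝒱 (Fin m)) :
    cls e v X * cls e w Y = cls e (Fin.append v w) (X.union Y) :=
  congrArg (coendSub n 𝒱 e g).mkQ (mulSum_term v w X Y)

theorem cls_congr {k m : ℕ} (h : k = m) {v : Fin k → Hyp g} {w : Fin m → Hyp g}
    {X : LabPart n 𝒱 (Fin k)} {Y : LabPart n 𝒱 (Fin m)} (hv : v = w ∘ Fin.cast h)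
    (hX : X.1.map (Part.map (finCongr h).toEmbedding) = Y.1) :
    cls e v X = cls e w Y :=
  congrArg (coendSub n 𝒱 e g).mkQ (term_congr h hv hX)

theorem RV.one_mul' (x : RV n 𝒱 e g) : 1 * x = x := by
  refine RV.induction e (P := fun x => 1 * x = x) x (fun m v X => ?_) ?_ ?_ ?_
  · refine (cls_mul _ _ _ _).trans (cls_congr (Nat.zero_add m) (Fin.elim0_append v) ?_)
    simp only [LabPart.union, emptyPart, Multiset.map_zero, zero_add, Multiset.map_map,
      Function.comp_def, Part.map_map]
    conv_rhs => rw [← Multiset.map_id X.1]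
    congr 1
    funext P
    have : (Fin.natAddEmb 0).trans (finCongr (Nat.zero_add m)).toEmbedding =
      Function.Embedding.refl _ := by ext i; simp
    rw [this]
    ext <;> simp [Part.map]
  · rw [mul_def, map_zero]
  · intro x y hx hy; rw [mul_def] at *; rw [map_add, hx, hy]
  · intro q x hx; rw [mul_def] at *; rw [map_smul, hx]

theorem RV.mul_one' (x : RV n 𝒱 e g) : x * 1 = x := by
  refine RV.induction e (P := fun x => x * 1 = x) x (fun m v X => ?_) ?_ ?_ ?_
  · refine (cls_mul _ _ _ _).trans (cls_congr (Nat.add_zero m) (Fin.append_elim0 v) ?_)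
    simp only [LabPart.union, emptyPart, Multiset.map_zero, add_zero, Multiset.map_map,
      Function.comp_def, Part.map_map]
    conv_rhs => rw [← Multiset.map_id X.1]
    congr 1
    funext P
    have : (Fin.castAddEmb 0).trans (finCongr (Nat.add_zero m)).toEmbedding =
      Function.Embedding.refl _ := by ext i; rfl
    rw [this]
    ext <;> simp [Part.map]
  · rw [mul_def, map_zero, LinearMap.zero_apply]
  · intro x y hx hy; rw [mul_def] at *; rw [map_add, LinearMap.add_apply, hx, hy]
  · intro q x hx; rw [mul_def] at *; rw [map_smul, LinearMap.smul_apply, hx]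

theorem RV.mul_assoc' (x y z : RV n 𝒱 e g) : x * y * z = x * (y * z) := by
  refine RV.induction e (P := fun x => x * y * z = x * (y * z)) x (fun k v X => ?_) ?_ ?_ ?_
  · refine RV.induction e (P := fun y => cls e v X * y * z = cls e v X * (y * z)) y (fun m w Y => ?_) ?_ ?_ ?_
    · refine RV.induction e
        (P := fun z => cls e v X * cls e w Y * z = cls e v X * (cls e w Y * z)) z (fun l u Z => ?_) ?_ ?_ ?_
      · simp only [cls_mul]
        refine cls_congr (Nat.add_assoc k m l) (Fin.append_assoc v w u) ?_
        simp only [LabPart.union, Multiset.map_add, Multiset.map_map, Function.comp_def,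
          Part.map_map, add_assoc]
        have e1 : (Fin.castAddEmb (n := k) m).trans ((Fin.castAddEmb l).trans
            (finCongr (Nat.add_assoc k m l)).toEmbedding) = Fin.castAddEmb (m + l) := by
          ext i; simp
        have e2 : (Fin.natAddEmb (m := m) k).trans ((Fin.castAddEmb l).trans
            (finCongr (Nat.add_assoc k m l)).toEmbedding) =
            (Fin.castAddEmb l).trans (Fin.natAddEmb k) := by
          ext i; simp
        have e3 : (Fin.natAddEmb (m := l) (k + m)).trans
            (finCongr (Nat.add_assoc k m l)).toEmbedding =
            (Fin.natAddEmb m).trans (Fin.natAddEmb k) := by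
          ext i; simp; omega
        simp only [Function.Embedding.trans_assoc, e1, e2, e3]
      · simp only [mul_def, map_zero]
      · intro x y hx hy; simp only [mul_def, map_add] at *; rw [hx, hy]
      · intro q x hx; simp only [mul_def, map_smul] at *; rw [hx]
    · simp only [mul_def, map_zero, LinearMap.zero_apply]
    · intro x y hx hy; simp only [mul_def, map_add, LinearMap.add_apply] at *; rw [hx, hy]
    · intro q x hx; simp only [mul_def, map_smul, LinearMap.smul_apply] at *; rw [hx]
  · simp only [mul_def, map_zero, LinearMap.zero_apply]
  · intro x y hx hy; simp only [mul_def, map_add, LinearMap.add_apply] at *; rw [hx, hy]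
  · intro q x hx; simp only [mul_def, map_smul, LinearMap.smul_apply] at *; rw [hx]

instance : Ring (RV n 𝒱 e g) where
  __ := (inferInstance : AddCommGroup (RV n 𝒱 e g))
  mul x y := x * y
  one := 1
  left_distrib x y z := map_add (mulRV e x) y z
  right_distrib x y z := LinearMap.map_add₂ (mulRV e) x y z
  zero_mul x := LinearMap.map_zero₂ (mulRV e) x
  mul_zero x := map_zero (mulRV e x)
  mul_assoc := RV.mul_assoc'
  one_mul := RV.one_mul'
  mul_one := RV.mul_one'

instance : Algebra ℚ (RV n 𝒱 e g) :=
  Algebra.ofModule (fun q x y => LinearMap.map_smul₂ (mulRV e) q x y)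
    (fun q x y => map_smul (mulRV e x) q y)

variable (n 𝒱 e g)

/-- The degree `k` part of `R^𝒱` (elements of `H(g)` having degree zero). -/
def degreePart (k : ℕ) : Submodule ℚ (RV n 𝒱 e g) :=
  Submodule.span ℚ {z | ∃ (m : ℕ) (v : Fin m → Hyp g) (X : LabPart n 𝒱 (Fin m)),
    X.degree = k ∧ z = cls e v X}

variable {n 𝒱}

theorem isLabelled_singleton {r d : ℕ} (c : 𝒱 d) (h : 2 * n < d + n * r) :
    IsLabelled n 𝒱 {(⟨Finset.univ, d, (c : V)⟩ : Part V (Fin r))} := by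
  refine ⟨fun s => ?_, ?_, ?_⟩
  · rw [← Multiset.cons_zero, Multiset.countP_cons_of_pos (p := fun P : Part V (Fin r) => s ∈ P.carrier)
      _ (Finset.mem_univ s), Multiset.countP_zero]
  · intro P hP
    rw [Multiset.mem_singleton.1 hP]
    exact c.2
  · intro P hP
    rw [Multiset.mem_singleton.1 hP, Finset.card_univ, Fintype.card_fin]
    exact h

variable {g}

/-- The class `κ_c(v₁ ⊗ ⋯ ⊗ v_r)`, of degree `|c| + n(r - 2) > 0`, given by the labelled partition of
`{0, …, r-1}` with a single part, labelled by `c`. -/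
def kappa {r d : ℕ} (c : 𝒱 d) (h : 2 * n < d + n * r) (v : Fin r → Hyp g) : RV n 𝒱 e g :=
  cls e v ⟨_, isLabelled_singleton c h⟩

end

/-! ### The small presentation -/

section

variable {V : Type u} [CommRing V] [Algebra ℚ V] (n : ℕ) (𝒱 : ℕ → Submodule ℚ V) (g : ℕ)

/-- The generators of the small presentation. -/
inductive Gen : Type u
  /-- `κ_c` for `c` of degree `d > 2n`. -/
  | k0 {d : ℕ} (hd : 2 * n < d) (c : 𝒱 d) : Gen
  /-- `κ_c(v)` for `c` of degree `d > n`. -/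
  | k1 {d : ℕ} (hd : n < d) (c : 𝒱 d) (v : Hyp g) : Gen
  /-- `κ_1(v₀ ⊗ v₁ ⊗ v₂)`. -/
  | k3 (v : Fin 3 → Hyp g) : Gen

variable {n 𝒱 g}

/-- The degree of a generator. -/
def Gen.deg : Gen n 𝒱 g → ℕ
  | .k0 (d := d) _ _ => d - 2 * n
  | .k1 (d := d) _ _ _ => d - n
  | .k3 _ => n

/-- The element of `R^𝒱` which is denoted by a generator. -/
def Gen.toRV [GradedAlgebra 𝒱] (hn : 0 < n) (e : 𝒱 (2 * n)) : Gen n 𝒱 g → RV n 𝒱 e g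
  | .k0 hd c => kappa e (r := 0) c (by omega) Fin.elim0
  | .k1 hd c v => kappa e (r := 1) c (by omega) ![v]
  | .k3 v => kappa e (r := 3) (⟨1, SetLike.GradedOne.one_mem⟩ : 𝒱 0) (by omega) v

open FreeAlgebra in
/-- The relations of the small presentation, imposed on the free associative algebra on the
generators. -/
inductive Rel [GradedAlgebra 𝒱] (hn : 0 < n) (e : 𝒱 (2 * n)) :
    FreeAlgebra ℚ (Gen n 𝒱 g) → FreeAlgebra ℚ (Gen n 𝒱 g) → Prop
  /-- graded commutativity -/
  | comm (x y : Gen n 𝒱 g) :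
      Rel hn e (ι ℚ x * ι ℚ y) ((-1 : ℚ) ^ (x.deg * y.deg) • (ι ℚ y * ι ℚ x))
  /-- linearity of `κ_c` in `c` -/
  | lin0 {d : ℕ} (hd : 2 * n < d) (c c' : 𝒱 d) (q q' : ℚ) :
      Rel hn e (ι ℚ (.k0 hd (q • c + q' • c'))) (q • ι ℚ (.k0 hd c) + q' • ι ℚ (.k0 hd c'))
  /-- linearity of `κ_c(v)` in `c` -/
  | lin1 {d : ℕ} (hd : n < d) (c c' : 𝒱 d) (q q' : ℚ) (v : Hyp g) :
      Rel hn e (ι ℚ (.k1 hd (q • c + q' • c') v))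
        (q • ι ℚ (.k1 hd c v) + q' • ι ℚ (.k1 hd c' v))
  /-- linearity of `κ_c(v)` in `v` -/
  | lin1v {d : ℕ} (hd : n < d) (c : 𝒱 d) (q q' : ℚ) (v v' : Hyp g) :
      Rel hn e (ι ℚ (.k1 hd c (q • v + q' • v')))
        (q • ι ℚ (.k1 hd c v) + q' • ι ℚ (.k1 hd c v'))
  /-- linearity of `κ_1(v₀ ⊗ v₁ ⊗ v₂)` in each `vᵢ` -/
  | lin3 (v : Fin 3 → Hyp g) (i : Fin 3) (q q' : ℚ) (w w' : Hyp g) :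
      Rel hn e (ι ℚ (.k3 (Function.update v i (q • w + q' • w'))))
        (q • ι ℚ (.k3 (Function.update v i w)) + q' • ι ℚ (.k3 (Function.update v i w')))
  /-- `κ_1(v_{σ(1)} ⊗ v_{σ(2)} ⊗ v_{σ(3)}) = sign(σ)^n κ_1(v₁ ⊗ v₂ ⊗ v₃)` -/
  | alpha (σ : Equiv.Perm (Fin 3)) (v : Fin 3 → Hyp g) :
      Rel hn e (ι ℚ (.k3 (v ∘ σ))) (((Equiv.Perm.sign σ : ℤ) : ℚ) ^ n • ι ℚ (.k3 v))
  /-- `κ_{xy} = ∑ᵢ κ_x(aᵢ) κ_y(aᵢ^#)` -/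
  | beta {p q : ℕ} (hp : n < p) (hq : n < q) (x : 𝒱 p) (y : 𝒱 q) :
      Rel hn e (ι ℚ (.k0 (d := p + q) (by omega) ⟨(x : V) * y, SetLike.GradedMul.mul_mem x.2 y.2⟩))
        (∑ i, ι ℚ (.k1 hp x (bas g i)) * ι ℚ (.k1 hq y (sharp n g i)))
  /-- `κ_{xy}(v) = ∑ᵢⱼ κ_1(v ⊗ aⱼ ⊗ aᵢ) κ_x(aᵢ^#) κ_y(aⱼ^#)` -/
  | gamma {p q : ℕ} (hp : n < p) (hq : n < q) (x : 𝒱 p) (y : 𝒱 q) (v : Hyp g) :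
      Rel hn e (ι ℚ (.k1 (d := p + q) (by omega) ⟨(x : V) * y, SetLike.GradedMul.mul_mem x.2 y.2⟩ v))
        (∑ i, ∑ j, ι ℚ (.k3 ![v, bas g j, bas g i]) * ι ℚ (.k1 hp x (sharp n g i)) *
          ι ℚ (.k1 hq y (sharp n g j)))
  /-- `∑ᵢ κ_1(v ⊗ aᵢ ⊗ aᵢ^#) = κ_e(v)` -/
  | delta (v : Hyp g) :
      Rel hn e (∑ i, ι ℚ (.k3 ![v, bas g i, sharp n g i])) (ι ℚ (.k1 (d := 2 * n) (by omega) e v))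
  /-- `∑ᵢ κ_1(v₁ ⊗ v₂ ⊗ aᵢ) κ_1(aᵢ^# ⊗ v₅ ⊗ v₆) = ∑ᵢ κ_1(v₁ ⊗ v₅ ⊗ aᵢ) κ_1(aᵢ^# ⊗ v₆ ⊗ v₂)` -/
  | epsilon (v₁ v₂ v₅ v₆ : Hyp g) :
      Rel hn e (∑ i, ι ℚ (.k3 ![v₁, v₂, bas g i]) * ι ℚ (.k3 ![sharp n g i, v₅, v₆]))
        (∑ i, ι ℚ (.k3 ![v₁, v₅, bas g i]) * ι ℚ (.k3 ![sharp n g i, v₆, v₂]))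

/-- The graded-commutative ring given by the small presentation. -/
abbrev SmallPres [GradedAlgebra 𝒱] (hn : 0 < n) (e : 𝒱 (2 * n)) (g : ℕ) : Type u :=
  RingQuot (Rel (g := g) hn e)

/-- The class of a generator in the ring given by the small presentation. -/
def SmallPres.gen [GradedAlgebra 𝒱] (hn : 0 < n) (e : 𝒱 (2 * n)) (x : Gen n 𝒱 g) :
    SmallPres hn e g :=
  RingQuot.mkAlgHom ℚ (Rel (g := g) hn e) (FreeAlgebra.ι ℚ x)

/-- The degree `k` part of the ring given by the small presentation. -/
def SmallPres.degreePart [GradedAlgebra 𝒱] (hn : 0 < n) (e : 𝒱 (2 * n)) (g k : ℕ) :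
    Submodule ℚ (SmallPres hn e g) :=
  Submodule.span ℚ {z | ∃ l : List (Gen n 𝒱 g),
    (l.map Gen.deg).sum = k ∧ z = (l.map (SmallPres.gen hn e)).prod}

end

end TwistedMMM

end

/-! Each relation of the small presentation holds in the coend because it equates two ways of
computing a contraction of labelled partitions. The resulting map `toCoend` is inverted by an
explicit linear map `smallInv`, built from the universal property of the coend. No stability enters:
the argument works for every `g` and in every degree, so `g₀ = 0`.

The inverse needs classes `κ_c(v₁ ⊗ ⋯ ⊗ v_r)` in the small presentation for all `r`. In the coend,
splitting along `ω` gives `κ_c(v₁ ⊗ ⋯ ⊗ v_r) = ∑ᵢ κ_c(v₁ ⊗ ⋯ ⊗ v_{r-2} ⊗ aᵢ) κ_1(aᵢ^# ⊗ v_{r-1} ⊗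
v_r)`, and this recursion is taken as the definition (`comb`). It starts from `κ_c` and `κ_c(-)` if
`|c| > n`, and from the form `λ` if `c = 1` (`scal`). These classes behave as in the coend: (1) `α`
and `ε` make them `(-1)^n`-symmetric in the vectors (`comb_isSigned`, `scal_isSigned`). (2)
Contracting two classes multiplies their labels (`sum_smallKappa_mul_smallKappa`). With a unit label
this is the recursion itself, up to graded commutativity; with two labels of degree `> n` it is `β`
if no vector remains and `γ` otherwise. (3) Contracting two entries of one class multiplies its
label by `e`, by `δ` (`sum_comb_self`, `sum_smallKappa_self`). As `𝒱 = ℚ{1} ⊕ 𝒱_{>n}`, these labels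
are all that occur, and positivity of the degrees excludes unit labels with too few vectors.

A labelled partition has no preferred order, whereas a product of classes does. A word of blocks is
therefore given the product of its classes times the `n`th power of the sign of the list of its
elements (`wordVal`). Since `𝒱` is even, `κ_c(v₁ ⊗ ⋯ ⊗ v_r)` has parity `nr`; so the sign of
exchanging two blocks is cancelled by graded commutativity, and that of reordering a block by (1).
The value of a partition is thus well defined (`partVal_eq`). An adjacent pair can be removed
without changing the sign, so (2) and (3) give the contraction relation of the coend
(`sum_partVal_contract`).

The map `smallInv` is multiplicative and fixes the generators, so it is a left inverse of `toCoend`,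
which is therefore injective (`smallInv_toCoend`). For surjectivity, a partition is up to sign a
product of partitions with one part, and the splitting formula in the coend reduces each of these to
generators, compatibly with degrees (`kappa_mem_imagePart`, `cls_mem_imagePart`). -/

noncomputable section

namespace TwistedMMM

universe u

/-! ### The sign of a list -/

section ListSign

variable {α β : Type*} [LinearOrder α] [LinearOrder β]

/-- The sign `1`, `-1` or `0` of a pair, according to whether it is increasing, decreasing or
constant. -/
def pairSign (a b : α) : ℤ := if a < b then 1 else if b < a then -1 else 0

theorem pairSign_swap (a b : α) : pairSign b a = -pairSign a b := by
  unfold pairSign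
  rcases lt_trichotomy a b with h | h | h
  · simp [h, h.not_gt]
  · simp [h]
  · simp [h, h.not_gt]

theorem pairSign_of_lt {a b : α} (h : a < b) : pairSign a b = 1 := if_pos h

/-- The product of the signs of the pairs in `l × l'`. -/
def crossSign (l l' : List α) : ℤ := (l.map fun a => (l'.map (pairSign a)).prod).prod

@[simp] theorem crossSign_nil_left (l : List α) : crossSign [] l = 1 := rfl

@[simp] theorem crossSign_nil_right (l : List α) : crossSign l [] = 1 := by simp [crossSign]

theorem crossSign_cons_left (a : α) (l l' : List α) :
    crossSign (a :: l) l' = crossSign [a] l' * crossSign l l' := by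
  simp [crossSign]

theorem crossSign_append_right (l l₁ l₂ : List α) :
    crossSign l (l₁ ++ l₂) = crossSign l l₁ * crossSign l l₂ := by
  simp [crossSign, List.prod_map_mul]

theorem crossSign_cons_right (l : List α) (a : α) (l' : List α) :
    crossSign l (a :: l') = crossSign l [a] * crossSign l l' :=
  crossSign_append_right l [a] l'

theorem crossSign_perm_left {l₁ l₂ : List α} (h : l₁.Perm l₂) (l' : List α) :
    crossSign l₁ l' = crossSign l₂ l' := (h.map _).prod_eq

theorem crossSign_perm_right (l : List α) {l₁ l₂ : List α} (h : l₁.Perm l₂) :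
    crossSign l l₁ = crossSign l l₂ := by
  unfold crossSign
  congr 1
  exact List.map_congr_left fun a _ => (h.map _).prod_eq

theorem crossSign_singleton_swap (a : α) (l : List α) :
    crossSign l [a] = (-1) ^ l.length * crossSign [a] l := by
  induction l with
  | nil => simp
  | cons b l ih =>
    rw [crossSign_cons_left, ih, crossSign_cons_right]
    simp only [crossSign, List.map_cons, List.map_nil, List.prod_cons, List.prod_nil,
      List.length_cons, pairSign_swap a b, pow_succ]
    ring

/-- Each pair in `l × l'` contributes one factor `-1` by antisymmetry of `pairSign`; vanishing
factors do no harm. -/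
theorem crossSign_swap (l l' : List α) :
    crossSign l l' = (-1) ^ (l.length * l'.length) * crossSign l' l := by
  induction l with
  | nil => simp
  | cons a l ih =>
    rw [crossSign_cons_left, ih, crossSign_cons_right l' a l,
      crossSign_singleton_swap a l', List.length_cons, add_mul, pow_add, one_mul]
    have h : ((-1 : ℤ) ^ l'.length) * (-1) ^ l'.length = 1 := by rw [← mul_pow]; norm_num
    linear_combination (-crossSign [a] l' * (-1) ^ (l.length * l'.length) * crossSign l' l) * h

theorem crossSign_of_lt {l l' : List α} (h : ∀ a ∈ l, ∀ b ∈ l', a < b) : crossSign l l' = 1 := by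
  refine List.prod_eq_one fun x hx => ?_
  obtain ⟨a, ha, rfl⟩ := List.mem_map.1 hx
  refine List.prod_eq_one fun y hy => ?_
  obtain ⟨b, hb, rfl⟩ := List.mem_map.1 hy
  exact pairSign_of_lt (h a ha b hb)

/-- The sign of a list: the product of the signs of its pairs. It vanishes if the list has a
repeated entry. -/
def listSign : List α → ℤ
  | [] => 1
  | a :: l => crossSign [a] l * listSign l

@[simp] theorem listSign_nil : listSign ([] : List α) = 1 := rfl

theorem listSign_cons (a : α) (l : List α) : listSign (a :: l) = crossSign [a] l * listSign l := rfl

theorem listSign_append (l l' : List α) :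
    listSign (l ++ l') = listSign l * listSign l' * crossSign l l' := by
  induction l with
  | nil => simp
  | cons a l ih =>
    rw [List.cons_append, listSign_cons, ih, listSign_cons, crossSign_append_right,
      crossSign_cons_left a l l']
    ring

/-- Only the pairs with one entry in each of the two exchanged blocks change their order. -/
theorem listSign_append_swap (l₁ l l' l₂ : List α) :
    listSign (l₁ ++ (l ++ (l' ++ l₂))) =
      (-1) ^ (l.length * l'.length) * listSign (l₁ ++ (l' ++ (l ++ l₂))) := by
  simp only [listSign_append, crossSign_append_right]
  rw [crossSign_swap l l']
  ring

theorem listSign_swap (l₁ : List α) (a b : α) (l₂ : List α) :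
    listSign (l₁ ++ a :: b :: l₂) = -listSign (l₁ ++ b :: a :: l₂) := by
  have := listSign_append_swap l₁ [a] [b] l₂
  simpa using this

theorem listSign_map {f : α → β} (hf : StrictMono f) (l : List α) :
    listSign (l.map f) = listSign l := by
  induction l with
  | nil => rfl
  | cons a l ih =>
    rw [List.map_cons, listSign_cons, listSign_cons, ih]
    congr 1
    simp only [crossSign, List.map_cons, List.map_nil, List.map_map, List.prod_singleton]
    congr 1
    refine List.map_congr_left fun b _ => ?_
    simp [pairSign, hf.lt_iff_lt]

theorem listSign_eq_zero {l : List α} (h : ¬ l.Nodup) : listSign l = 0 := by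
  induction l with
  | nil => simp at h
  | cons a l ih =>
    rw [listSign_cons]
    by_cases ha : a ∈ l
    · have : crossSign [a] l = 0 := by
        simp only [crossSign, List.map_cons, List.map_nil, List.prod_singleton]
        refine List.prod_eq_zero (List.mem_map.2 ⟨a, ha, ?_⟩)
        simp [pairSign]
      rw [this, zero_mul]
    · rw [ih (fun h' => h (List.nodup_cons.2 ⟨ha, h'⟩)), mul_zero]

theorem listSign_of_pairwise_lt {l : List α} (h : l.Pairwise (· < ·)) : listSign l = 1 := by
  induction h with
  | nil => rfl
  | cons ha _ ih =>
    rw [listSign_cons, ih, crossSign_of_lt (by simpa using ha), mul_one]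

/-- Without repetitions, exchanging the values `a` and `b` amounts to exchanging the places of these
two entries. With a repetition both sides vanish. -/
theorem listSign_map_swap {a b : α} (hab : a ≠ b) {l : List α} (ha : a ∈ l) (hb : b ∈ l) :
    listSign (l.map (Equiv.swap a b)) = -listSign l := by
  by_cases hl : l.Nodup
  · have key : ∀ (a b : α) (l₁ l₂ l₃ : List α), (l₁ ++ a :: (l₂ ++ b :: l₃)).Nodup →
        listSign ((l₁ ++ a :: (l₂ ++ b :: l₃)).map (Equiv.swap a b)) =
          -listSign (l₁ ++ a :: (l₂ ++ b :: l₃)) := by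
      intro a b l₁ l₂ l₃ hl
      have hfix : ∀ l' : List α, a ∉ l' → b ∉ l' → l'.map (Equiv.swap a b) = l' := by
        intro l' ha hb
        conv_rhs => rw [← List.map_id l']
        refine List.map_congr_left fun x hx => Equiv.swap_apply_of_ne_of_ne ?_ ?_
        · rintro rfl; exact ha hx
        · rintro rfl; exact hb hx
      simp only [List.nodup_append, List.nodup_cons, List.mem_append, List.mem_cons] at hl
      simp only [List.map_append, List.map_cons, Equiv.swap_apply_left, Equiv.swap_apply_right]
      rw [hfix l₁ (by grind) (by grind), hfix l₂ (by grind) (by grind),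
        hfix l₃ (by grind) (by grind)]
      -- Moving `b` and moving `a` past `l₂` cost the same sign, which cancels; exchanging the
      -- neighbours `b` and `a` leaves `-1`.
      have h1 := listSign_append_swap l₁ [b] l₂ (a :: l₃)
      have h2 := listSign_append_swap (l₁ ++ l₂) [b] [a] l₃
      have h3 := listSign_append_swap l₁ [a] l₂ (b :: l₃)
      simp only [List.singleton_append, List.append_assoc, List.length_singleton, one_mul,
        pow_one] at h1 h2 h3
      rw [h1, h2, h3]
      ring
    obtain ⟨l₁, l', rfl⟩ := List.append_of_mem ha
    rcases List.mem_append.1 hb with hb | hb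
    · obtain ⟨l₀, l₂, rfl⟩ := List.append_of_mem hb
      have := key b a l₀ l₂ l' (by simpa using hl)
      rw [Equiv.swap_comm]
      simpa using this
    · obtain ⟨l₂, l₃, rfl⟩ := List.append_of_mem ((List.mem_cons.1 hb).resolve_left hab.symm)
      exact key a b l₁ l₂ l₃ hl
  · rw [listSign_eq_zero hl, listSign_eq_zero (fun h => hl (List.Nodup.of_map _ h)), neg_zero]

/-- The permutation acts on values. The list has to contain every element so that both elements of
each transposition occur in it. -/
theorem listSign_map_perm [Fintype α] (σ : Equiv.Perm α) {l : List α} (hl : ∀ a, a ∈ l) :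
    listSign (l.map σ) = Equiv.Perm.sign σ * listSign l := by
  induction σ using Equiv.Perm.swap_induction_on with
  | one => simp
  | swap_mul f x y hxy ih =>
    have : l.map (Equiv.swap x y * f) = (l.map f).map (Equiv.swap x y) := by simp
    rw [this, listSign_map_swap hxy (List.mem_map.2 ⟨f.symm x, hl _, by simp⟩)
      (List.mem_map.2 ⟨f.symm y, hl _, by simp⟩), ih, Equiv.Perm.sign_mul,
      Equiv.Perm.sign_swap hxy]
    simp

end ListSign

/-! ### The form `λ` -/

section Form

variable (n : ℕ) {g : ℕ}

/-- The pairing `λ` as a bilinear map. -/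
def pairingₗ (g : ℕ) : Hyp g →ₗ[ℚ] Hyp g →ₗ[ℚ] ℚ :=
  LinearMap.mk₂ ℚ (pairing n g)
    (by intro v v' w; simp only [pairing, ← Finset.sum_add_distrib, Pi.add_apply]
        exact Finset.sum_congr rfl fun i _ => by ring)
    (by intro q v w; simp only [pairing, Finset.mul_sum, Pi.smul_apply, smul_eq_mul]
        exact Finset.sum_congr rfl fun i _ => by ring)
    (by intro v w w'; simp only [pairing, ← Finset.sum_add_distrib, Pi.add_apply]
        exact Finset.sum_congr rfl fun i _ => by ring)
    (by intro q v w; simp only [pairing, Finset.mul_sum, Pi.smul_apply, smul_eq_mul]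
        exact Finset.sum_congr rfl fun i _ => by ring)

theorem neg_one_pow_mul_self : ((-1 : ℚ) ^ n) * (-1) ^ n = 1 := by
  rw [← mul_pow]; norm_num

theorem pairingₗ_symm (v w : Hyp g) : pairingₗ n g v w = (-1) ^ n * pairingₗ n g w v := by
  simp only [pairingₗ, LinearMap.mk₂_apply, pairing, Finset.mul_sum]
  refine Finset.sum_congr rfl fun i _ => ?_
  linear_combination (-v (.inl i) * w (.inr i)) * neg_one_pow_mul_self n

theorem sum_smul_bas (v : Hyp g) : ∑ i, v i • bas g i = v := by
  simp only [bas]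
  exact (pi_eq_sum_univ' v).symm

theorem sum_pairing_sharp_smul_bas (v : Hyp g) :
    ∑ i, pairingₗ n g (sharp n g i) v • bas g i = v := by
  conv_rhs => rw [← sum_smul_bas v]
  refine Finset.sum_congr rfl fun i _ => ?_
  congr 1
  conv_lhs => rw [← sum_smul_bas v]
  simp only [map_sum, map_smul, pairingₗ, LinearMap.mk₂_apply, pairing_sharp]
  simp

/-- The form `ω` is `(-1)^n`-symmetric. Homogeneity of `B` suffices, because each `aᵢ^#` is a
multiple of a basis vector. -/
theorem sum_sharp_bas {M : Type*} [AddCommGroup M] [Module ℚ M] (B : Hyp g → Hyp g → M)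
    (hl : ∀ (q : ℚ) v w, B (q • v) w = q • B v w) (hr : ∀ (q : ℚ) v w, B v (q • w) = q • B v w) :
    ∑ i, B (sharp n g i) (bas g i) = (-1 : ℚ) ^ n • ∑ i, B (bas g i) (sharp n g i) := by
  simp only [Fintype.sum_sum_type, sharp, hl, hr, Finset.smul_sum, smul_add, smul_smul,
    neg_one_pow_mul_self, one_smul]
  rw [add_comm]

theorem sum_pairing_bas_smul_sharp (v : Hyp g) :
    ∑ i, pairingₗ n g v (bas g i) • sharp n g i = v := by
  have := sum_sharp_bas n (g := g) (fun x y => pairingₗ n g v y • x)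
    (fun q x y => smul_comm _ _ _) (fun q x y => by rw [map_smul, smul_assoc])
  rw [this, Finset.smul_sum]
  conv_rhs => rw [← sum_pairing_sharp_smul_bas n v]
  refine Finset.sum_congr rfl fun i _ => ?_
  rw [pairingₗ_symm, smul_smul, ← mul_assoc, neg_one_pow_mul_self, one_mul]

end Form

/-! ### Functions of lists -/

section ListFun

variable {H A : Type*} [AddCommGroup H] [Module ℚ H] [AddCommGroup A] [Module ℚ A]

/-- A function of lists of vectors is multilinear if it is linear in each entry. -/
def IsMultilinear (Φ : List H → A) : Prop :=
  ∀ (l₁ : List H) (q q' : ℚ) (x y : H) (l₂ : List H),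
    Φ (l₁ ++ (q • x + q' • y) :: l₂) = q • Φ (l₁ ++ x :: l₂) + q' • Φ (l₁ ++ y :: l₂)

theorem IsMultilinear.smul_mid {Φ : List H → A} (h : IsMultilinear Φ) (l₁ : List H) (q : ℚ) (x : H)
    (l₂ : List H) : Φ (l₁ ++ (q • x) :: l₂) = q • Φ (l₁ ++ x :: l₂) := by
  have := h l₁ q 0 x x l₂
  simpa using this

end ListFun

/-! ### Signed symmetry of functions of lists -/

section SignedListFun

variable {H A : Type*} [AddCommGroup A] [Module ℚ A]

/-- A function of lists which is multiplied by `(-1)^n` when two adjacent entries are exchanged. -/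
def IsSigned (n : ℕ) (Φ : List H → A) : Prop :=
  ∀ (l₁ : List H) (x y : H) (l₂ : List H),
    Φ (l₁ ++ x :: y :: l₂) = (-1 : ℚ) ^ n • Φ (l₁ ++ y :: x :: l₂)

theorem IsSigned.swap_one {n : ℕ} {Φ : List H → A} (h : IsSigned n Φ) (l₁ : List H) (x : H)
    (l l₂ : List H) :
    Φ (l₁ ++ x :: (l ++ l₂)) = (-1 : ℚ) ^ (n * l.length) • Φ (l₁ ++ (l ++ x :: l₂)) := by
  induction l generalizing l₁ with
  | nil => simp
  | cons y l ih =>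
    have := ih (l₁ ++ [y])
    simp only [List.append_assoc, List.singleton_append] at this
    rw [List.cons_append, h, this, smul_smul, ← pow_add]
    simp only [List.cons_append, List.length_cons]
    congr 2
    ring

theorem IsSigned.swap {n : ℕ} {Φ : List H → A} (h : IsSigned n Φ) (l₁ l l' l₂ : List H) :
    Φ (l₁ ++ (l ++ (l' ++ l₂))) =
      (-1 : ℚ) ^ (n * l.length * l'.length) • Φ (l₁ ++ (l' ++ (l ++ l₂))) := by
  induction l generalizing l₁ with
  | nil => simp
  | cons y l ih =>
    have := ih (l₁ ++ [y])
    simp only [List.append_assoc, List.singleton_append] at this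
    rw [List.cons_append, this, h.swap_one, smul_smul, ← pow_add]
    simp only [List.cons_append, List.length_cons]
    congr 2
    ring

theorem IsSigned.rotate {n : ℕ} {Φ : List H → A} (h : IsSigned n Φ) (l l' : List H) :
    Φ (l ++ l') = (-1 : ℚ) ^ (n * l.length * l'.length) • Φ (l' ++ l) := by
  simpa using h.swap [] l l' []

end SignedListFun

/-! ### Iterated products with the cubic classes -/

section Comb

variable (n : ℕ) {g : ℕ} {A : Type*} [Ring A] [Algebra ℚ A]
  (μ : Hyp g →ₗ[ℚ] Hyp g →ₗ[ℚ] Hyp g →ₗ[ℚ] A)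

/-- The linear form `v ↦ ∑ f(aᵢ) μ(aᵢ^#, w, v)`. -/
def step (w : Hyp g) : (Hyp g →ₗ[ℚ] A) →ₗ[ℚ] (Hyp g →ₗ[ℚ] A) where
  toFun f := ∑ i, LinearMap.mulLeft ℚ (f (bas g i)) ∘ₗ μ (sharp n g i) w
  map_add' f f' := by
    refine LinearMap.ext fun v => ?_
    simp [add_mul, Finset.sum_add_distrib, -Fintype.sum_sum_type]
  map_smul' q f := by
    refine LinearMap.ext fun v => ?_
    simp [Finset.smul_sum, -Fintype.sum_sum_type]

theorem step_apply (w : Hyp g) (f : Hyp g →ₗ[ℚ] A) (v : Hyp g) :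
    step n μ w f v = ∑ i, f (bas g i) * μ (sharp n g i) w v := by
  simp [step, -Fintype.sum_sum_type]

/-- The iterated application of `step`. -/
def fold : List (Hyp g) → (Hyp g →ₗ[ℚ] A) →ₗ[ℚ] (Hyp g →ₗ[ℚ] A)
  | [] => LinearMap.id
  | w :: l => fold l ∘ₗ step n μ w

/-- The value on a list of the family of multilinear forms which is `b` on the empty list, `f` on
singletons and is extended by `step`. -/
def comb : List (Hyp g) → (Hyp g →ₗ[ℚ] A) × A →ₗ[ℚ] A
  | [] => LinearMap.snd ℚ _ _
  | w :: l => comb l ∘ₗ LinearMap.prod (step n μ w) (LinearMap.applyₗ w) ∘ₗ LinearMap.fst ℚ _ _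

@[simp] theorem comb_nil (f : Hyp g →ₗ[ℚ] A) (b : A) : comb n μ [] (f, b) = b := rfl

theorem comb_cons (w : Hyp g) (l : List (Hyp g)) (f : Hyp g →ₗ[ℚ] A) (b : A) :
    comb n μ (w :: l) (f, b) = comb n μ l (step n μ w f, f w) := rfl

theorem comb_append (l l' : List (Hyp g)) (f : Hyp g →ₗ[ℚ] A) (b : A) :
    comb n μ (l ++ l') (f, b) = comb n μ l' (fold n μ l f, comb n μ l (f, b)) := by
  induction l generalizing f b with
  | nil => rfl
  | cons w l ih => rw [List.cons_append, comb_cons, ih, comb_cons]; rfl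

theorem comb_concat (l : List (Hyp g)) (v : Hyp g) (f : Hyp g →ₗ[ℚ] A) (b : A) :
    comb n μ (l ++ [v]) (f, b) = fold n μ l f v := by
  rw [comb_append]; rfl

/-- The second component of the state is read only on the empty list; the first letter overwrites
it. -/
theorem comb_congr {l : List (Hyp g)} (hl : l ≠ []) (f : Hyp g →ₗ[ℚ] A) (b b' : A) :
    comb n μ l (f, b) = comb n μ l (f, b') := by
  cases l with
  | nil => exact absurd rfl hl
  | cons w l => rfl

/-- Each step multiplies by `μ` on the right, so a left factor passes through without any
commutativity. -/
theorem comb_mul (l : List (Hyp g)) (a : A) (f : Hyp g →ₗ[ℚ] A) (b : A) :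
    comb n μ l (LinearMap.mulLeft ℚ a ∘ₗ f, a * b) = a * comb n μ l (f, b) := by
  induction l generalizing f b with
  | nil => rfl
  | cons w l ih =>
    rw [comb_cons, comb_cons, ← ih]
    congr 2
    refine LinearMap.ext fun v => ?_
    simp [step_apply, mul_assoc, -Fintype.sum_sum_type]

theorem step_linear (q q' : ℚ) (x y : Hyp g) :
    step n μ (q • x + q' • y) = q • step n μ x + q' • step n μ y := by
  refine LinearMap.ext fun f => LinearMap.ext fun v => ?_
  simp [step_apply, mul_add, Finset.sum_add_distrib, Finset.smul_sum, -Fintype.sum_sum_type]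

theorem comb_isMultilinear (p : (Hyp g →ₗ[ℚ] A) × A) : IsMultilinear fun l => comb n μ l p := by
  obtain ⟨f, b⟩ := p
  intro l₁ q q' x y l₂
  simp only [comb_append, comb_cons]
  rw [← map_smul, ← map_smul, ← map_add]
  congr 1
  exact Prod.ext (by simp [step_linear]) (by simp)

/-- The linear form `λ(x, -) • 1`. -/
def lam (A : Type*) [Ring A] [Algebra ℚ A] : Hyp g →ₗ[ℚ] Hyp g →ₗ[ℚ] A :=
  (pairingₗ n g).compr₂ (Algebra.linearMap ℚ A)

theorem lam_apply (x v : Hyp g) : lam n A x v = algebraMap ℚ A (pairingₗ n g x v) := rfl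

/-- This is the expansion `v = ∑ᵢ λ(aᵢ^#, v) aᵢ` inside `f`; scalars are central in `A`. -/
theorem sum_mulLeft_lam (f : Hyp g →ₗ[ℚ] A) :
    ∑ i, LinearMap.mulLeft ℚ (f (bas g i)) ∘ₗ lam n A (sharp n g i) = f := by
  refine LinearMap.ext fun v => ?_
  conv_rhs => rw [← sum_pairing_sharp_smul_bas n v, map_sum]
  simp only [LinearMap.sum_apply, LinearMap.comp_apply, LinearMap.mulLeft_apply, lam_apply,
    map_smul]
  simp only [Algebra.smul_def, Algebra.commutes]

/-- The family of multilinear forms which is `λ` on lists of length `2`, and `μ` on lists of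
length `3`. -/
def scal : List (Hyp g) → A
  | [] => 0
  | x :: l => comb n μ l (lam n A x, 0)

theorem scal_cons (x : Hyp g) (l : List (Hyp g)) : scal n μ (x :: l) = comb n μ l (lam n A x, 0) :=
  rfl

/-- Since `x = ∑ᵢ λ(x, aᵢ) aᵢ^#`, contraction with `λ` is the identity. This is why a recursion that
starts from `λ` produces `μ` on three vectors. -/
theorem step_lam (w x : Hyp g) : step n μ w (lam n A x) = μ x w := by
  refine LinearMap.ext fun v => ?_
  conv_rhs => rw [← sum_pairing_bas_smul_sharp n x, map_sum]
  simp only [step_apply, LinearMap.sum_apply, lam_apply, map_smul, LinearMap.smul_apply]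
  simp only [Algebra.smul_def]

theorem scal_triple (x y z : Hyp g) : scal n μ [x, y, z] = μ x y z := by
  rw [scal_cons, comb_cons, comb_cons, step_lam, comb_nil]

/-- Expand `f = ∑ᵢ f(aᵢ) λ(aᵢ^#, -)` and use linearity of `comb` in its state. All dependence on `f`
is thereby moved in front of the universal classes `scal`. -/
theorem comb_eq_sum {l : List (Hyp g)} (hl : l ≠ []) (f : Hyp g →ₗ[ℚ] A) (b : A) :
    comb n μ l (f, b) = ∑ i, f (bas g i) * scal n μ (sharp n g i :: l) := by
  simp only [scal_cons, ← comb_mul]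
  rw [← map_sum, comb_congr n μ hl f b 0]
  congr 1
  refine Prod.ext ?_ ?_
  · rw [Prod.fst_sum]
    exact (sum_mulLeft_lam n f).symm
  · rw [Prod.snd_sum]
    simp

/-- Contraction of `comb` with `scal`. -/
theorem sum_comb_mul_scal (l : List (Hyp g)) {l' : List (Hyp g)} (hl' : l' ≠ [])
    (f : Hyp g →ₗ[ℚ] A) (b : A) :
    ∑ i, comb n μ (l ++ [bas g i]) (f, b) * scal n μ (sharp n g i :: l') =
      comb n μ (l ++ l') (f, b) := by
  simp only [comb_concat]
  rw [comb_append, comb_eq_sum n μ hl']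

theorem sum_scal_mul_scal {l : List (Hyp g)} (hl : l ≠ []) {l' : List (Hyp g)} (hl' : l' ≠ []) :
    ∑ i, scal n μ (l ++ [bas g i]) * scal n μ (sharp n g i :: l') = scal n μ (l ++ l') := by
  cases l with
  | nil => exact absurd rfl hl
  | cons x l => exact sum_comb_mul_scal n μ l hl' _ _

theorem scal_isMultilinear : IsMultilinear (scal n μ) := by
  intro l₁ q q' x y l₂
  cases l₁ with
  | nil =>
    simp only [List.nil_append, scal_cons]
    rw [← map_smul, ← map_smul, ← map_add]
    congr 1
    exact Prod.ext (by simp) (by simp)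
  | cons z l₁ => exact comb_isMultilinear n μ _ l₁ q q' x y l₂

variable {μ}

/-- Two adjacent letters affect the state through the value after both and through the form on the
next vector. For the value, symmetry of `μ` in its last two arguments is enough; the form contains
two copies of `μ` and needs the associativity relation `h₂`. -/
theorem comb_isSigned (h₁ : ∀ u v w, μ u v w = (-1 : ℚ) ^ n • μ u w v)
    (h₂ : ∀ u v w x, ∑ i, μ u v (bas g i) * μ (sharp n g i) w x =
      ∑ i, μ u w (bas g i) * μ (sharp n g i) x v)
    (p : (Hyp g →ₗ[ℚ] A) × A) : IsSigned n fun l => comb n μ l p := by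
  obtain ⟨f, b⟩ := p
  intro l₁ x y l₂
  simp only [comb_append, comb_cons]
  rw [← map_smul]
  congr 1
  refine Prod.ext ?_ ?_
  · refine LinearMap.ext fun v => ?_
    have key : ∀ w w', step n μ w' (step n μ w (fold n μ l₁ f)) v = ∑ i, fold n μ l₁ f (bas g i) *
        ∑ j, μ (sharp n g i) w (bas g j) * μ (sharp n g j) w' v := by
      intro w w'
      simp only [step_apply, Finset.sum_mul, Finset.mul_sum, mul_assoc]
      exact Finset.sum_comm
    simp only [Prod.smul_mk, LinearMap.smul_apply]
    rw [key, key, Finset.smul_sum]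
    refine Finset.sum_congr rfl fun i _ => ?_
    -- `h₂` rotates the three vectors `x, y, v` to `y, v, x`; the sign comes from `h₁`, which moves
    -- `v` back to the end.
    rw [h₂, ← mul_smul_comm, Finset.smul_sum]
    congr 1
    refine Finset.sum_congr rfl fun j _ => ?_
    rw [h₁ _ v x, mul_smul_comm]
  · simp only [step_apply, Prod.smul_mk, Finset.smul_sum]
    refine Finset.sum_congr rfl fun i _ => ?_
    rw [h₁, mul_smul_comm]

/-- The new case is that of the first two letters, where the state is `(μ x y, λ(x, y))` and both
components are `(-1)^n`-symmetric. -/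
theorem scal_isSigned (h₀ : ∀ u v w, μ u v w = (-1 : ℚ) ^ n • μ v u w)
    (h₁ : ∀ u v w, μ u v w = (-1 : ℚ) ^ n • μ u w v)
    (h₂ : ∀ u v w x, ∑ i, μ u v (bas g i) * μ (sharp n g i) w x =
      ∑ i, μ u w (bas g i) * μ (sharp n g i) x v) : IsSigned n (scal n μ) := by
  intro l₁ x y l₂
  cases l₁ with
  | nil =>
    simp only [List.nil_append, scal_cons, comb_cons, step_lam]
    rw [← map_smul]
    congr 1
    refine Prod.ext ?_ ?_
    · refine LinearMap.ext fun v => ?_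
      exact h₀ x y v
    · simp only [lam_apply, Prod.smul_mk]
      rw [pairingₗ_symm, map_mul, Algebra.smul_def]
  | cons z l₁ => exact comb_isSigned n h₁ h₂ _ l₁ x y l₂

end Comb

/-- A map which preserves linear combinations of two vectors, as a linear map. -/
def linearMapOfComb {M N : Type*} [AddCommGroup M] [Module ℚ M] [AddCommGroup N] [Module ℚ N]
    (f : M → N) (hf : ∀ (q q' : ℚ) x y, f (q • x + q' • y) = q • f x + q' • f y) : M →ₗ[ℚ] N where
  toFun := f
  map_add' x y := by simpa using hf 1 1 x y
  map_smul' q x := by simpa using hf q 0 x x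

@[simp] theorem linearMapOfComb_apply {M N : Type*} [AddCommGroup M] [Module ℚ M] [AddCommGroup N]
    [Module ℚ N] (f : M → N) (hf) (x : M) : linearMapOfComb f hf x = f x := rfl

/-- A function of three vectors which preserves linear combinations in each argument, as a trilinear
map. -/
def trilinearMapOfComb {M A : Type*} [AddCommGroup M] [Module ℚ M] [Ring A] [Algebra ℚ A]
    (f : M → M → M → A)
    (h₁ : ∀ (q q' : ℚ) u u' v w, f (q • u + q' • u') v w = q • f u v w + q' • f u' v w)
    (h₂ : ∀ (q q' : ℚ) u v v' w, f u (q • v + q' • v') w = q • f u v w + q' • f u v' w)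
    (h₃ : ∀ (q q' : ℚ) u v w w', f u v (q • w + q' • w') = q • f u v w + q' • f u v w') :
    M →ₗ[ℚ] M →ₗ[ℚ] M →ₗ[ℚ] A :=
  linearMapOfComb (fun u => linearMapOfComb (fun v => linearMapOfComb (f u v)
    (fun q q' w w' => h₃ q q' u v w w'))
    (fun q q' v v' => LinearMap.ext fun w => h₂ q q' u v v' w))
    (fun q q' u u' => LinearMap.ext fun v => LinearMap.ext fun w => h₁ q q' u u' v w)

/-! ### The generators of the small presentation as linear maps -/

section SmallPresGen

variable {V : Type u} [CommRing V] [Algebra ℚ V] {n : ℕ} {𝒱 : ℕ → Submodule ℚ V}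
  [GradedAlgebra 𝒱] (hn : 0 < n) (e : 𝒱 (2 * n)) (g : ℕ)

/-- The projection to the homogeneous elements of degree `d`. -/
def homProj (𝒱 : ℕ → Submodule ℚ V) [GradedAlgebra 𝒱] (d : ℕ) : V →ₗ[ℚ] 𝒱 d :=
  DirectSum.component ℚ ℕ (fun i => 𝒱 i) d ∘ₗ (DirectSum.decomposeLinearEquiv 𝒱).toLinearMap

theorem homProj_of_mem {d : ℕ} {c : V} (hc : c ∈ 𝒱 d) : homProj 𝒱 d c = ⟨c, hc⟩ := by
  apply Subtype.ext
  exact DirectSum.decompose_of_mem_same 𝒱 hc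

theorem homProj_eq_zero {d : ℕ} (h : 𝒱 d = ⊥) (c : V) : homProj 𝒱 d c = 0 :=
  Subtype.ext ((Submodule.eq_bot_iff _).1 h _ (homProj 𝒱 d c).2)

theorem SmallPres.rel {x y : FreeAlgebra ℚ (Gen n 𝒱 g)} (h : Rel hn e x y) :
    RingQuot.mkAlgHom ℚ (Rel (g := g) hn e) x = RingQuot.mkAlgHom ℚ (Rel (g := g) hn e) y :=
  RingQuot.mkAlgHom_rel ℚ h

theorem SmallPres.mk_ι (x : Gen n 𝒱 g) :
    RingQuot.mkAlgHom ℚ (Rel (g := g) hn e) (FreeAlgebra.ι ℚ x) = SmallPres.gen hn e x := rfl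

/-- The class `κ_c`, as a linear function of `c`. -/
def smallK0 (d : ℕ) : V →ₗ[ℚ] SmallPres hn e g :=
  if h : 2 * n < d then
    linearMapOfComb (fun c : 𝒱 d => SmallPres.gen hn e (g := g) (.k0 h c)) (fun q q' c c' => by
      have := SmallPres.rel hn e g (Rel.lin0 h c c' q q')
      simpa only [map_add, map_smul, SmallPres.mk_ι] using this) ∘ₗ homProj 𝒱 d
  -- For `n < d ≤ 2n` this zero is still part of the initial state of `posKappa`, but it has no
  -- effect on nonempty lists.
  else 0

theorem smallK0_of_mem {d : ℕ} (h : 2 * n < d) {c : V} (hc : c ∈ 𝒱 d) :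
    smallK0 hn e g d c = SmallPres.gen hn e (.k0 h ⟨c, hc⟩) := by
  rw [smallK0, dif_pos h, LinearMap.comp_apply, homProj_of_mem hc, linearMapOfComb_apply]

/-- The class `κ_c(v)`, as a bilinear function of `c` and `v`. -/
def smallK1 (d : ℕ) : V →ₗ[ℚ] Hyp g →ₗ[ℚ] SmallPres hn e g :=
  if h : n < d then
    linearMapOfComb (fun c : 𝒱 d =>
      linearMapOfComb (fun v : Hyp g => SmallPres.gen hn e (.k1 h c v)) (fun q q' v v' => by
        have := SmallPres.rel hn e g (Rel.lin1v h c q q' v v')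
        simpa only [map_add, map_smul, SmallPres.mk_ι] using this)) (fun q q' c c' => by
      refine LinearMap.ext fun v => ?_
      have := SmallPres.rel hn e g (Rel.lin1 h c c' q q' v)
      simpa only [map_add, map_smul, SmallPres.mk_ι, linearMapOfComb_apply, LinearMap.add_apply,
        LinearMap.smul_apply] using this) ∘ₗ homProj 𝒱 d
  else 0

theorem smallK1_of_mem {d : ℕ} (h : n < d) {c : V} (hc : c ∈ 𝒱 d) (v : Hyp g) :
    smallK1 hn e g d c v = SmallPres.gen hn e (.k1 h ⟨c, hc⟩ v) := by
  rw [smallK1, dif_pos h, LinearMap.comp_apply, homProj_of_mem hc]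
  rfl

/-- The class `κ_1(u ⊗ v ⊗ w)`, as a trilinear function. -/
def smallK3 : Hyp g →ₗ[ℚ] Hyp g →ₗ[ℚ] Hyp g →ₗ[ℚ] SmallPres hn e g :=
  trilinearMapOfComb (fun u v w => SmallPres.gen hn e (.k3 ![u, v, w]))
    (fun q q' u u' v w => by
      have := SmallPres.rel hn e g (Rel.lin3 ![0, v, w] 0 q q' u u')
      have h : ∀ z, Function.update (![0, v, w] : Fin 3 → Hyp g) 0 z = ![z, v, w] := fun z => by
        funext i; fin_cases i <;> rfl
      simpa only [map_add, map_smul, SmallPres.mk_ι, h] using this)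
    (fun q q' u v v' w => by
      have := SmallPres.rel hn e g (Rel.lin3 ![u, 0, w] 1 q q' v v')
      have h : ∀ z, Function.update (![u, 0, w] : Fin 3 → Hyp g) 1 z = ![u, z, w] := fun z => by
        funext i; fin_cases i <;> rfl
      simpa only [map_add, map_smul, SmallPres.mk_ι, h] using this)
    (fun q q' u v w w' => by
      have := SmallPres.rel hn e g (Rel.lin3 ![u, v, 0] 2 q q' w w')
      have h : ∀ z, Function.update (![u, v, 0] : Fin 3 → Hyp g) 2 z = ![u, v, z] := fun z => by
        funext i; fin_cases i <;> rfl
      simpa only [map_add, map_smul, SmallPres.mk_ι, h] using this)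

theorem smallK3_apply (u v w : Hyp g) :
    smallK3 hn e g u v w = SmallPres.gen hn e (.k3 ![u, v, w]) := rfl

variable {g}

theorem smallK3_swap_left (u v w : Hyp g) :
    smallK3 hn e g u v w = (-1 : ℚ) ^ n • smallK3 hn e g v u w := by
  have := SmallPres.rel hn e g (Rel.alpha (Equiv.swap 0 1) ![v, u, w])
  rw [map_smul] at this
  have h : (![v, u, w] : Fin 3 → Hyp g) ∘ Equiv.swap 0 1 = ![u, v, w] := by
    funext i; fin_cases i <;> rfl
  rw [h, Equiv.Perm.sign_swap (by decide)] at this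
  simpa [SmallPres.mk_ι, smallK3_apply] using this

theorem smallK3_swap_right (u v w : Hyp g) :
    smallK3 hn e g u v w = (-1 : ℚ) ^ n • smallK3 hn e g u w v := by
  have := SmallPres.rel hn e g (Rel.alpha (Equiv.swap 1 2) ![u, w, v])
  rw [map_smul] at this
  have h : (![u, w, v] : Fin 3 → Hyp g) ∘ Equiv.swap 1 2 = ![u, v, w] := by
    funext i; fin_cases i <;> rfl
  rw [h, Equiv.Perm.sign_swap (by decide)] at this
  simpa [SmallPres.mk_ι, smallK3_apply] using this

theorem smallK3_assoc (u v w x : Hyp g) :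
    ∑ i, smallK3 hn e g u v (bas g i) * smallK3 hn e g (sharp n g i) w x =
      ∑ i, smallK3 hn e g u w (bas g i) * smallK3 hn e g (sharp n g i) x v := by
  have := SmallPres.rel hn e g (Rel.epsilon u v w x)
  simpa only [map_sum, map_mul, SmallPres.mk_ι, smallK3_apply] using this

/-! ### Graded commutativity -/

/-- The elements which commute with the generators as elements of degree `b` do. -/
def superCentral (b : ℕ) : Submodule ℚ (SmallPres hn e g) where
  carrier := {x | ∀ y, x * SmallPres.gen hn e y =
    (-1 : ℚ) ^ (b * y.deg) • (SmallPres.gen hn e y * x)}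
  zero_mem' y := by simp
  add_mem' {x x'} h h' y := by rw [add_mul, h y, h' y, mul_add, smul_add]
  smul_mem' q x h y := by rw [smul_mul_assoc, h y, mul_smul_comm, smul_comm]

/-- The elements which commute with all `superCentral` elements as elements of degree `b` do. -/
def superBicentral (b : ℕ) : Submodule ℚ (SmallPres hn e g) where
  carrier := {y | ∀ a, ∀ x ∈ superCentral hn e (g := g) a, x * y = (-1 : ℚ) ^ (a * b) • (y * x)}
  zero_mem' a x _ := by simp
  add_mem' {y y'} h h' a x hx := by rw [mul_add, h a x hx, h' a x hx, add_mul, smul_add]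
  smul_mem' q y h a x hx := by rw [mul_smul_comm, h a x hx, smul_mul_assoc, smul_comm]

theorem gen_mem_superBicentral (y : Gen n 𝒱 g) :
    SmallPres.gen hn e y ∈ superBicentral hn e y.deg := fun _ _ hx => hx y

theorem gen_mem_superCentral (x : Gen n 𝒱 g) :
    SmallPres.gen hn e x ∈ superCentral hn e x.deg := fun y => by
  have := SmallPres.rel hn e g (Rel.comm x y)
  simpa only [map_mul, map_smul, SmallPres.mk_ι] using this

variable {hn e}

/-- A bicommutant argument: the generators are supercentral by the relation `comm`, so whatever
supercommutes with all supercentral elements supercommutes with them. Hence any two elements of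
these subspaces supercommute, and no induction on words is needed. -/
theorem mem_superCentral_of_mem {b : ℕ} {y : SmallPres hn e g} (hy : y ∈ superBicentral hn e b) :
    y ∈ superCentral hn e b := fun z => by
  rw [hy _ _ (gen_mem_superCentral hn e z), smul_smul, mul_comm z.deg, neg_one_pow_mul_self,
    one_smul]

theorem superBicentral_comm {a b : ℕ} {x y : SmallPres hn e g} (hx : x ∈ superBicentral hn e a)
    (hy : y ∈ superBicentral hn e b) : x * y = (-1 : ℚ) ^ (a * b) • (y * x) :=
  hy _ _ (mem_superCentral_of_mem hx)

theorem superBicentral_mul {a b : ℕ} {x y : SmallPres hn e g} (hx : x ∈ superBicentral hn e a)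
    (hy : y ∈ superBicentral hn e b) : x * y ∈ superBicentral hn e (a + b) := fun c z hz => by
  rw [← mul_assoc, hx _ _ hz, smul_mul_assoc, mul_assoc, hy _ _ hz, mul_smul_comm, smul_smul,
    mul_assoc, ← pow_add, mul_add]

theorem superBicentral_algebraMap (q : ℚ) :
    algebraMap ℚ (SmallPres hn e g) q ∈ superBicentral hn e 0 := fun c z _ => by
  rw [mul_zero, pow_zero, one_smul, Algebra.commutes]

/-- Only the parity of the degree enters the signs. -/
theorem superBicentral_congr {a b : ℕ} (h : (-1 : ℚ) ^ a = (-1) ^ b) :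
    superBicentral hn e (g := g) a = superBicentral hn e b := by
  have : ∀ c : ℕ, (-1 : ℚ) ^ (c * a) = (-1) ^ (c * b) := fun c => by
    rw [mul_comm, pow_mul, h, ← pow_mul, mul_comm]
  ext y
  simp only [superBicentral, Submodule.mem_mk, AddSubmonoid.mem_mk, AddSubsemigroup.mem_mk,
    Set.mem_ofPred_eq, this]

theorem smallK3_mem (u v w : Hyp g) : smallK3 hn e g u v w ∈ superBicentral hn e n :=
  gen_mem_superBicentral hn e (.k3 ![u, v, w])

theorem smallK0_mem (hodd : ∀ k, Odd k → 𝒱 k = ⊥) (d : ℕ) (c : V) :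
    smallK0 hn e g d c ∈ superBicentral hn e 0 := by
  by_cases h : 2 * n < d
  · rcases Nat.even_or_odd d with hd | hd
    · have := gen_mem_superBicentral hn e (g := g) (.k0 h (homProj 𝒱 d c))
      rw [superBicentral_congr (b := 0)] at this
      · rwa [smallK0, dif_pos h]
      · rw [Even.neg_one_pow, pow_zero]
        exact (Nat.even_sub h.le).2 (by simp [hd])
    · rw [smallK0, dif_pos h, LinearMap.comp_apply, homProj_eq_zero (hodd d hd), map_zero]
      exact Submodule.zero_mem _
  · rw [smallK0, dif_neg h]
    exact Submodule.zero_mem _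

/-- For even `d` the degree `d - n` has the parity of `n`; for odd `d` the class vanishes because
its label does. -/
theorem smallK1_mem (hodd : ∀ k, Odd k → 𝒱 k = ⊥) (d : ℕ) (c : V) (v : Hyp g) :
    smallK1 hn e g d c v ∈ superBicentral hn e n := by
  by_cases h : n < d
  · rcases Nat.even_or_odd d with hd | hd
    · have := gen_mem_superBicentral hn e (g := g) (.k1 h (homProj 𝒱 d c) v)
      rw [superBicentral_congr (b := n)] at this
      · rwa [smallK1, dif_pos h]
      · obtain ⟨k, rfl⟩ := Nat.exists_eq_add_of_lt h
        simp only [Gen.deg]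
        rw [show n + k + 1 - n = k + 1 by omega]
        rw [add_assoc, Nat.even_add] at hd
        rcases Nat.even_or_odd n with hn' | hn'
        · rw [hn'.neg_one_pow, (hd.1 hn').neg_one_pow]
        · rw [hn'.neg_one_pow, (Nat.not_even_iff_odd.1
            (fun h' => Nat.not_even_iff_odd.2 hn' (hd.2 h'))).neg_one_pow]
    · rw [smallK1, dif_pos h, LinearMap.comp_apply, homProj_eq_zero (hodd d hd), map_zero]
      exact Submodule.zero_mem _
  · rw [smallK1, dif_neg h]
    exact Submodule.zero_mem _

theorem comb_mem {p : ℕ} (l : List (Hyp g)) (f : Hyp g →ₗ[ℚ] SmallPres hn e g)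
    (b : SmallPres hn e g) (hf : ∀ v, f v ∈ superBicentral hn e (p + n))
    (hb : b ∈ superBicentral hn e p) :
    comb n (smallK3 hn e g) l (f, b) ∈ superBicentral hn e (p + n * l.length) := by
  induction l generalizing p f b with
  | nil => exact hb
  | cons w l ih =>
    rw [comb_cons, List.length_cons, mul_add, mul_one, add_comm (n * _), ← add_assoc]
    refine ih _ _ (fun v => ?_) (hf w)
    rw [step_apply]
    exact Submodule.sum_mem _ fun i _ => superBicentral_mul (hf _) (smallK3_mem _ _ _)

theorem scal_mem (l : List (Hyp g)) :
    scal n (smallK3 hn e g) l ∈ superBicentral hn e (n * l.length) := by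
  cases l with
  | nil => exact Submodule.zero_mem _
  | cons x l =>
    rw [List.length_cons, mul_add, mul_one, add_comm]
    refine comb_mem l _ _ (fun v => ?_) (Submodule.zero_mem _)
    rw [superBicentral_congr (b := 0) (by rw [pow_add, neg_one_pow_mul_self, pow_zero])]
    exact superBicentral_algebraMap _

end SmallPresGen

/-! ### The classes `κ_c(v₁ ⊗ ⋯ ⊗ v_r)` in the small presentation -/

theorem label_cases {V : Type u} [CommRing V] [Algebra ℚ V] {n : ℕ} {𝒱 : ℕ → Submodule ℚ V}
    (h0 : 𝒱 0 = Submodule.span ℚ {1}) (hlow : ∀ k, 0 < k → k ≤ n → 𝒱 k = ⊥)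
    {d : ℕ} {c : V} (hc : c ∈ 𝒱 d) : (d = 0 ∧ ∃ q : ℚ, c = q • 1) ∨ n < d ∨ c = 0 := by
  rcases Nat.eq_zero_or_pos d with rfl | hd
  · rw [h0, Submodule.mem_span_singleton] at hc
    obtain ⟨q, rfl⟩ := hc
    exact Or.inl ⟨rfl, q, rfl⟩
  · rcases Nat.lt_or_ge n d with h | h
    · exact Or.inr (Or.inl h)
    · rw [hlow d hd h] at hc
      exact Or.inr (Or.inr ((Submodule.mem_bot ℚ).1 hc))

section SmallPresKappa

variable {V : Type u} [CommRing V] [Algebra ℚ V] {n : ℕ} {𝒱 : ℕ → Submodule ℚ V}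
  [GradedAlgebra 𝒱] {hn : 0 < n} {e : 𝒱 (2 * n)} {g : ℕ}

variable (hn e) in
/-- The class `κ_c(v₁ ⊗ ⋯ ⊗ v_r)` for a label `c` of degree `d > 0`. -/
def posKappa (d : ℕ) (c : V) (l : List (Hyp g)) : SmallPres hn e g :=
  comb n (smallK3 hn e g) l (smallK1 hn e g d c, smallK0 hn e g d c)

variable (hn e) in
/-- The class `κ_1(v₁ ⊗ ⋯ ⊗ v_r)`. -/
def unitKappa (l : List (Hyp g)) : SmallPres hn e g := scal n (smallK3 hn e g) l

theorem posKappa_nil (d : ℕ) (c : V) : posKappa hn e (g := g) d c [] = smallK0 hn e g d c := rfl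

theorem posKappa_singleton (d : ℕ) (c : V) (v : Hyp g) :
    posKappa hn e d c [v] = smallK1 hn e g d c v := rfl

theorem posKappa_isMultilinear (d : ℕ) (c : V) : IsMultilinear (posKappa hn e (g := g) d c) :=
  comb_isMultilinear n _ _

theorem unitKappa_isMultilinear : IsMultilinear (unitKappa hn e (g := g)) :=
  scal_isMultilinear n _

theorem posKappa_isSigned (d : ℕ) (c : V) : IsSigned n (posKappa hn e (g := g) d c) :=
  comb_isSigned n (smallK3_swap_right hn e) (smallK3_assoc hn e) _

theorem unitKappa_isSigned : IsSigned n (unitKappa hn e (g := g)) :=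
  scal_isSigned n (smallK3_swap_left hn e) (smallK3_swap_right hn e) (smallK3_assoc hn e)

theorem posKappa_mem (hodd : ∀ k, Odd k → 𝒱 k = ⊥) (d : ℕ) (c : V) (l : List (Hyp g)) :
    posKappa hn e d c l ∈ superBicentral hn e (n * l.length) := by
  have := comb_mem (hn := hn) (e := e) (p := 0) l (smallK1 hn e g d c) (smallK0 hn e g d c)
    (fun v => by rw [zero_add]; exact smallK1_mem hodd d c v) (smallK0_mem hodd d c)
  rwa [zero_add] at this

theorem unitKappa_mem (l : List (Hyp g)) : unitKappa hn e l ∈ superBicentral hn e (n * l.length) :=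
  scal_mem l

theorem posKappa_eq_sum (d : ℕ) (c : V) {l : List (Hyp g)} (hl : l ≠ []) :
    posKappa hn e d c l = ∑ i, smallK1 hn e g d c (bas g i) * unitKappa hn e (sharp n g i :: l) :=
  comb_eq_sum n _ hl _ _

theorem sum_unitKappa_mul_unitKappa {l l' : List (Hyp g)} (hl : l ≠ []) (hl' : l' ≠ []) :
    ∑ i, unitKappa hn e (l ++ [bas g i]) * unitKappa hn e (sharp n g i :: l') =
      unitKappa hn e (l ++ l') :=
  sum_scal_mul_scal n _ hl hl'

theorem sum_posKappa_mul_unitKappa (d : ℕ) (c : V) (l : List (Hyp g)) {l' : List (Hyp g)}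
    (hl' : l' ≠ []) :
    ∑ i, posKappa hn e d c (l ++ [bas g i]) * unitKappa hn e (sharp n g i :: l') =
      posKappa hn e d c (l ++ l') :=
  sum_comb_mul_scal n _ l hl' _ _

/-- The recursion appends unit classes on the right. To absorb one on the left, the two factors are
commuted, the contracted entries are rotated to the other ends, and `ω` is flipped. -/
theorem sum_unitKappa_mul_posKappa (hodd : ∀ k, Odd k → 𝒱 k = ⊥) (d : ℕ) (c : V)
    {l : List (Hyp g)} (hl : l ≠ []) (l' : List (Hyp g)) :
    ∑ i, unitKappa hn e (l ++ [bas g i]) * posKappa hn e d c (sharp n g i :: l') =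
      posKappa hn e d c (l ++ l') := by
  have h1 : ∀ x y : Hyp g, unitKappa hn e (l ++ [x]) * posKappa hn e d c (y :: l') =
      (-1 : ℚ) ^ (n * (l.length + 1) * (n * (l'.length + 1)) + n * l'.length + n * l.length) •
        (posKappa hn e d c (l' ++ [y]) * unitKappa hn e (x :: l)) := by
    intro x y
    rw [superBicentral_comm (unitKappa_mem _) (posKappa_mem hodd _ _ _)]
    have e1 := (posKappa_isSigned (hn := hn) (e := e) d c).rotate [y] l'
    have e2 := (unitKappa_isSigned (hn := hn) (e := e)).rotate l [x]
    simp only [List.singleton_append, List.length_singleton, mul_one] at e1 e2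
    rw [e1, e2, smul_mul_assoc, mul_smul_comm, smul_smul, smul_smul, pow_add, pow_add]
    simp only [List.length_append, List.length_cons, List.length_nil, zero_add]
  have h2 := sum_sharp_bas n (g := g)
    (fun x y => posKappa hn e d c (l' ++ [x]) * unitKappa hn e (y :: l))
    (fun q x y => by
      rw [(posKappa_isMultilinear (hn := hn) (e := e) d c).smul_mid, smul_mul_assoc])
    (fun q x y => by
      have := (unitKappa_isMultilinear (hn := hn) (e := e)).smul_mid [] q y l
      rw [List.nil_append, List.nil_append] at this
      rw [this, mul_smul_comm])
  simp only [h1, ← Finset.smul_sum]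
  rw [h2, sum_posKappa_mul_unitKappa d c l' hl, (posKappa_isSigned d c).rotate l' l, smul_smul,
    smul_smul, ← pow_add, ← pow_add]
  -- The signs of the commutation, of the three rotations and of flipping `ω` have total exponent
  -- `n(n+1)(|l|+1)(|l'|+1)`, which is even.
  rw [Even.neg_one_pow, one_smul]
  have : Even (n * (n + 1) * ((l.length + 1) * (l'.length + 1))) :=
    (Nat.even_mul_succ_self n).mul_right _
  convert this using 1
  ring

theorem sum_smallK1_mul_smallK1 {d d' : ℕ} (hd : n < d) (hd' : n < d') {c c' : V} (hc : c ∈ 𝒱 d)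
    (hc' : c' ∈ 𝒱 d') :
    ∑ i, smallK1 hn e g d c (bas g i) * smallK1 hn e g d' c' (sharp n g i) =
      smallK0 hn e g (d + d') (c * c') := by
  have := SmallPres.rel hn e g (Rel.beta hd hd' ⟨c, hc⟩ ⟨c', hc'⟩)
  rw [smallK0_of_mem hn e g (by omega) (SetLike.GradedMul.mul_mem hc hc')]
  simp only [smallK1_of_mem hn e g hd hc, smallK1_of_mem hn e g hd' hc']
  simpa only [map_sum, map_mul, SmallPres.mk_ι] using this.symm

/-- This is relation `γ`, once `κ_{c'}(aᵢ^# ⊗ v)` has been expanded by the recursion. -/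
theorem sum_smallK1_mul_posKappa_pair (hodd : ∀ k, Odd k → 𝒱 k = ⊥) {d d' : ℕ} (hd : n < d)
    (hd' : n < d') {c c' : V} (hc : c ∈ 𝒱 d) (hc' : c' ∈ 𝒱 d') (v : Hyp g) :
    ∑ i, smallK1 hn e g d c (bas g i) * posKappa hn e d' c' [sharp n g i, v] =
      smallK1 hn e g (d + d') (c * c') v := by
  have h1 : ∀ x y z w : Hyp g, smallK1 hn e g d c x * (smallK1 hn e g d' c' y *
      smallK3 hn e g z w v) =
      smallK3 hn e g v z w * smallK1 hn e g d c x * smallK1 hn e g d' c' y := by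
    intro x y z w
    -- The product of the two linear classes has parity `n + n`, so the cubic class passes it
    -- without sign; two transpositions then bring `v` to its first argument.
    rw [← mul_assoc, superBicentral_comm (superBicentral_mul (smallK1_mem hodd d c x)
      (smallK1_mem hodd d' c' y)) (smallK3_mem z w v), smallK3_swap_right hn e z w v,
      smallK3_swap_left hn e z v w, smul_smul, smul_mul_assoc, smul_smul, neg_one_pow_mul_self,
      mul_one, add_mul, pow_add, neg_one_pow_mul_self, one_smul, mul_assoc]
  have h2 : ∀ x y, posKappa hn e d' c' [x, y] =
      ∑ j, smallK1 hn e g d' c' (bas g j) * smallK3 hn e g (sharp n g j) x y := by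
    intro x y
    exact step_apply n _ _ _ _
  simp only [h2, Finset.mul_sum, h1]
  -- Relation `γ` has the dual vectors in the linear classes, so both copies of `ω` are flipped, at
  -- the cost of two signs which cancel.
  have h3 : ∀ i, ∑ j, smallK3 hn e g v (sharp n g j) (sharp n g i) * smallK1 hn e g d c (bas g i) *
      smallK1 hn e g d' c' (bas g j) = (-1 : ℚ) ^ n • ∑ j, smallK3 hn e g v (bas g j) (sharp n g i) *
        smallK1 hn e g d c (bas g i) * smallK1 hn e g d' c' (sharp n g j) := fun i =>
    sum_sharp_bas n (fun x y => smallK3 hn e g v x (sharp n g i) *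
      smallK1 hn e g d c (bas g i) * smallK1 hn e g d' c' y) (by simp) (by simp)
  have h4 := sum_sharp_bas n (fun x y => ∑ j, smallK3 hn e g v (bas g j) x *
        smallK1 hn e g d c y * smallK1 hn e g d' c' (sharp n g j))
        (fun q x y => by simp only [map_smul, smul_mul_assoc, Finset.smul_sum])
        (fun q x y => by simp only [map_smul, smul_mul_assoc, mul_smul_comm, Finset.smul_sum])
  simp only [h3]
  rw [← Finset.smul_sum, h4, smul_smul, neg_one_pow_mul_self, one_smul]
  have := SmallPres.rel hn e g (Rel.gamma hd hd' ⟨c, hc⟩ ⟨c', hc'⟩ v)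
  rw [smallK1_of_mem hn e g (by omega) (SetLike.GradedMul.mul_mem hc hc')]
  simp only [smallK1_of_mem hn e g hd hc, smallK1_of_mem hn e g hd' hc', smallK3_apply]
  simpa only [map_sum, map_mul, SmallPres.mk_ι] using this.symm

/-- Write the first class as `∑ⱼ κ_c(aⱼ) κ_1(aⱼ^# ⊗ l ⊗ aᵢ)` and let the second class absorb the
unit class. What remains is `∑ⱼ κ_c(aⱼ) κ_{c'}(aⱼ^# ⊗ l ⊗ l')`. If `l` and `l'` are empty this is
`β`. Otherwise `κ_{c'}` is split again, so that the part which meets `κ_c(aⱼ)` carries a single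
further vector and `γ` applies. -/
theorem sum_posKappa_mul_posKappa (hodd : ∀ k, Odd k → 𝒱 k = ⊥) {d d' : ℕ} (hd : n < d)
    (hd' : n < d') {c c' : V} (hc : c ∈ 𝒱 d) (hc' : c' ∈ 𝒱 d') (l l' : List (Hyp g)) :
    ∑ i, posKappa hn e d c (l ++ [bas g i]) * posKappa hn e d' c' (sharp n g i :: l') =
      posKappa hn e (d + d') (c * c') (l ++ l') := by
  have h1 : ∀ i, posKappa hn e d c (l ++ [bas g i]) * posKappa hn e d' c' (sharp n g i :: l') =
      ∑ j, smallK1 hn e g d c (bas g j) * (unitKappa hn e ((sharp n g j :: l) ++ [bas g i]) *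
        posKappa hn e d' c' (sharp n g i :: l')) := fun i => by
    rw [posKappa_eq_sum d c (by simp), Finset.sum_mul]
    exact Finset.sum_congr rfl fun j _ => mul_assoc _ _ _
  simp only [h1]
  rw [Finset.sum_comm]
  simp only [← Finset.mul_sum]
  rw [Finset.sum_congr rfl fun j _ => by
    rw [sum_unitKappa_mul_posKappa hodd d' c' (l := sharp n g j :: l) (by simp) l',
      List.cons_append]]
  generalize l ++ l' = l
  cases l with
  | nil => exact sum_smallK1_mul_smallK1 hd hd' hc hc'
  | cons w l =>
    have h2 : ∀ j, posKappa hn e d' c' (sharp n g j :: w :: l) =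
        ∑ i, posKappa hn e d' c' [sharp n g j, bas g i] * unitKappa hn e (sharp n g i :: w :: l) :=
      fun j => (sum_posKappa_mul_unitKappa d' c' [sharp n g j] (by simp)).symm
    simp only [h2, Finset.mul_sum]
    rw [Finset.sum_comm]
    simp only [← mul_assoc, ← Finset.sum_mul]
    rw [Finset.sum_congr rfl fun j _ => by
      rw [sum_smallK1_mul_posKappa_pair hodd hd hd' hc hc']]
    exact (posKappa_eq_sum _ _ (by simp)).symm

/-- By the recursion, the last two letters enter through one cubic class `κ_1(aⱼ^# ⊗ aᵢ ⊗ aᵢ^#)`,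
whose sum over `i` is `κ_e(aⱼ^#)` by `δ`. -/
theorem sum_comb_self (l : List (Hyp g)) (f : Hyp g →ₗ[ℚ] SmallPres hn e g)
    (b : SmallPres hn e g) :
    ∑ i, comb n (smallK3 hn e g) (l ++ [bas g i, sharp n g i]) (f, b) =
      ∑ i, comb n (smallK3 hn e g) (l ++ [bas g i]) (f, b) *
        posKappa hn e (2 * n) (e : V) [sharp n g i] := by
  have h1 : ∀ x y, comb n (smallK3 hn e g) (l ++ [x, y]) (f, b) =
      ∑ j, comb n (smallK3 hn e g) (l ++ [bas g j]) (f, b) * smallK3 hn e g (sharp n g j) x y := by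
    intro x y
    simp only [comb_concat]
    rw [comb_append]
    exact step_apply n _ _ _ _
  simp only [h1]
  rw [Finset.sum_comm]
  simp only [← Finset.mul_sum]
  refine Finset.sum_congr rfl fun i _ => ?_
  have := SmallPres.rel hn e g (Rel.delta (sharp n g i))
  rw [posKappa_singleton, smallK1_of_mem hn e g (by omega) e.2]
  simp only [smallK3_apply]
  congr 1
  simpa only [map_sum, SmallPres.mk_ι] using this

variable [Nontrivial V]

variable (V) in
/-- A linear functional on `V` with value `1` at `1`. -/
def unitFunctional : V →ₗ[ℚ] ℚ :=
  Classical.choose (Module.Projective.exists_dual_eq_one ℚ (one_ne_zero (α := V)))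

theorem unitFunctional_one : unitFunctional V 1 = 1 :=
  Classical.choose_spec (Module.Projective.exists_dual_eq_one ℚ (one_ne_zero (α := V)))

variable (hn e) in
/-- The class `κ_c(v₁ ⊗ ⋯ ⊗ v_r)` for a label `c` of degree `d`. -/
def smallKappa (d : ℕ) (c : V) (l : List (Hyp g)) : SmallPres hn e g :=
  if d = 0 then unitFunctional V c • unitKappa hn e l else posKappa hn e d c l

theorem smallKappa_of_pos {d : ℕ} (hd : 0 < d) (c : V) (l : List (Hyp g)) :
    smallKappa hn e d c l = posKappa hn e d c l := if_neg hd.ne'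

/-- Labels of degree zero will be multiples of `1`, so the choice of `unitFunctional` away from `ℚ ·
1` is immaterial. -/
theorem smallKappa_zero (q : ℚ) (l : List (Hyp g)) :
    smallKappa hn e 0 (q • (1 : V)) l = q • unitKappa hn e l := by
  rw [smallKappa, if_pos rfl, map_smul, unitFunctional_one, smul_eq_mul, mul_one]

theorem smallKappa_linear (d : ℕ) (q q' : ℚ) (c c' : V) (l : List (Hyp g)) :
    smallKappa hn e d (q • c + q' • c') l =
      q • smallKappa hn e d c l + q' • smallKappa hn e d c' l := by
  unfold smallKappa
  split_ifs
  · simp only [map_add, map_smul, add_smul, smul_smul, smul_eq_mul]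
  · unfold posKappa
    rw [← map_smul, ← map_smul, ← map_add]
    congr 1
    exact Prod.ext (by simp) (by simp)

theorem smallKappa_zero_label (d : ℕ) (l : List (Hyp g)) : smallKappa hn e d (0 : V) l = 0 := by
  simpa using smallKappa_linear (hn := hn) (e := e) d 0 0 (0 : V) 0 l

theorem smallKappa_smul (d : ℕ) (q : ℚ) (c : V) (l : List (Hyp g)) :
    smallKappa hn e d (q • c) l = q • smallKappa hn e d c l := by
  simpa using smallKappa_linear (hn := hn) (e := e) d q 0 c 0 l

theorem smallKappa_isMultilinear (d : ℕ) (c : V) : IsMultilinear (smallKappa hn e (g := g) d c) := by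
  intro l₁ q q' x y l₂
  unfold smallKappa
  split_ifs
  · rw [unitKappa_isMultilinear, smul_add, smul_comm _ q, smul_comm _ q']
  · exact posKappa_isMultilinear d c l₁ q q' x y l₂

theorem smallKappa_isSigned (d : ℕ) (c : V) : IsSigned n (smallKappa hn e (g := g) d c) := by
  intro l₁ x y l₂
  unfold smallKappa
  split_ifs
  · rw [unitKappa_isSigned, smul_comm]
  · exact posKappa_isSigned d c l₁ x y l₂

theorem smallKappa_mem (hodd : ∀ k, Odd k → 𝒱 k = ⊥) (d : ℕ) (c : V) (l : List (Hyp g)) :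
    smallKappa hn e d c l ∈ superBicentral hn e (n * l.length) := by
  unfold smallKappa
  split_ifs
  · exact Submodule.smul_mem _ _ (unitKappa_mem l)
  · exact posKappa_mem hodd d c l

theorem smallKappa_comm (hodd : ∀ k, Odd k → 𝒱 k = ⊥) (d d' : ℕ) (c c' : V)
    (l l' : List (Hyp g)) : smallKappa hn e d c l * smallKappa hn e d' c' l' =
      (-1 : ℚ) ^ (n * (l.length * l'.length)) •
        (smallKappa hn e d' c' l' * smallKappa hn e d c l) := by
  rw [superBicentral_comm (smallKappa_mem hodd d c l) (smallKappa_mem hodd d' c' l')]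
  congr 1
  -- The parities are `n|l|` and `n|l'|`, and `n²` has the parity of `n`.
  rw [show n * l.length * (n * l'.length) = n * (n * (l.length * l'.length)) by ring]
  rcases neg_one_pow_eq_or ℚ n with h | h
  · simp only [pow_mul, h, one_pow]
  · rw [pow_mul, h]

/-- Contraction of entries of two different classes. -/
theorem sum_smallKappa_mul_smallKappa (hodd : ∀ k, Odd k → 𝒱 k = ⊥)
    (h0 : 𝒱 0 = Submodule.span ℚ {1}) (hlow : ∀ k, 0 < k → k ≤ n → 𝒱 k = ⊥)
    {d d' : ℕ} {c c' : V} (hc : c ∈ 𝒱 d) (hc' : c' ∈ 𝒱 d') {l l' : List (Hyp g)}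
    (hl : 2 * n < d + n * (l.length + 1)) (hl' : 2 * n < d' + n * (l'.length + 1)) :
    ∑ i, smallKappa hn e d c (l ++ [bas g i]) * smallKappa hn e d' c' (sharp n g i :: l') =
      smallKappa hn e (d + d') (c * c') (l ++ l') := by
  -- For a scalar label, positivity of the degree forces at least two vectors besides the contracted
  -- one; being nonempty is all that is needed.
  have hne : ∀ l : List (Hyp g), 2 * n < 0 + n * (l.length + 1) → l ≠ [] := by
    rintro l hl rfl
    simp at hl
    omega
  rcases label_cases h0 hlow hc with ⟨rfl, q, rfl⟩ | hd | rfl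
  · rcases label_cases h0 hlow hc' with ⟨rfl, q', rfl⟩ | hd' | rfl
    · simp only [smallKappa_zero, smul_mul_assoc, mul_smul_comm, one_mul, smul_smul,
        ← Finset.smul_sum]
      rw [sum_unitKappa_mul_unitKappa (hne l hl) (hne l' hl'), add_zero, smallKappa_zero]
    · simp only [smallKappa_zero, smul_mul_assoc, one_mul, ← Finset.smul_sum,
        smallKappa_of_pos (Nat.zero_lt_of_lt hd')]
      rw [sum_unitKappa_mul_posKappa hodd _ _ (hne l hl), zero_add, smallKappa_smul,
        smallKappa_of_pos (Nat.zero_lt_of_lt hd')]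
    · simp [smallKappa_zero_label]
  · rcases label_cases h0 hlow hc' with ⟨rfl, q', rfl⟩ | hd' | rfl
    · simp only [smallKappa_zero, mul_smul_comm, mul_one, ← Finset.smul_sum,
        smallKappa_of_pos (Nat.zero_lt_of_lt hd)]
      rw [sum_posKappa_mul_unitKappa _ _ _ (hne l' hl'), add_zero, smallKappa_smul,
        smallKappa_of_pos (Nat.zero_lt_of_lt hd)]
    · simp only [smallKappa_of_pos (Nat.zero_lt_of_lt hd), smallKappa_of_pos (Nat.zero_lt_of_lt hd')]
      rw [sum_posKappa_mul_posKappa hodd hd hd' hc hc', smallKappa_of_pos (by omega)]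
    · simp [smallKappa_zero_label]
  · simp [smallKappa_zero_label]

/-- Contraction of two entries of the same class. -/
theorem sum_smallKappa_self (hodd : ∀ k, Odd k → 𝒱 k = ⊥)
    (h0 : 𝒱 0 = Submodule.span ℚ {1}) (hlow : ∀ k, 0 < k → k ≤ n → 𝒱 k = ⊥)
    {d : ℕ} {c : V} (hc : c ∈ 𝒱 d) {l : List (Hyp g)} (hl : 2 * n < d + n * (l.length + 2)) :
    ∑ i, smallKappa hn e d c (l ++ [bas g i, sharp n g i]) =
      smallKappa hn e (2 * n + d) ((e : V) * c) l := by
  have h2n : n < 2 * n := by omega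
  rcases label_cases h0 hlow hc with ⟨rfl, q, rfl⟩ | hd | rfl
  · cases l with
    | nil => simp at hl; omega
    | cons x l =>
      simp only [smallKappa_zero, ← Finset.smul_sum, mul_smul_comm, mul_one, add_zero]
      rw [smallKappa_smul, smallKappa_of_pos (by omega)]
      congr 1
      -- `δ` produces `∑ᵢ κ_1(x ⊗ l ⊗ aᵢ) κ_e(aᵢ^#)`, and `κ_e` then absorbs the unit class.
      refine (sum_comb_self l _ _).trans ?_
      refine (sum_unitKappa_mul_posKappa hodd (2 * n) (e : V) (l := x :: l) (by simp) []).trans ?_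
      rw [List.append_nil]
  · simp only [smallKappa_of_pos (Nat.zero_lt_of_lt hd)]
    refine (sum_comb_self l _ _).trans ?_
    refine (sum_posKappa_mul_posKappa hodd hd h2n hc e.2 l []).trans ?_
    rw [List.append_nil, smallKappa_of_pos (by omega), add_comm, mul_comm c]
  · simp [smallKappa_zero_label]

end SmallPresKappa

/-! ### Linear maps out of `R^𝒱` -/

section Lift

variable {V : Type u} [CommRing V] [Algebra ℚ V] {n : ℕ} {𝒱 : ℕ → Submodule ℚ V}
  {e : 𝒱 (2 * n)} {g : ℕ} {A : Type*} [Ring A] [Algebra ℚ A]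

/-- A function which is linear in each entry, as a multilinear map. -/
def multilinearOfComb {m : ℕ} (f : (Fin m → Hyp g) → A)
    (hf : ∀ (i : Fin m) (v v' v'' : Fin m → Hyp g) (q q' : ℚ), v i = q • v' i + q' • v'' i →
      (∀ j ≠ i, v j = v' j) → (∀ j ≠ i, v j = v'' j) → f v = q • f v' + q' • f v'') :
    MultilinearMap ℚ (fun _ : Fin m => Hyp g) A where
  toFun := f
  map_update_add' v i x y := by
    have := hf i (Function.update v i (x + y)) (Function.update v i x) (Function.update v i y) 1 1
      (by simp) (fun j hj => by simp [hj]) (fun j hj => by simp [hj])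
    simpa using this
  map_update_smul' v i q x := by
    have := hf i (Function.update v i (q • x)) (Function.update v i x) (Function.update v i x) q 0
      (by simp) (fun j hj => by simp [hj]) (fun j hj => by simp [hj])
    simpa using this

variable (F : ∀ m : ℕ, (Fin m → Hyp g) → LabPart n 𝒱 (Fin m) → A)
  (hv : ∀ (m : ℕ) (X : LabPart n 𝒱 (Fin m)) (i : Fin m) (v v' v'' : Fin m → Hyp g) (q q' : ℚ),
    v i = q • v' i + q' • v'' i → (∀ j ≠ i, v j = v' j) → (∀ j ≠ i, v j = v'' j) →
    F m v X = q • F m v' X + q' • F m v'' X)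
  (hc : ∀ (m : ℕ) (v : Fin m → Hyp g) (S : Finset (Fin m)) (d : ℕ) (c c' : V) (q q' : ℚ)
    (X : Multiset (Part V (Fin m)))
    (h : IsLabelled n 𝒱 (⟨S, d, c⟩ ::ₘ X)) (h' : IsLabelled n 𝒱 (⟨S, d, c'⟩ ::ₘ X))
    (h'' : IsLabelled n 𝒱 (⟨S, d, q • c + q' • c'⟩ ::ₘ X)),
    F m v ⟨_, h''⟩ = q • F m v ⟨_, h⟩ + q' • F m v ⟨_, h'⟩)

/-- The linear map on `TermMod` induced by a function which is multilinear in the vectors and linear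
in the labels. -/
def TermMod.lift (m : ℕ) : TermMod n 𝒱 g m →ₗ[ℚ] A :=
  TensorProduct.lift (M := ⨂[ℚ]^m (Hyp g)) (N := PMod n 𝒱 (Fin m)) <| LinearMap.flip <|
    PMod.lift (fun X => PiTensorProduct.lift (multilinearOfComb (fun v => F m v X) (hv m X)))
      (fun S d c c' q q' X h h' h'' => by
        refine PiTensorProduct.ext (MultilinearMap.ext fun v => ?_)
        simp only [LinearMap.compMultilinearMap_apply, LinearMap.add_apply, LinearMap.smul_apply,
          PiTensorProduct.lift.tprod]
        exact hc m v S d c c' q q' X h h' h'')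

theorem TermMod.lift_mk (m : ℕ) (v : Fin m → Hyp g) (X : LabPart n 𝒱 (Fin m)) :
    TermMod.lift F hv hc m (TermMod.mk v X) = F m v X := by
  refine (TensorProduct.lift.tmul (M := ⨂[ℚ]^m (Hyp g)) (N := PMod n 𝒱 (Fin m)) _ _).trans ?_
  rw [LinearMap.flip_apply, PMod.lift_of, PiTensorProduct.lift.tprod]
  rfl

/-- The linear map on `CoendSum` induced by such a family of functions. -/
def CoendSum.lift : CoendSum n 𝒱 g →ₗ[ℚ] A :=
  DirectSum.toModule ℚ ℕ A (TermMod.lift F hv hc)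

theorem CoendSum.lift_term {m : ℕ} (v : Fin m → Hyp g) (X : LabPart n 𝒱 (Fin m)) :
    CoendSum.lift F hv hc (term v X) = F m v X := by
  rw [CoendSum.lift, term, DirectSum.toModule_lof, TermMod.lift_mk]

variable
  (hb : ∀ (m : ℕ) (σ : Equiv.Perm (Fin m)) (v : Fin m → Hyp g) (X : LabPart n 𝒱 (Fin m)),
    F m (v ∘ σ) X = ((Equiv.Perm.sign σ : ℤ) : ℚ) ^ n • F m v (X.map σ))
  (hk : ∀ (m k : ℕ) (h : k = m + 2) (p : ℕ) (hp : p ≤ m) (v : Fin m → Hyp g)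
    (X : LabPart n 𝒱 (Fin k)) (X' : LabPart n 𝒱 (Fin m)),
    Contracts n (e : V) h p hp X.1 X'.1 →
      ∑ i, F k (insertPair h p hp v (bas g i) (sharp n g i)) X = F m v X')

/-- The universal property of the coend. -/
def RV.lift : RV n 𝒱 e g →ₗ[ℚ] A :=
  Submodule.liftQ (coendSub n 𝒱 e g) (CoendSum.lift F hv hc) (by
    rw [coendSub, Submodule.span_le]
    rintro z (⟨σ, v, X⟩ | ⟨h, p, hp, v, X, X', hX⟩)
    · rw [SetLike.mem_coe, LinearMap.mem_ker, map_sub, map_smul, CoendSum.lift_term,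
        CoendSum.lift_term, hb, sub_self]
    · rw [SetLike.mem_coe, LinearMap.mem_ker, map_sub, map_sum]
      simp only [CoendSum.lift_term]
      rw [hk _ _ h p hp v X X' hX, sub_self])

theorem RV.lift_cls {m : ℕ} (v : Fin m → Hyp g) (X : LabPart n 𝒱 (Fin m)) :
    RV.lift F hv hc hb hk (cls e v X) = F m v X :=
  (Submodule.liftQ_apply _ _ _).trans (CoendSum.lift_term F hv hc v X)

end Lift

/-! ### Words of blocks -/

section Blocks

variable {V : Type u} {α β : Type}

/-- An ordered labelled part. -/
abbrev Block (V : Type u) (α : Type) : Type u := List α × ℕ × V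

/-- The elements of a word of blocks. -/
def wordElems (W : List (Block V α)) : List α := (W.map Prod.fst).flatten

/-- The image of a block. -/
def Block.map (f : α → β) (b : Block V α) : Block V β := (b.1.map f, b.2)

@[simp] theorem wordElems_nil : wordElems ([] : List (Block V α)) = [] := rfl

theorem wordElems_cons (b : Block V α) (W : List (Block V α)) :
    wordElems (b :: W) = b.1 ++ wordElems W := rfl

theorem wordElems_append (W W' : List (Block V α)) :
    wordElems (W ++ W') = wordElems W ++ wordElems W' := by
  simp [wordElems]

theorem wordElems_map (f : α → β) (W : List (Block V α)) :
    wordElems (W.map (Block.map f)) = (wordElems W).map f := by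
  simp only [wordElems, List.map_flatten, List.map_map]
  rfl

theorem wordElems_perm {W W' : List (Block V α)} (h : W.Perm W') :
    (wordElems W).Perm (wordElems W') := (h.map _).flatten

end Blocks

/-! ### Orderings of the parts of a labelled partition -/

section Represents

variable {V : Type u} {α β : Type} [DecidableEq α] [DecidableEq β]

/-- A block represents a part if it is an ordering of this part. -/
def Represents (P : Part V α) (b : Block V α) : Prop :=
  b.1.Nodup ∧ b.1.toFinset = P.carrier ∧ b.2 = (P.deg, P.label)

theorem Represents.card_eq {P : Part V α} {b : Block V α} (h : Represents P b) :
    P.carrier.card = b.1.length := by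
  rw [← h.2.1, List.toFinset_card_of_nodup h.1]

theorem Represents.map {P : Part V α} {b : Block V α} (h : Represents P b) (f : α ↪ β) :
    Represents (P.map f) (b.map f) := by
  refine ⟨h.1.map f.injective, ?_, h.2.2⟩
  ext x
  simp [Block.map, Part.map, ← h.2.1]

theorem forall₂_map {L : List (Part V α)} {W : List (Block V α)}
    (h : List.Forall₂ Represents L W) (f : α ↪ β) :
    List.Forall₂ Represents (L.map (Part.map f)) (W.map (Block.map f)) := by
  induction h with
  | nil => exact List.Forall₂.nil
  | cons h _ ih => exact List.Forall₂.cons (h.map f) ih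

theorem mem_wordElems {L : List (Part V α)} {W : List (Block V α)}
    (h : List.Forall₂ Represents L W) (a : α) : a ∈ wordElems W ↔ ∃ P ∈ L, a ∈ P.carrier := by
  induction h with
  | nil => simp
  | cons h _ ih =>
    rw [wordElems_cons, List.mem_append, ih, ← List.mem_toFinset, h.2.1]
    simp

end Represents

section SortBlock

variable {V : Type u} {α : Type} [LinearOrder α]

/-- The increasing ordering of a part. -/
def sortBlock (P : Part V α) : Block V α := (P.carrier.sort (· ≤ ·), P.deg, P.label)

theorem represents_sortBlock (P : Part V α) : Represents P (sortBlock P) :=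
  ⟨Finset.sort_nodup _ _, Finset.sort_toFinset _ _, rfl⟩

theorem forall₂_sortBlock (L : List (Part V α)) : List.Forall₂ Represents L (L.map sortBlock) := by
  induction L with
  | nil => exact List.Forall₂.nil
  | cons P L ih => exact List.Forall₂.cons (represents_sortBlock P) ih

end SortBlock

/-! ### Disjointness and exhaustion of the parts -/

section Labelled

variable {V : Type u} [CommRing V] [Algebra ℚ V] {n : ℕ} {𝒱 : ℕ → Submodule ℚ V}

theorem IsLabelled.exists_mem {S : Type} [DecidableEq S] {X : Multiset (Part V S)}
    (hX : IsLabelled n 𝒱 X) (s : S) : ∃ P ∈ X, s ∈ P.carrier :=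
  Multiset.countP_pos.1 (by rw [hX.partition s]; exact one_pos)

theorem IsLabelled.notMem_of_cons {S : Type} [DecidableEq S] {P Q : Part V S}
    {X : Multiset (Part V S)} (hX : IsLabelled n 𝒱 (P ::ₘ X)) {s : S} (hs : s ∈ P.carrier)
    (hQ : Q ∈ X) : s ∉ Q.carrier := by
  have h := hX.partition s
  rw [Multiset.countP_cons_of_pos (p := fun P : Part V S => s ∈ P.carrier) _ hs,
    Nat.add_eq_right, Multiset.countP_eq_zero] at h
  exact h Q hQ

end Labelled

/-! ### Values in the small presentation -/

section Words

variable {V : Type u} [CommRing V] [Algebra ℚ V] [Nontrivial V] {n : ℕ} {𝒱 : ℕ → Submodule ℚ V}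
  [GradedAlgebra 𝒱] (hn : 0 < n) (e : 𝒱 (2 * n)) {g : ℕ}
  {α β : Type} [LinearOrder α] [LinearOrder β]

/-- The class of a block in the small presentation. -/
def blockVal (v : α → Hyp g) (b : Block V α) : SmallPres hn e g :=
  smallKappa hn e b.2.1 b.2.2 (b.1.map v)

/-- The value of a word of blocks: the product of the values of the blocks, with the sign which is
needed to order the elements. -/
def wordVal (v : α → Hyp g) (W : List (Block V α)) : SmallPres hn e g :=
  ((listSign (wordElems W) : ℤ) : ℚ) ^ n • (W.map (blockVal hn e v)).prod

theorem wordVal_cons (v : α → Hyp g) (b : Block V α) (W : List (Block V α)) :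
    wordVal hn e v (b :: W) =
      ((listSign b.1 * crossSign b.1 (wordElems W) : ℤ) : ℚ) ^ n •
        (blockVal hn e v b * wordVal hn e v W) := by
  rw [wordVal, wordVal, wordElems_cons, listSign_append, List.map_cons, List.prod_cons,
    mul_smul_comm, smul_smul, ← mul_pow, ← Int.cast_mul]
  congr 3
  ring

theorem wordVal_append (v : α → Hyp g) (W W' : List (Block V α)) :
    wordVal hn e v (W ++ W') = ((crossSign (wordElems W) (wordElems W') : ℤ) : ℚ) ^ n •
      (wordVal hn e v W * wordVal hn e v W') := by
  rw [wordVal, wordVal, wordVal, wordElems_append, listSign_append, List.map_append,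
    List.prod_append, mul_smul_comm, smul_mul_assoc, smul_smul, smul_smul, ← mul_pow, ← mul_pow,
    ← Int.cast_mul, ← Int.cast_mul]
  congr 3
  ring

theorem wordVal_map_strictMono {f : α → β} (hf : StrictMono f) (v : β → Hyp g)
    (W : List (Block V α)) :
    wordVal hn e v (W.map (Block.map f)) = wordVal hn e (v ∘ f) W := by
  rw [wordVal, wordVal, wordElems_map, listSign_map hf, List.map_map]
  congr 3
  funext b
  simp [blockVal, Block.map]

theorem wordVal_map_perm [Fintype α] (σ : Equiv.Perm α) (v : α → Hyp g) {W : List (Block V α)}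
    (hW : ∀ a, a ∈ wordElems W) :
    wordVal hn e v (W.map (Block.map σ)) =
      ((Equiv.Perm.sign σ : ℤ) : ℚ) ^ n • wordVal hn e (v ∘ σ) W := by
  rw [wordVal, wordVal, wordElems_map, listSign_map_perm σ hW, List.map_map, smul_smul, ← mul_pow,
    ← Int.cast_mul]
  congr 3
  funext b
  simp [blockVal, Block.map]

theorem wordVal_congr {v v' : α → Hyp g} {W : List (Block V α)}
    (h : ∀ a ∈ wordElems W, v a = v' a) : wordVal hn e v W = wordVal hn e v' W := by
  unfold wordVal
  congr 2
  refine List.map_congr_left fun b hb => ?_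
  unfold blockVal
  congr 1
  exact List.map_congr_left fun a ha =>
    h a (List.mem_flatten.2 ⟨b.1, List.mem_map.2 ⟨b, hb, rfl⟩, ha⟩)

theorem intCast_neg_one_pow_mul (k : ℕ) (s : ℤ) :
    (((-1) ^ k * s : ℤ) : ℚ) ^ n = (-1) ^ (n * k) * (s : ℚ) ^ n := by
  push_cast
  rw [mul_pow, ← pow_mul, mul_comm k n]

variable {hn e}

/-- The sign of moving one block past the other and the sign from graded commutativity are both
`(-1)^(n|b||b'|)`, so they cancel. -/
theorem wordVal_swap (hodd : ∀ k, Odd k → 𝒱 k = ⊥) (v : α → Hyp g) (b b' : Block V α)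
    (W : List (Block V α)) :
    wordVal hn e v (b :: b' :: W) = wordVal hn e v (b' :: b :: W) := by
  simp only [wordVal, wordElems_cons, List.map_cons, List.prod_cons, ← mul_assoc]
  have h := listSign_append_swap [] b.1 b'.1 (wordElems W)
  rw [List.nil_append, List.nil_append] at h
  rw [h, intCast_neg_one_pow_mul, blockVal, blockVal, smallKappa_comm hodd, smul_mul_assoc,
    smul_smul, List.length_map, List.length_map, mul_right_comm, ← pow_add, ← two_mul]
  rw [Even.neg_one_pow (even_two_mul _), one_mul]

theorem wordVal_perm (hodd : ∀ k, Odd k → 𝒱 k = ⊥) (v : α → Hyp g) {W W' : List (Block V α)}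
    (h : W.Perm W') : wordVal hn e v W = wordVal hn e v W' := by
  induction h with
  | nil => rfl
  | cons b h ih => rw [wordVal_cons, wordVal_cons, ih, crossSign_perm_right _ (wordElems_perm h)]
  | swap b b' W => exact wordVal_swap hodd v b' b W
  | trans _ _ ih ih' => exact ih.trans ih'

/-- An adjacent transposition changes both `listSign ^ n` and the class by `(-1)^n`. -/
theorem listSign_smul_smallKappa_perm (v : α → Hyp g) (d : ℕ) (c : V) {l l' : List α}
    (h : l.Perm l') :
    ((listSign l : ℤ) : ℚ) ^ n • smallKappa hn e d c (l.map v) =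
      ((listSign l' : ℤ) : ℚ) ^ n • smallKappa hn e d c (l'.map v) := by
  -- A common prefix is carried along, because the inductive case of an added head must see the
  -- whole list.
  suffices H : ∀ l₀ : List α,
      ((listSign (l₀ ++ l) : ℤ) : ℚ) ^ n • smallKappa hn e d c ((l₀ ++ l).map v) =
        ((listSign (l₀ ++ l') : ℤ) : ℚ) ^ n • smallKappa hn e d c ((l₀ ++ l').map v) from H []
  induction h with
  | nil => exact fun _ => rfl
  | cons a _ ih => exact fun l₀ => by simpa using ih (l₀ ++ [a])
  | swap a b l =>
    intro l₀
    rw [listSign_swap, List.map_append, List.map_append, List.map_cons, List.map_cons,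
      List.map_cons, List.map_cons, smallKappa_isSigned, smul_smul, Int.cast_neg, ← mul_pow]
    congr 2
    ring
  | trans _ _ ih ih' => exact fun l₀ => (ih l₀).trans (ih' l₀)

theorem wordVal_forall₂ (v : α → Hyp g) {W W' : List (Block V α)}
    (h : List.Forall₂ (fun b b' => b.1.Perm b'.1 ∧ b.2 = b'.2) W W') :
    wordVal hn e v W = wordVal hn e v W' ∧ (wordElems W).Perm (wordElems W') := by
  induction h with
  | nil => exact ⟨rfl, List.Perm.refl _⟩
  | @cons b b' W W' hb _ ih =>
    obtain ⟨l, d, c⟩ := b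
    obtain ⟨l', d', c'⟩ := b'
    obtain ⟨hl, hdc⟩ : l.Perm l' ∧ (d, c) = (d', c') := hb
    cases hdc
    refine ⟨?_, hl.append ih.2⟩
    rw [wordVal_cons, wordVal_cons, ih.1, crossSign_perm_right _ ih.2, crossSign_perm_left hl]
    simp only [blockVal, Int.cast_mul, mul_pow]
    have h : ∀ (a b : ℚ) (x y : SmallPres hn e g), (a * b) • (x * y) = b • ((a • x) * y) :=
      fun a b x y => by rw [mul_comm a, mul_smul, smul_mul_assoc]
    rw [h, h, listSign_smul_smallKappa_perm v d c hl]

variable (hn e) in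
/-- The value in the small presentation of a multiset of labelled parts. -/
def partVal (v : α → Hyp g) (X : Multiset (Part V α)) : SmallPres hn e g :=
  wordVal hn e v (X.toList.map sortBlock)

/-- Well-definedness: neither the order of the parts nor the order inside each part matters.
Contractions can therefore be computed in whatever ordering suits them. -/
theorem partVal_eq (hodd : ∀ k, Odd k → 𝒱 k = ⊥) (v : α → Hyp g) {L : List (Part V α)}
    {W : List (Block V α)} (h : List.Forall₂ Represents L W) :
    partVal hn e v (L : Multiset (Part V α)) = wordVal hn e v W := by
  have h1 : (L : Multiset (Part V α)).toList.Perm L :=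
    Multiset.coe_eq_coe.1 (Multiset.coe_toList _)
  rw [partVal, wordVal_perm hodd v (h1.map sortBlock)]
  refine (wordVal_forall₂ v ?_).1
  clear h1
  induction h with
  | nil => exact List.Forall₂.nil
  | cons h _ ih =>
    refine List.Forall₂.cons ⟨?_, h.2.2.symm⟩ ih
    exact List.perm_of_nodup_nodup_toFinset_eq (represents_sortBlock _).1 h.1
      ((represents_sortBlock _).2.1.trans h.2.1.symm)

theorem partVal_cons (hodd : ∀ k, Odd k → 𝒱 k = ⊥) (v : α → Hyp g) {P : Part V α} {b : Block V α}
    (h : Represents P b) (X : Multiset (Part V α)) :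
    partVal hn e v (P ::ₘ X) = wordVal hn e v (b :: X.toList.map sortBlock) := by
  rw [← partVal_eq hodd v (List.Forall₂.cons h (forall₂_sortBlock X.toList)),
    ← Multiset.cons_coe, Multiset.coe_toList]

theorem partVal_label_linear (hodd : ∀ k, Odd k → 𝒱 k = ⊥) (v : α → Hyp g) (S : Finset α) (d : ℕ)
    (c c' : V) (q q' : ℚ) (X : Multiset (Part V α)) :
    partVal hn e v (⟨S, d, q • c + q' • c'⟩ ::ₘ X) =
      q • partVal hn e v (⟨S, d, c⟩ ::ₘ X) + q' • partVal hn e v (⟨S, d, c'⟩ ::ₘ X) := by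
  simp only [partVal_cons hodd v (represents_sortBlock _), wordVal_cons]
  simp only [sortBlock, blockVal, smallKappa_linear]
  rw [add_mul, smul_add, smul_mul_assoc, smul_mul_assoc, smul_comm q, smul_comm q']

/-- The element `i` occurs in exactly one block and exactly once there, so a single factor of the
product varies, and it does so linearly. -/
theorem partVal_multilinear (hodd : ∀ k, Odd k → 𝒱 k = ⊥) {X : Multiset (Part V α)}
    (hX : IsLabelled n 𝒱 X) (i : α) (v v' v'' : α → Hyp g) (q q' : ℚ)
    (hi : v i = q • v' i + q' • v'' i) (h' : ∀ j ≠ i, v j = v' j) (h'' : ∀ j ≠ i, v j = v'' j) :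
    partVal hn e v X = q • partVal hn e v' X + q' • partVal hn e v'' X := by
  obtain ⟨P, hP, hiP⟩ := hX.exists_mem i
  obtain ⟨X, rfl⟩ := Multiset.exists_cons_of_mem hP
  have hiX : ∀ Q ∈ X, i ∉ Q.carrier := fun Q hQ => hX.notMem_of_cons hiP hQ
  simp only [partVal_cons hodd _ (represents_sortBlock P), wordVal_cons]
  have hW : ∀ a ∈ wordElems (X.toList.map sortBlock), a ≠ i := by
    rintro a ha rfl
    obtain ⟨Q, hQ, haQ⟩ := (mem_wordElems (forall₂_sortBlock _) a).1 ha
    exact hiX Q (Multiset.mem_toList.1 hQ) haQ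
  -- The remaining blocks do not contain `i`, so their common value does not see which of the three
  -- families is used.
  rw [← wordVal_congr hn e (v := v) (v' := v') (fun a ha => h' a (hW a ha)),
    ← wordVal_congr hn e (v := v) (v' := v'') (fun a ha => h'' a (hW a ha))]
  have hmem : i ∈ (sortBlock P).1 := (Finset.mem_sort _).2 hiP
  have hnd : (sortBlock P).1.Nodup := Finset.sort_nodup _ _
  obtain ⟨l₁, l₂, hl⟩ := List.append_of_mem hmem
  rw [hl] at hnd
  have h₁ : ∀ a ∈ l₁, a ≠ i := by
    rintro a ha rfl
    exact (List.nodup_append.1 hnd).2.2 a ha a List.mem_cons_self rfl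
  have h₂ : ∀ a ∈ l₂, a ≠ i := by
    rintro a ha rfl
    exact (List.nodup_cons.1 (List.nodup_append.1 hnd).2.1).1 ha
  have key : blockVal hn e v (sortBlock P) =
      q • blockVal hn e v' (sortBlock P) + q' • blockVal hn e v'' (sortBlock P) := by
    simp only [blockVal, hl, List.map_append, List.map_cons]
    rw [hi, smallKappa_isMultilinear, List.map_congr_left fun a ha => h' a (h₁ a ha),
      List.map_congr_left fun a ha => h' a (h₂ a ha)]
    congr 3
    rw [← List.map_congr_left fun a ha => h' a (h₁ a ha),
      ← List.map_congr_left fun a ha => h' a (h₂ a ha),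
      List.map_congr_left fun a ha => h'' a (h₁ a ha),
      List.map_congr_left fun a ha => h'' a (h₂ a ha)]
  rw [key, add_mul, smul_add, smul_mul_assoc, smul_mul_assoc, smul_comm q, smul_comm q']

theorem partVal_map_perm [Fintype α] (hodd : ∀ k, Odd k → 𝒱 k = ⊥) (σ : Equiv.Perm α)
    (v : α → Hyp g) {X : Multiset (Part V α)} (hX : IsLabelled n 𝒱 X) :
    partVal hn e (v ∘ σ) X =
      ((Equiv.Perm.sign σ : ℤ) : ℚ) ^ n • partVal hn e v (X.map (Part.map σ.toEmbedding)) := by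
  have h1 := partVal_eq (hn := hn) (e := e) hodd v
    (forall₂_map (forall₂_sortBlock X.toList) σ.toEmbedding)
  rw [← Multiset.map_coe, Multiset.coe_toList] at h1
  have h2 := wordVal_map_perm hn e σ v (W := X.toList.map sortBlock) (fun a => by
    rw [mem_wordElems (forall₂_sortBlock _)]
    obtain ⟨P, hP, ha⟩ := hX.exists_mem a
    exact ⟨P, Multiset.mem_toList.2 hP, ha⟩)
  have hs : ((Equiv.Perm.sign σ : ℤ) : ℚ) * (Equiv.Perm.sign σ : ℤ) = 1 := by
    rw [← Int.cast_mul, Int.units_coe_mul_self, Int.cast_one]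
  refine Eq.trans ?_ (congrArg _ (h2.symm.trans h1.symm))
  rw [smul_smul, ← mul_pow, hs, one_pow, one_smul]
  rfl

/-- All elements of the first partition precede those of the second, so the cross sign is `1` and
the value is multiplicative. -/
theorem partVal_add {γ : Type} [LinearOrder γ] (hodd : ∀ k, Odd k → 𝒱 k = ⊥) (f : α ↪ γ)
    (f' : β ↪ γ) (hf : StrictMono f) (hf' : StrictMono f') (hlt : ∀ a b, f a < f' b)
    (v : γ → Hyp g) (X : Multiset (Part V α)) (Y : Multiset (Part V β)) :
    partVal hn e v (X.map (Part.map f) + Y.map (Part.map f')) =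
      partVal hn e (v ∘ f) X * partVal hn e (v ∘ f') Y := by
  have h := partVal_eq (hn := hn) (e := e) hodd v
    ((List.rel_append (forall₂_map (forall₂_sortBlock X.toList) f))
      (forall₂_map (forall₂_sortBlock Y.toList) f'))
  rw [← Multiset.coe_add, ← Multiset.map_coe, ← Multiset.map_coe, Multiset.coe_toList,
    Multiset.coe_toList] at h
  rw [h, wordVal_append, wordElems_map, wordElems_map, crossSign_of_lt, Int.cast_one, one_pow,
    one_smul, wordVal_map_strictMono hn e hf, wordVal_map_strictMono hn e hf']
  · rfl
  · intro a ha b hb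
    obtain ⟨a, _, rfl⟩ := List.mem_map.1 ha
    obtain ⟨b, _, rfl⟩ := List.mem_map.1 hb
    exact hlt a b

end Words

/-! ### Contractions of values -/

/-- By hypothesis every other entry lies on the same side of `p` and `q`, so its two signs multiply
to `1`. -/
theorem listSign_insert_pair {α : Type*} [LinearOrder α] {p q : α} (hpq : p < q) (l₁ l₂ : List α)
    (h : ∀ a ∈ l₁ ++ l₂, pairSign a p * pairSign a q = 1) :
    listSign (l₁ ++ p :: q :: l₂) = listSign (l₁ ++ l₂) := by
  have h1 : ∀ l : List α, (∀ a ∈ l, pairSign a p * pairSign a q = 1) →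
      crossSign l [p, q] = 1 := fun l hl => by
    refine List.prod_eq_one fun x hx => ?_
    obtain ⟨a, ha, rfl⟩ := List.mem_map.1 hx
    simpa using hl a ha
  have h2 : listSign [p, q] = 1 := listSign_of_pairwise_lt (by simpa using hpq)
  have h3 : crossSign [p, q] l₂ = 1 := by
    rw [crossSign_swap, h1 l₂ fun a ha => h a (List.mem_append_right _ ha), mul_one]
    exact Even.neg_one_pow (even_two.mul_right _)
  change listSign (l₁ ++ ([p, q] ++ l₂)) = _
  rw [listSign_append, listSign_append, listSign_append, crossSign_append_right, h2, h3,
    h1 l₁ fun a ha => h a (List.mem_append_left _ ha)]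
  ring

/-! ### Inserting an adjacent pair of elements -/

section InsertPair

variable {m k g : ℕ} (h : k = m + 2) (p : ℕ) (hp : p ≤ m)

theorem skip_strictMono : StrictMono (skip h p) := by
  intro i j hij
  rw [Fin.lt_def, skip_val, skip_val]
  rw [Fin.lt_def] at hij
  split_ifs <;> omega

theorem pairSign_skip (i : Fin m) :
    pairSign (skip h p i) ⟨p, by omega⟩ * pairSign (skip h p i) ⟨p + 1, by omega⟩ = 1 := by
  simp only [pairSign, Fin.lt_def, skip_val]
  by_cases hi : (i : ℕ) < p
  · rw [if_pos hi, if_pos hi, if_pos (by omega)]; rfl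
  · rw [if_neg hi, if_neg (by omega), if_pos (by omega), if_neg (by omega), if_pos (by omega)]; rfl

theorem listSign_skip (l₁ l₂ : List (Fin m)) :
    listSign (l₁.map (skip h p) ++ ⟨p, by omega⟩ :: ⟨p + 1, by omega⟩ :: l₂.map (skip h p)) =
      listSign (l₁ ++ l₂) := by
  rw [listSign_insert_pair (by simp), ← List.map_append, listSign_map (skip_strictMono h p)]
  rw [← List.map_append]
  intro a ha
  obtain ⟨i, _, rfl⟩ := List.mem_map.1 ha
  exact pairSign_skip h p hp i

theorem skip_ne_fst (i : Fin m) : skip h p i ≠ ⟨p, by omega⟩ := by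
  rw [Ne, Fin.ext_iff, skip_val]
  split_ifs <;> simp <;> omega

theorem skip_ne_snd (i : Fin m) : skip h p i ≠ ⟨p + 1, by omega⟩ := by
  rw [Ne, Fin.ext_iff, skip_val]
  split_ifs <;> simp <;> omega

variable (v : Fin m → Hyp g) (x y : Hyp g)

theorem insertPair_skip (i : Fin m) : insertPair h p hp v x y (skip h p i) = v i := by
  simp only [insertPair, skip_val]
  by_cases hi : (i : ℕ) < p
  · simp only [hi, if_true, dif_pos]
  · simp only [if_neg hi]
    rw [dif_neg (by omega), dif_neg (by omega), dif_neg (by omega)]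
    congr 1

theorem insertPair_comp_skip : insertPair h p hp v x y ∘ skip h p = v :=
  funext fun i => insertPair_skip h p hp v x y i

theorem insertPair_fst : insertPair h p hp v x y ⟨p, by omega⟩ = x := by
  simp [insertPair]

theorem insertPair_snd : insertPair h p hp v x y ⟨p + 1, by omega⟩ = y := by
  simp [insertPair]

end InsertPair

section Contract

variable {V : Type u} [CommRing V] [Algebra ℚ V] [Nontrivial V] {n : ℕ} {𝒱 : ℕ → Submodule ℚ V}
  [GradedAlgebra 𝒱] {hn : 0 < n} {e : 𝒱 (2 * n)} {g : ℕ}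

theorem map_blockVal_map {α β : Type} (v : β → Hyp g) (f : α → β) (W : List (Block V α)) :
    (W.map (Block.map f)).map (blockVal hn e v) = W.map (blockVal hn e (v ∘ f)) := by
  rw [List.map_map]
  congr 1
  funext b
  simp [blockVal, Block.map]

/-- The blocks are ordered so that `p` and `p + 1` become neighbours in the word. Removing them
preserves the sign and the other factors, which leaves a contraction inside one class or between two
consecutive classes. -/
theorem sum_partVal_contract (hodd : ∀ k, Odd k → 𝒱 k = ⊥)
    (h0 : 𝒱 0 = Submodule.span ℚ {1}) (hlow : ∀ k, 0 < k → k ≤ n → 𝒱 k = ⊥)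
    {m k : ℕ} (h : k = m + 2) (p : ℕ) (hp : p ≤ m) (v : Fin m → Hyp g)
    {X : Multiset (Part V (Fin k))} {X' : Multiset (Part V (Fin m))} (hX : IsLabelled n 𝒱 X)
    (hC : Contracts n (e : V) h p hp X X') :
    ∑ i, partVal hn e (insertPair h p hp v (bas g i) (sharp n g i)) X = partVal hn e v X' := by
  rcases hC with ⟨A, d, c, Y, rfl, rfl⟩ | ⟨A, B, d, d', c, c', Y, rfl, rfl⟩
  · set s := A.sort (· ≤ ·) with hs
    set W := Y.toList.map sortBlock with hW
    have hWf := forall₂_sortBlock Y.toList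
    -- Both contracted elements are placed at the end of their common block.
    have hb : Represents (⟨{⟨p, by omega⟩, ⟨p + 1, by omega⟩} ∪ A.map (skip h p), d, c⟩ :
        Part V (Fin k)) (s.map (skip h p) ++ [⟨p, by omega⟩, ⟨p + 1, by omega⟩], d, c) := by
      refine ⟨?_, ?_, rfl⟩
      · rw [List.nodup_append]
        refine ⟨(Finset.sort_nodup _ _).map (skip h p).injective, by simp, ?_⟩
        intro a ha b hb hab
        obtain ⟨i, _, rfl⟩ := List.mem_map.1 ha
        simp only [List.mem_cons, List.not_mem_nil, or_false] at hb
        rcases hb with rfl | rfl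
        · exact skip_ne_fst h p hp i hab
        · exact skip_ne_snd h p hp i hab
      · ext x
        simp [hs]
    have hb' : Represents (⟨A, 2 * n + d, (e : V) * c⟩ : Part V (Fin m)) (s, 2 * n + d, (e : V) * c) :=
      represents_sortBlock _
    have h1 : ∀ v' : Fin k → Hyp g, partVal hn e v' (⟨{⟨p, by omega⟩, ⟨p + 1, by omega⟩} ∪ A.map (skip h p), d, c⟩ ::ₘ
        Y.map (Part.map (skip h p))) = wordVal hn e v'
          ((s.map (skip h p) ++ [⟨p, by omega⟩, ⟨p + 1, by omega⟩], d, c) ::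
            W.map (Block.map (skip h p))) := fun v' => by
      have := partVal_eq (hn := hn) (e := e) hodd v'
        (List.Forall₂.cons hb (forall₂_map hWf (skip h p)))
      rwa [← Multiset.cons_coe, ← Multiset.map_coe, Multiset.coe_toList] at this
    have h2 := partVal_cons (hn := hn) (e := e) hodd v hb' Y
    simp only [h1]
    rw [h2]
    simp only [wordVal, wordElems_cons, wordElems_map, List.map_cons, List.prod_cons,
      map_blockVal_map, insertPair_comp_skip, List.append_assoc, List.cons_append, List.nil_append]
    rw [← Finset.smul_sum, listSign_skip h p hp, ← Finset.sum_mul]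
    congr 2
    simp only [blockVal, List.map_append, List.map_map, insertPair_comp_skip, List.map_cons,
      List.map_nil, insertPair_fst, insertPair_snd]
    refine sum_smallKappa_self hodd h0 hlow (hX.homogeneous _ (Multiset.mem_cons_self _ _)) ?_
    have := hX.allowed _ (Multiset.mem_cons_self _ _)
    rw [hb.card_eq] at this
    simpa [Nat.add_assoc] using this
  · set s := A.sort (· ≤ ·) with hs
    set t := B.sort (· ≤ ·) with ht
    set W := Y.toList.map sortBlock with hW
    have hWf := forall₂_sortBlock Y.toList
    -- The first block ends with `p` and the second begins with `p + 1`, so their concatenation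
    -- contains the pair as neighbours and orders the merged part once the pair is removed.
    have hb₁ : Represents (⟨{⟨p, by omega⟩} ∪ A.map (skip h p), d, c⟩ : Part V (Fin k))
        (s.map (skip h p) ++ [⟨p, by omega⟩], d, c) := by
      refine ⟨?_, ?_, rfl⟩
      · rw [List.nodup_append]
        refine ⟨(Finset.sort_nodup _ _).map (skip h p).injective, by simp, ?_⟩
        intro a ha b hb hab
        obtain ⟨i, _, rfl⟩ := List.mem_map.1 ha
        rw [List.mem_singleton] at hb
        exact skip_ne_fst h p hp i (hab.trans hb)
      · ext x
        simp [hs]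
    have hb₂ : Represents (⟨{⟨p + 1, by omega⟩} ∪ B.map (skip h p), d', c'⟩ : Part V (Fin k))
        (⟨p + 1, by omega⟩ :: t.map (skip h p), d', c') := by
      refine ⟨?_, ?_, rfl⟩
      · rw [List.nodup_cons]
        refine ⟨fun ha => ?_, (Finset.sort_nodup _ _).map (skip h p).injective⟩
        obtain ⟨i, _, hi⟩ := List.mem_map.1 ha
        exact skip_ne_snd h p hp i hi
      · ext x
        simp [ht]
    have hdisj : ∀ a ∈ A, a ∉ B := by
      intro a ha hB
      refine hX.notMem_of_cons (s := skip h p a) ?_ (Multiset.mem_cons_self _ _) ?_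
      · exact Finset.mem_union_right _ (Finset.mem_map_of_mem _ ha)
      · exact Finset.mem_union_right _ (Finset.mem_map_of_mem _ hB)
    have hb' : Represents (⟨A ∪ B, d + d', c * c'⟩ : Part V (Fin m)) (s ++ t, d + d', c * c') := by
      refine ⟨?_, ?_, rfl⟩
      · rw [List.nodup_append]
        refine ⟨Finset.sort_nodup _ _, Finset.sort_nodup _ _, ?_⟩
        rintro a ha b hb rfl
        exact hdisj a ((Finset.mem_sort _).1 ha) ((Finset.mem_sort _).1 hb)
      · ext x
        simp [hs, ht]
    have h1 : ∀ v' : Fin k → Hyp g, partVal hn e v' (⟨{⟨p, by omega⟩} ∪ A.map (skip h p), d, c⟩ ::ₘ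
        ⟨{⟨p + 1, by omega⟩} ∪ B.map (skip h p), d', c'⟩ ::ₘ
        Y.map (Part.map (skip h p))) = wordVal hn e v'
          ((s.map (skip h p) ++ [⟨p, by omega⟩], d, c) ::
            (⟨p + 1, by omega⟩ :: t.map (skip h p), d', c') ::
            W.map (Block.map (skip h p))) := fun v' => by
      have := partVal_eq (hn := hn) (e := e) hodd v'
        (List.Forall₂.cons hb₁ (List.Forall₂.cons hb₂ (forall₂_map hWf (skip h p))))
      rwa [← Multiset.cons_coe, ← Multiset.cons_coe, ← Multiset.map_coe, Multiset.coe_toList] at this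
    have h2 := partVal_cons (hn := hn) (e := e) hodd v hb' Y
    simp only [h1]
    rw [h2]
    simp only [wordVal, wordElems_cons, wordElems_map, List.map_cons, List.prod_cons,
      map_blockVal_map, insertPair_comp_skip, List.append_assoc, List.cons_append, List.nil_append,
      ← List.map_append]
    rw [← Finset.smul_sum, listSign_skip h p hp]
    simp only [← mul_assoc]
    rw [← Finset.sum_mul]
    congr 2
    simp only [blockVal, List.map_append, List.map_map, insertPair_comp_skip, List.map_cons,
      List.map_nil, insertPair_fst, insertPair_snd]
    have hm₂ : (⟨{⟨p + 1, by omega⟩} ∪ B.map (skip h p), d', c'⟩ : Part V (Fin k)) ∈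
        (⟨{⟨p, by omega⟩} ∪ A.map (skip h p), d, c⟩ ::ₘ
        ⟨{⟨p + 1, by omega⟩} ∪ B.map (skip h p), d', c'⟩ ::ₘ Y.map (Part.map (skip h p))) :=
      Multiset.mem_cons_of_mem (Multiset.mem_cons_self _ _)
    refine sum_smallKappa_mul_smallKappa hodd h0 hlow
      (hX.homogeneous _ (Multiset.mem_cons_self _ _)) (hX.homogeneous _ hm₂) ?_ ?_
    · have := hX.allowed _ (Multiset.mem_cons_self _ _)
      rw [hb₁.card_eq] at this
      simpa using this
    · have := hX.allowed _ hm₂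
      rw [hb₂.card_eq] at this
      simpa using this

/-! ### The inverse homomorphism -/

variable (hn e g) in
/-- The linear map from the coend to the small presentation. -/
def smallInv (hodd : ∀ k, Odd k → 𝒱 k = ⊥) (h0 : 𝒱 0 = Submodule.span ℚ {1})
    (hlow : ∀ k, 0 < k → k ≤ n → 𝒱 k = ⊥) : RV n 𝒱 e g →ₗ[ℚ] SmallPres hn e g :=
  RV.lift (fun _ v X => partVal hn e v X.1)
    (fun _ X i v v' v'' q q' hi h' h'' => partVal_multilinear hodd X.2 i v v' v'' q q' hi h' h'')
    (fun _ v S d c c' q q' X _ _ _ => partVal_label_linear hodd v S d c c' q q' X)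
    (fun _ σ v X => partVal_map_perm hodd σ v X.2)
    (fun _ _ h p hp v X _ hC => sum_partVal_contract hodd h0 hlow h p hp v X.2 hC)

variable (hodd : ∀ k, Odd k → 𝒱 k = ⊥) (h0 : 𝒱 0 = Submodule.span ℚ {1})
  (hlow : ∀ k, 0 < k → k ≤ n → 𝒱 k = ⊥)

theorem smallInv_cls {m : ℕ} (v : Fin m → Hyp g) (X : LabPart n 𝒱 (Fin m)) :
    smallInv hn e g hodd h0 hlow (cls e v X) = partVal hn e v X.1 :=
  RV.lift_cls _ _ _ _ _ v X

theorem smallInv_one : smallInv hn e g hodd h0 hlow 1 = 1 := by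
  refine (smallInv_cls hodd h0 hlow _ _).trans ?_
  simp [partVal, emptyPart, wordVal]

theorem smallInv_mul (x y : RV n 𝒱 e g) : smallInv hn e g hodd h0 hlow (x * y) =
    smallInv hn e g hodd h0 hlow x * smallInv hn e g hodd h0 hlow y := by
  refine RV.induction e (P := fun x => smallInv hn e g hodd h0 hlow (x * y) =
    smallInv hn e g hodd h0 hlow x * smallInv hn e g hodd h0 hlow y) x (fun k v X => ?_) ?_ ?_ ?_
  · refine RV.induction e (P := fun y => smallInv hn e g hodd h0 hlow (cls e v X * y) =
      smallInv hn e g hodd h0 hlow (cls e v X) * smallInv hn e g hodd h0 hlow y) y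
      (fun m w Y => ?_) ?_ ?_ ?_
    · rw [cls_mul, smallInv_cls, smallInv_cls, smallInv_cls]
      refine (partVal_add hodd (Fin.castAddEmb m) (Fin.natAddEmb k) (Fin.strictMono_castAdd m)
        (Fin.strictMono_natAdd k) ?_ _ X.1 Y.1).trans ?_
      · intro a b
        rw [Fin.lt_def]
        simp only [Fin.castAddEmb_apply, Fin.natAddEmb_apply, Fin.val_castAdd, Fin.val_natAdd]
        omega
      · congr 2 <;> funext i <;> simp
    · rw [mul_zero, map_zero, mul_zero]
    · intro y y' hy hy'
      rw [mul_add, map_add, hy, hy', map_add, mul_add]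
    · intro q y hy
      rw [mul_smul_comm, map_smul, hy, map_smul, mul_smul_comm]
  · rw [zero_mul, map_zero, zero_mul]
  · intro x x' hx hx'
    rw [add_mul, map_add, hx, hx', map_add, add_mul]
  · intro q x hx
    rw [smul_mul_assoc, map_smul, hx, map_smul, smul_mul_assoc]

theorem smallInv_kappa {r d : ℕ} (c : 𝒱 d) (h : 2 * n < d + n * r) (v : Fin r → Hyp g) :
    smallInv hn e g hodd h0 hlow (kappa e c h v) = smallKappa hn e d (c : V) (List.ofFn v) := by
  refine (smallInv_cls hodd h0 hlow _ _).trans ?_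
  have hb : Represents (⟨Finset.univ, d, (c : V)⟩ : Part V (Fin r)) (List.finRange r, d, (c : V)) :=
    ⟨List.nodup_finRange r, by ext; simp, rfl⟩
  have := partVal_eq (hn := hn) (e := e) hodd v (List.Forall₂.cons hb List.Forall₂.nil)
  refine Eq.trans this ?_
  simp [wordVal, wordElems_cons, listSign_of_pairwise_lt (List.pairwise_lt_finRange r), blockVal,
    List.ofFn_eq_map]

/-- The recursion returns its initial data on at most one vector, and `scal` on three vectors is the
cubic class itself. -/
theorem smallInv_toRV (x : Gen n 𝒱 g) :
    smallInv hn e g hodd h0 hlow (x.toRV hn e) = SmallPres.gen hn e x := by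
  cases x with
  | k0 hd c =>
    refine (smallInv_kappa hodd h0 hlow c (by omega) Fin.elim0).trans ?_
    rw [List.ofFn_zero, smallKappa_of_pos (by omega), posKappa_nil, smallK0_of_mem hn e g hd c.2]
  | k1 hd c v =>
    refine (smallInv_kappa hodd h0 hlow c (by omega) ![v]).trans ?_
    rw [smallKappa_of_pos (by omega)]
    refine Eq.trans ?_ (smallK1_of_mem hn e g hd c.2 v)
    simp [posKappa_singleton]
  | k3 v =>
    refine (smallInv_kappa hodd h0 hlow _ (by omega) v).trans ?_
    have h1 := smallKappa_zero (hn := hn) (e := e) 1 (List.ofFn v)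
    rw [one_smul, one_smul] at h1
    have h2 : v = ![v 0, v 1, v 2] := by funext i; fin_cases i <;> rfl
    refine h1.trans ?_
    conv_rhs => rw [h2]
    exact scal_triple n _ _ _ _

end Contract

/-! ### Relations in `R^𝒱` -/

section Coend

variable {V : Type u} [CommRing V] [Algebra ℚ V] {n : ℕ} {𝒱 : ℕ → Submodule ℚ V}
  {e : 𝒱 (2 * n)} {g : ℕ}

theorem cls_bij {m : ℕ} (σ : Equiv.Perm (Fin m)) (v : Fin m → Hyp g) (X Y : LabPart n 𝒱 (Fin m))
    (h : X.1.map (Part.map σ.toEmbedding) = Y.1) :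
    cls e (v ∘ σ) X = ((Equiv.Perm.sign σ : ℤ) : ℚ) ^ n • cls e v Y := by
  have := (Submodule.Quotient.mk_eq_zero _).2 (term_bij_mem e σ v X Y h)
  rw [← Submodule.mkQ_apply, map_sub, map_smul] at this
  exact sub_eq_zero.1 this

theorem cls_contract {m k : ℕ} (h : k = m + 2) (p : ℕ) (hp : p ≤ m) (v : Fin m → Hyp g)
    (X : LabPart n 𝒱 (Fin k)) (X' : LabPart n 𝒱 (Fin m))
    (hX : Contracts n (e : V) h p hp X.1 X'.1) :
    ∑ i, cls e (insertPair h p hp v (bas g i) (sharp n g i)) X = cls e v X' := by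
  have := (Submodule.Quotient.mk_eq_zero (coendSub n 𝒱 e g)).2
    (Submodule.subset_span (CoendRel.contract h p hp v X X' hX))
  rw [← Submodule.mkQ_apply, map_sub, map_sum] at this
  exact sub_eq_zero.1 this

variable (n 𝒱 e g) in
/-- The class of a tensor, as a bilinear map. -/
def tensorCls (m : ℕ) : (⨂[ℚ]^m (Hyp g)) →ₗ[ℚ] PMod n 𝒱 (Fin m) →ₗ[ℚ] RV n 𝒱 e g :=
  (TensorProduct.mk ℚ (⨂[ℚ]^m (Hyp g)) (PMod n 𝒱 (Fin m))).compr₂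
    ((coendSub n 𝒱 e g).mkQ ∘ₗ DirectSum.lof ℚ ℕ (TermMod n 𝒱 g) m)

/-- This definitional identity reduces linearity of `cls` in vectors and labels to that of a
bilinear map. -/
theorem tensorCls_apply {m : ℕ} (v : Fin m → Hyp g) (X : LabPart n 𝒱 (Fin m)) :
    tensorCls n 𝒱 e g m (PiTensorProduct.tprod ℚ v) (PMod.of X) = cls e v X := rfl

theorem cls_label_linear {m : ℕ} (v : Fin m → Hyp g) {S : Finset (Fin m)} {d : ℕ} {c c' : V}
    {q q' : ℚ} {X : Multiset (Part V (Fin m))} (Z Z' Z'' : LabPart n 𝒱 (Fin m))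
    (h : Z.1 = ⟨S, d, c⟩ ::ₘ X) (h' : Z'.1 = ⟨S, d, c'⟩ ::ₘ X)
    (h'' : Z''.1 = ⟨S, d, q • c + q' • c'⟩ ::ₘ X) :
    cls e v Z'' = q • cls e v Z + q' • cls e v Z' := by
  simp only [← tensorCls_apply]
  rw [PMod.of_linear Z Z' Z'' h h' h'', map_add, map_smul, map_smul]

theorem cls_update {m : ℕ} (v : Fin m → Hyp g) (i : Fin m) (q q' : ℚ) (x y : Hyp g)
    (X : LabPart n 𝒱 (Fin m)) : cls e (Function.update v i (q • x + q' • y)) X =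
      q • cls e (Function.update v i x) X + q' • cls e (Function.update v i y) X := by
  simp only [← tensorCls_apply]
  rw [MultilinearMap.map_update_add, MultilinearMap.map_update_smul,
    MultilinearMap.map_update_smul, map_add, map_smul, map_smul, LinearMap.add_apply,
    LinearMap.smul_apply, LinearMap.smul_apply]

theorem kappa_linear {r d : ℕ} (c c' : 𝒱 d) (q q' : ℚ) (h : 2 * n < d + n * r)
    (v : Fin r → Hyp g) :
    kappa e (q • c + q' • c') h v = q • kappa e c h v + q' • kappa e c' h v :=
  cls_label_linear (S := Finset.univ) (c := (c : V)) (c' := (c' : V)) (X := 0) v _ _ _ rfl rfl rfl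

theorem kappa_update {r d : ℕ} (c : 𝒱 d) (h : 2 * n < d + n * r) (v : Fin r → Hyp g) (i : Fin r)
    (q q' : ℚ) (x y : Hyp g) : kappa e c h (Function.update v i (q • x + q' • y)) =
      q • kappa e c h (Function.update v i x) + q' • kappa e c h (Function.update v i y) :=
  cls_update v i q q' x y _

theorem kappa_zero {r d : ℕ} {c : 𝒱 d} (hc : c = 0) (h : 2 * n < d + n * r) (v : Fin r → Hyp g) :
    kappa e c h v = 0 := by
  have := kappa_linear (e := e) c c 0 0 h v
  simp only [zero_smul, add_zero] at this
  rw [hc, this]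

theorem kappa_smul {r d : ℕ} (c : 𝒱 d) (q : ℚ) (h : 2 * n < d + n * r) (v : Fin r → Hyp g) :
    kappa e (q • c) h v = q • kappa e c h v := by
  have := kappa_linear (e := e) c c q 0 h v
  rwa [zero_smul, add_zero, zero_smul, add_zero] at this

theorem kappa_congr {r r' d d' : ℕ} {c : 𝒱 d} {c' : 𝒱 d'} (hd : d = d') (hc : (c : V) = c')
    (hr : r = r') {h : 2 * n < d + n * r} {h' : 2 * n < d' + n * r'} {v : Fin r → Hyp g}
    {v' : Fin r' → Hyp g} (hv : v = v' ∘ Fin.cast hr) : kappa e c h v = kappa e c' h' v' := by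
  subst hd hr
  obtain rfl : c = c' := Subtype.ext hc
  obtain rfl : v = v' := hv
  rfl

theorem kappa_perm {r d : ℕ} (c : 𝒱 d) (h : 2 * n < d + n * r) (σ : Equiv.Perm (Fin r))
    (v : Fin r → Hyp g) :
    kappa e c h (v ∘ σ) = ((Equiv.Perm.sign σ : ℤ) : ℚ) ^ n • kappa e c h v :=
  cls_bij σ v _ _ (by simp [Part.map])

theorem map_castAdd_union_map_natAdd (r s : ℕ) :
    (Finset.univ.map (Fin.castAddEmb s) ∪ Finset.univ.map (Fin.natAddEmb r) :
      Finset (Fin (r + s))) = Finset.univ := by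
  ext i
  refine Fin.addCases (fun i => ?_) (fun i => ?_) i
  · simp only [Finset.mem_union, Finset.mem_univ, iff_true]
    exact Or.inl (Finset.mem_map_of_mem (Fin.castAddEmb s) (Finset.mem_univ i))
  · simp only [Finset.mem_union, Finset.mem_univ, iff_true]
    exact Or.inr (Finset.mem_map_of_mem (Fin.natAddEmb r) (Finset.mem_univ i))

/-- The block exchange is applied to the increasing list of all elements; the sign of the resulting
list counts the `r s` inversions between the two blocks. -/
theorem sign_finAddFlip (r s : ℕ) :
    (Equiv.Perm.sign ((finAddFlip (m := r) (n := s)).trans (finCongr (Nat.add_comm s r))) : ℤ) =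
      (-1) ^ (r * s) := by
  set l₁ := (List.finRange r).map (Fin.castAdd s)
  set l₂ := (List.finRange s).map (Fin.natAdd r)
  have hall : ∀ i, i ∈ l₁ ++ l₂ := fun i => by
    refine Fin.addCases (fun i => ?_) (fun i => ?_) i <;> simp [l₁, l₂]
  have h1 : listSign (l₁ ++ l₂) = 1 := by
    rw [listSign_append, listSign_map (Fin.strictMono_castAdd s),
      listSign_map (Fin.strictMono_natAdd r),
      listSign_of_pairwise_lt (List.pairwise_lt_finRange r),
      listSign_of_pairwise_lt (List.pairwise_lt_finRange s), crossSign_of_lt]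
    · rfl
    · intro a ha b hb
      obtain ⟨i, _, rfl⟩ := List.mem_map.1 ha
      obtain ⟨j, _, rfl⟩ := List.mem_map.1 hb
      rw [Fin.lt_def, Fin.val_castAdd, Fin.val_natAdd]
      omega
  have h2 := listSign_map_perm
    ((finAddFlip (m := r) (n := s)).trans (finCongr (Nat.add_comm s r))) hall
  rw [h1, mul_one] at h2
  rw [← h2, List.map_append, List.map_map, List.map_map]
  set f : Fin r → Fin (r + s) := (finAddFlip.trans (finCongr (Nat.add_comm s r))) ∘ Fin.castAdd s
  set f' : Fin s → Fin (r + s) := (finAddFlip.trans (finCongr (Nat.add_comm s r))) ∘ Fin.natAdd r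
  have hf : ∀ i, (f i : ℕ) = s + i := fun i => by simp [f, Nat.add_comm]
  have hf' : ∀ i, (f' i : ℕ) = i := fun i => by simp [f']
  rw [listSign_append, crossSign_swap, listSign_map, listSign_map,
      listSign_of_pairwise_lt (List.pairwise_lt_finRange r),
      listSign_of_pairwise_lt (List.pairwise_lt_finRange s), crossSign_of_lt]
  · simp
  · intro a ha b hb
    obtain ⟨i, _, rfl⟩ := List.mem_map.1 ha
    obtain ⟨j, _, rfl⟩ := List.mem_map.1 hb
    rw [Fin.lt_def, hf, hf']
    omega
  · intro i j hij
    rw [Fin.lt_def, hf', hf']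
    exact hij
  · intro i j hij
    rw [Fin.lt_def, hf, hf]
    exact Nat.add_lt_add_left hij s

/-- Disjoint union is commutative up to the block exchange of the `r + s` elements, which acts on
`det^{⊗ n}` by `(-1)^(n r s)`. -/
theorem cls_mul_comm {r s : ℕ} (v : Fin r → Hyp g) (w : Fin s → Hyp g) (X : LabPart n 𝒱 (Fin r))
    (Y : LabPart n 𝒱 (Fin s)) :
    cls e v X * cls e w Y = (-1 : ℚ) ^ (n * (r * s)) • (cls e w Y * cls e v X) := by
  rw [cls_mul, cls_mul]
  set τ : Equiv.Perm (Fin (r + s)) := finAddFlip.trans (finCongr (Nat.add_comm s r)) with hτ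
  have h1 : Fin.append v w = (Fin.append w v ∘ Fin.cast (Nat.add_comm r s)) ∘ τ := by
    funext i
    refine Fin.addCases (fun i => ?_) (fun i => ?_) i <;> simp [hτ]
  have h2 := cls_bij (e := e) τ (Fin.append w v ∘ Fin.cast (Nat.add_comm r s)) (X.union Y)
    ((X.union Y).map τ) rfl
  rw [h1, h2, sign_finAddFlip]
  push_cast
  rw [← pow_mul, mul_comm n]
  congr 1
  refine cls_congr (Nat.add_comm r s) rfl ?_
  simp only [LabPart.map, LabPart.union, Multiset.map_add, Multiset.map_map, Function.comp_def,
    Part.map_map]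
  refine (add_comm _ _).trans ?_
  congr 2
  · funext P
    congr 1
    ext i
    simp [hτ]
  · funext P
    congr 1
    ext i
    simp [hτ]

variable [GradedAlgebra 𝒱]

/-- Contraction of entries of two different classes. -/
theorem kappa_merge {r s d d' : ℕ} (c : 𝒱 d) (c' : 𝒱 d') (h : 2 * n < d + n * (r + 1))
    (h' : 2 * n < d' + n * (s + 1)) (h'' : 2 * n < d + d' + n * (r + s)) (v : Fin r → Hyp g)
    (w : Fin s → Hyp g) :
    ∑ i, kappa e c h (Fin.snoc v (bas g i)) * kappa e c' h' (Fin.cons (sharp n g i) w) =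
      kappa e (d := d + d') ⟨(c : V) * c', SetLike.GradedMul.mul_mem c.2 c'.2⟩ h''
        (Fin.append v w) := by
  -- In the concatenated list the contracted entries sit at the adjacent positions `r` and `r + 1`.
  have hk : (r + 1) + (s + 1) = (r + s) + 2 := by omega
  have key : ∀ x y, Fin.append (Fin.snoc v x : Fin (r + 1) → Hyp g) (Fin.cons y w) =
      insertPair hk r (by omega) (Fin.append v w) x y := by
    intro x y
    funext i
    refine Fin.addCases (fun i => ?_) (fun i => ?_) i
    · rw [Fin.append_left]
      refine Fin.lastCases ?_ (fun i => ?_) i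
      · simp [insertPair]
      · rw [Fin.snoc_castSucc]
        simp only [insertPair, Fin.val_castAdd, Fin.val_castSucc]
        rw [dif_pos i.2]
        exact (Fin.append_left v w i).symm
    · rw [Fin.append_right]
      refine Fin.cases ?_ (fun i => ?_) i
      · simp [insertPair]
      · rw [Fin.cons_succ]
        simp only [insertPair, Fin.val_natAdd, Fin.val_succ]
        rw [dif_neg (by omega), dif_neg (by omega), dif_neg (by omega), ← Fin.append_right v w i]
        congr 1
        ext
        simp
        omega
  simp only [kappa, cls_mul, key]
  refine cls_contract hk r (by omega) _ _ _ (Or.inr ⟨Finset.univ.map (Fin.castAddEmb s),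
    Finset.univ.map (Fin.natAddEmb r), d, d', c, c', 0, ?_, ?_⟩)
  · have h1 : Finset.univ.map (Fin.castAddEmb (s + 1)) =
        {⟨r, by omega⟩} ∪ (Finset.univ.map (Fin.castAddEmb s)).map (skip hk r) := by
      ext i
      simp only [Finset.mem_map, Finset.mem_univ, true_and, Finset.mem_union, Finset.mem_singleton,
        exists_exists_eq_and]
      constructor
      · rintro ⟨j, rfl⟩
        refine Fin.lastCases (Or.inl ?_) (fun j => Or.inr ⟨j, ?_⟩) j
        · ext; simp
        · ext; simp [skip_val]
      · rintro (rfl | ⟨j, rfl⟩)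
        · exact ⟨Fin.last r, by ext; simp⟩
        · exact ⟨j.castSucc, by ext; simp [skip_val]⟩
    have h2 : Finset.univ.map (Fin.natAddEmb (r + 1)) =
        {⟨r + 1, by omega⟩} ∪ (Finset.univ.map (Fin.natAddEmb r)).map (skip hk r) := by
      ext i
      simp only [Finset.mem_map, Finset.mem_univ, true_and, Finset.mem_union, Finset.mem_singleton,
        exists_exists_eq_and]
      constructor
      · rintro ⟨j, rfl⟩
        refine Fin.cases (Or.inl ?_) (fun j => Or.inr ⟨j, ?_⟩) j
        · ext; simp
        · ext; simp [skip_val]; omega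
      · rintro (rfl | ⟨j, rfl⟩)
        · exact ⟨0, by ext; simp⟩
        · exact ⟨j.succ, by ext; simp [skip_val]; omega⟩
    simp only [LabPart.union, Multiset.map_singleton, Part.map, h1, h2, Multiset.map_zero]
    rfl
  · rw [map_castAdd_union_map_natAdd]
    rfl

/-- Contraction of two entries of the same class. -/
theorem kappa_self {r p d : ℕ} (hp : p ≤ r) (c : 𝒱 d) (h : 2 * n < d + n * (r + 2))
    (h' : 2 * n < 2 * n + d + n * r) (v : Fin r → Hyp g) :
    ∑ i, kappa e c h (insertPair rfl p hp v (bas g i) (sharp n g i)) =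
      kappa e (d := 2 * n + d) ⟨(e : V) * c, SetLike.GradedMul.mul_mem e.2 c.2⟩ h' v := by
  refine cls_contract rfl p hp _ _ _ (Or.inl ⟨Finset.univ, d, c, 0, ?_, rfl⟩)
  have : (Finset.univ : Finset (Fin (r + 2))) =
      {⟨p, by omega⟩, ⟨p + 1, by omega⟩} ∪ Finset.univ.map (skip rfl p) := by
    ext i
    simp only [Finset.mem_map, Finset.mem_univ, true_and, Finset.mem_union, Finset.mem_singleton,
      Finset.mem_insert, true_iff, Fin.ext_iff, skip_val]
    rcases lt_trichotomy (i : ℕ) p with hi | hi | hi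
    · exact Or.inr ⟨⟨i, by omega⟩, by simp [hi]⟩
    · exact Or.inl (Or.inl hi)
    · by_cases hi' : (i : ℕ) = p + 1
      · exact Or.inl (Or.inr hi')
      · refine Or.inr ⟨⟨i - 2, by omega⟩, ?_⟩
        rw [if_neg (by dsimp only; omega)]
        dsimp only
        omega
  change ({(⟨Finset.univ, d, (c : V)⟩ : Part V (Fin (r + 2)))} : Multiset _) = _
  rw [this]
  rfl

end Coend

/-! ### The homomorphism from the small presentation -/

section Merge

variable {V : Type u} [CommRing V] [Algebra ℚ V] {n : ℕ} {𝒱 : ℕ → Submodule ℚ V}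
  [GradedAlgebra 𝒱] {g : ℕ}

theorem snoc_elim0 (x : Hyp g) : (Fin.snoc (Fin.elim0 : Fin 0 → Hyp g) x : Fin 1 → Hyp g) = ![x] := by
  funext i; fin_cases i; rfl

theorem cons_elim0 (x : Hyp g) : (Fin.cons x (Fin.elim0 : Fin 0 → Hyp g) : Fin 1 → Hyp g) = ![x] :=
  rfl

theorem snoc_singleton (x y : Hyp g) : (Fin.snoc ![x] y : Fin 2 → Hyp g) = ![x, y] := by
  funext i; fin_cases i <;> rfl

theorem snoc_pair (x y z : Hyp g) : (Fin.snoc ![x, y] z : Fin 3 → Hyp g) = ![x, y, z] := by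
  funext i; fin_cases i <;> rfl

theorem cons_pair (x y z : Hyp g) : (Fin.cons x ![y, z] : Fin 3 → Hyp g) = ![x, y, z] := rfl

/-- The unit of `𝒱` as a label of degree zero. -/
def oneLabel (𝒱 : ℕ → Submodule ℚ V) [GradedAlgebra 𝒱] : 𝒱 0 := ⟨1, SetLike.GradedOne.one_mem⟩

theorem sum_kappa_one_mul_kappa (hn : 0 < n) (e : 𝒱 (2 * n)) {d : ℕ} (hd : n < d) (c : 𝒱 d) (v w : Hyp g) :
    ∑ i, kappa e (r := 3) (oneLabel 𝒱) (by omega) ![v, w, bas g i] *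
      kappa e (r := 1) c (by omega) ![sharp n g i] =
    kappa e (r := 2) c (by omega) ![v, w] := by
  have := kappa_merge (e := e) (oneLabel 𝒱) c (r := 2) (s := 0) (by omega) (by omega) (by omega)
    ![v, w] Fin.elim0
  simp only [snoc_pair, cons_elim0] at this
  refine this.trans (kappa_congr (zero_add d) (one_mul _) rfl ?_)
  funext i; fin_cases i <;> rfl

theorem sum_kappa_pair_mul_kappa (hn : 0 < n) (e : 𝒱 (2 * n)) {d d' : ℕ} (hd : n < d) (hd' : n < d') (c : 𝒱 d) (c' : 𝒱 d')
    (v : Hyp g) :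
    ∑ i, kappa e (r := 2) c (by omega) ![v, bas g i] *
      kappa e (r := 1) c' (by omega) ![sharp n g i] =
    kappa e (r := 1) (d := d + d') ⟨(c : V) * c', SetLike.GradedMul.mul_mem c.2 c'.2⟩ (by omega)
      ![v] := by
  have := kappa_merge (e := e) c c' (r := 1) (s := 0) (by omega) (by omega) (by omega)
    ![v] Fin.elim0
  simp only [snoc_singleton, cons_elim0] at this
  refine this.trans (kappa_congr rfl rfl rfl ?_)
  funext i; fin_cases i; rfl

theorem sum_kappa_one_mul_kappa_one (hn : 0 < n) (e : 𝒱 (2 * n)) (v w x y : Hyp g) :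
    ∑ i, kappa e (r := 3) (oneLabel 𝒱) (by omega) ![v, w, bas g i] *
      kappa e (r := 3) (oneLabel 𝒱) (by omega) ![sharp n g i, x, y] =
    kappa e (r := 4) (oneLabel 𝒱) (by omega) ![v, w, x, y] := by
  have := kappa_merge (e := e) (oneLabel 𝒱) (oneLabel 𝒱) (r := 2) (s := 2) (by omega) (by omega)
    (by omega) ![v, w] ![x, y]
  simp only [snoc_pair, cons_pair] at this
  refine this.trans (kappa_congr (zero_add 0) (one_mul _) rfl ?_)
  funext i; fin_cases i <;> rfl

end Merge

/-! ### The relations of the small presentation hold in the coend -/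

section ToCoend

variable {V : Type u} [CommRing V] [Algebra ℚ V] {n : ℕ} {𝒱 : ℕ → Submodule ℚ V}
  [GradedAlgebra 𝒱] (hn : 0 < n) (e : 𝒱 (2 * n)) {g : ℕ}

/-- The number of vectors of a generator. -/
def Gen.arity : Gen n 𝒱 g → ℕ
  | .k0 _ _ => 0
  | .k1 _ _ _ => 1
  | .k3 _ => 3

theorem Gen.toRV_mul_comm (x y : Gen n 𝒱 g) : x.toRV hn e * y.toRV hn e =
    (-1 : ℚ) ^ (n * (x.arity * y.arity)) • (y.toRV hn e * x.toRV hn e) := by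
  cases x <;> cases y <;> exact cls_mul_comm _ _ _ _

theorem Gen.toRV_eq_zero_or (hodd : ∀ k, Odd k → 𝒱 k = ⊥) (x : Gen n 𝒱 g) :
    x.toRV hn e = 0 ∨ (-1 : ℚ) ^ x.deg = (-1) ^ (n * x.arity) := by
  have hzero : ∀ d, Odd d → ∀ c : 𝒱 d, c = 0 := fun d hd c =>
    Subtype.ext ((Submodule.eq_bot_iff _).1 (hodd d hd) _ c.2)
  have hpow : ∀ d k : ℕ, k ≤ d → Even d → (-1 : ℚ) ^ (d - k) = (-1) ^ k := fun d k hk hd => by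
    have h1 : (-1 : ℚ) ^ (d - k) * (-1) ^ k = 1 := by
      rw [← pow_add, Nat.sub_add_cancel hk, hd.neg_one_pow]
    have h2 := neg_one_pow_mul_self k
    linear_combination (-1 : ℚ) ^ k * h1 - (-1 : ℚ) ^ (d - k) * h2
  cases x with
  | @k0 d hd c =>
    rcases Nat.even_or_odd d with h | h
    · right
      simp only [Gen.deg, Gen.arity]
      rw [hpow _ _ hd.le h, pow_mul]
      simp
    · exact Or.inl (kappa_zero (r := 0) (hzero _ h c) (by omega) Fin.elim0)
  | @k1 d hd c v =>
    rcases Nat.even_or_odd d with h | h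
    · right
      simp only [Gen.deg, Gen.arity]
      rw [hpow _ _ hd.le h, mul_one]
    · exact Or.inl (kappa_zero (r := 1) (hzero _ h c) (by omega) ![v])
  | k3 v =>
    right
    simp only [Gen.deg, Gen.arity]
    rw [show n * 3 = n + n + n by ring, pow_add, pow_add, neg_one_pow_mul_self, one_mul]

/-- The coend gives a sign in terms of the numbers of vectors. It agrees with the sign of the
degrees because the degree of a generator with nonzero class has the parity of `n` times its number
of vectors. -/
theorem Gen.toRV_comm (hodd : ∀ k, Odd k → 𝒱 k = ⊥) (x y : Gen n 𝒱 g) :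
    x.toRV hn e * y.toRV hn e =
      (-1 : ℚ) ^ (x.deg * y.deg) • (y.toRV hn e * x.toRV hn e) := by
  rcases x.toRV_eq_zero_or hn e hodd with h | hx
  · rw [h, zero_mul, mul_zero, smul_zero]
  rcases y.toRV_eq_zero_or hn e hodd with h | hy
  · rw [h, zero_mul, mul_zero, smul_zero]
  rw [Gen.toRV_mul_comm]
  congr 1
  have h1 : (-1 : ℚ) ^ (x.deg * y.deg) = (-1) ^ (n * (n * (x.arity * y.arity))) := by
    calc (-1 : ℚ) ^ (x.deg * y.deg) = ((-1) ^ y.deg) ^ (n * x.arity) := by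
          rw [pow_mul, hx, ← pow_mul, mul_comm, pow_mul]
      _ = _ := by
          rw [hy, ← pow_mul]
          congr 1
          ring
  rw [h1, pow_mul (-1 : ℚ) n (n * _), pow_mul (-1 : ℚ) n (x.arity * y.arity)]
  rcases neg_one_pow_eq_or ℚ n with h | h
  · rw [h, one_pow, one_pow]
  · rw [h, pow_mul (-1 : ℚ) n, h]

/-- The classes in `R^𝒱` satisfy the relations of the small presentation. -/
theorem toRV_rel (hodd : ∀ k, Odd k → 𝒱 k = ⊥) ⦃x y : FreeAlgebra ℚ (Gen n 𝒱 g)⦄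
    (h : Rel hn e x y) : FreeAlgebra.lift ℚ (Gen.toRV hn e) x =
      FreeAlgebra.lift ℚ (Gen.toRV hn e) y := by
  cases h with
  | comm x y =>
    simp only [map_mul, map_smul, FreeAlgebra.lift_ι_apply]
    exact Gen.toRV_comm hn e hodd x y
  | lin0 hd c c' q q' =>
    simp only [map_add, map_smul, FreeAlgebra.lift_ι_apply]
    exact kappa_linear (r := 0) c c' q q' (by omega) Fin.elim0
  | lin1 hd c c' q q' v =>
    simp only [map_add, map_smul, FreeAlgebra.lift_ι_apply]
    exact kappa_linear (r := 1) c c' q q' (by omega) ![v]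
  | lin1v hd c q q' v v' =>
    simp only [map_add, map_smul, FreeAlgebra.lift_ι_apply, Gen.toRV]
    have h : ∀ z : Hyp g, ![z] = Function.update ![0] 0 z := fun z => by
      funext i; fin_cases i; rfl
    rw [h, h v, h v']
    exact kappa_update (r := 1) c (by omega) _ _ _ _ _ _
  | lin3 v i q q' w w' =>
    simp only [map_add, map_smul, FreeAlgebra.lift_ι_apply]
    exact kappa_update (r := 3) (oneLabel 𝒱) (by omega) v i q q' w w'
  | alpha σ v =>
    simp only [map_smul, FreeAlgebra.lift_ι_apply]
    exact kappa_perm (r := 3) (oneLabel 𝒱) (by omega) σ v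
  | @beta p q hp hq x y =>
    simp only [map_sum, map_mul, FreeAlgebra.lift_ι_apply]
    have := kappa_merge (e := e) x y (r := 0) (s := 0) (by omega) (by omega) (by omega)
      (Fin.elim0 : Fin 0 → Hyp g) Fin.elim0
    simp only [snoc_elim0, cons_elim0] at this
    exact Eq.trans (kappa_congr (h := by omega) rfl rfl rfl (Subsingleton.elim _ _)) this.symm
  | @gamma p q hp hq x y v =>
    simp only [map_sum, map_mul, FreeAlgebra.lift_ι_apply]
    rw [Finset.sum_comm]
    simp only [← Finset.sum_mul]
    -- The class `κ_y` is split off first; then `κ_x(v ⊗ aⱼ)` is split into a cubic class and `κ_x`.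
    refine Eq.trans (sum_kappa_pair_mul_kappa hn e hp hq x y v).symm ?_
    refine Finset.sum_congr rfl fun j _ => ?_
    rw [← sum_kappa_one_mul_kappa hn e hp x v (bas g j)]
    rfl
  | delta v =>
    simp only [map_sum, FreeAlgebra.lift_ι_apply]
    have := kappa_self (e := e) (r := 1) (p := 1) le_rfl (oneLabel 𝒱) (by omega) (by omega) ![v]
    refine Eq.trans ?_ (this.trans (kappa_congr (h' := by omega) (add_zero _) (mul_one _) rfl rfl))
    refine Finset.sum_congr rfl fun i _ => kappa_congr (h := by omega) rfl rfl rfl ?_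
    funext i; fin_cases i <;> rfl
  | epsilon v₁ v₂ v₅ v₆ =>
    simp only [map_sum, map_mul, FreeAlgebra.lift_ι_apply]
    -- Both sides are values of `κ_1` on four vectors, which differ by a cyclic permutation of the
    -- last three; this permutation is even.
    refine (sum_kappa_one_mul_kappa_one hn e v₁ v₂ v₅ v₆).trans
      (Eq.trans ?_ (sum_kappa_one_mul_kappa_one hn e v₁ v₅ v₆ v₂).symm)
    have := kappa_perm (e := e) (oneLabel 𝒱) (r := 4) (by omega)
      (Equiv.swap 1 3 * Equiv.swap 2 3) ![v₁, v₅, v₆, v₂]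
    have hs : Equiv.Perm.sign (Equiv.swap (1 : Fin 4) 3 * Equiv.swap 2 3) = 1 := by decide
    rw [hs, Units.val_one, Int.cast_one, one_pow, one_smul] at this
    rw [← this]
    refine kappa_congr rfl rfl rfl ?_
    funext i; fin_cases i <;> rfl

variable (g) in
/-- The homomorphism from the small presentation to `R^𝒱`. -/
def toCoend (hodd : ∀ k, Odd k → 𝒱 k = ⊥) : SmallPres hn e g →ₐ[ℚ] RV n 𝒱 e g :=
  RingQuot.liftAlgHom ℚ ⟨FreeAlgebra.lift ℚ (Gen.toRV hn e), toRV_rel hn e hodd⟩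

theorem toCoend_gen (hodd : ∀ k, Odd k → 𝒱 k = ⊥) (x : Gen n 𝒱 g) :
    toCoend hn e g hodd (SmallPres.gen hn e x) = x.toRV hn e := by
  rw [toCoend, SmallPres.gen, RingQuot.liftAlgHom_mkAlgHom_apply, FreeAlgebra.lift_ι_apply]

/-- Both maps are multiplicative, so the composite is an algebra endomorphism, and it suffices that
it fixes the generators. -/
theorem smallInv_toCoend [Nontrivial V] (hodd : ∀ k, Odd k → 𝒱 k = ⊥)
    (h0 : 𝒱 0 = Submodule.span ℚ {1}) (hlow : ∀ k, 0 < k → k ≤ n → 𝒱 k = ⊥)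
    (x : SmallPres hn e g) : smallInv hn e g hodd h0 hlow (toCoend hn e g hodd x) = x := by
  have : (AlgHom.ofLinearMap (smallInv hn e g hodd h0 hlow) (smallInv_one hodd h0 hlow)
      (smallInv_mul hodd h0 hlow)).comp (toCoend hn e g hodd) = AlgHom.id ℚ _ := by
    refine RingQuot.ringQuot_ext' ℚ _ _ (FreeAlgebra.hom_ext (funext fun y => ?_))
    change smallInv hn e g hodd h0 hlow (toCoend hn e g hodd (SmallPres.gen hn e y)) =
      SmallPres.gen hn e y
    rw [toCoend_gen, smallInv_toRV]
  exact DFunLike.congr_fun this x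

end ToCoend

/-! ### Degrees and surjectivity -/

section Degree

variable {V : Type u} [CommRing V] [Algebra ℚ V] {n : ℕ} {𝒱 : ℕ → Submodule ℚ V}
  {e : 𝒱 (2 * n)} {g : ℕ}

theorem cls_mem_degreePart {m : ℕ} (v : Fin m → Hyp g) (X : LabPart n 𝒱 (Fin m)) :
    cls e v X ∈ degreePart n 𝒱 e g X.degree := Submodule.subset_span ⟨m, v, X, rfl, rfl⟩

theorem LabPart.degree_union {k m : ℕ} (X : LabPart n 𝒱 (Fin k)) (Y : LabPart n 𝒱 (Fin m)) :
    (X.union Y).degree = X.degree + Y.degree := by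
  simp [LabPart.degree, LabPart.union, Part.map]

theorem degreePart_mul {j k : ℕ} {x y : RV n 𝒱 e g} (hx : x ∈ degreePart n 𝒱 e g j)
    (hy : y ∈ degreePart n 𝒱 e g k) : x * y ∈ degreePart n 𝒱 e g (j + k) := by
  have := Submodule.mul_mem_mul hx hy
  rw [degreePart, degreePart, Submodule.span_mul_span] at this
  refine Submodule.span_mono ?_ this
  rintro _ ⟨_, ⟨m, v, X, rfl, rfl⟩, _, ⟨m', v', X', rfl, rfl⟩, rfl⟩
  exact ⟨_, _, X.union X', LabPart.degree_union X X', cls_mul v v' X X'⟩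

theorem kappa_mem_degreePart {r d k : ℕ} (c : 𝒱 d) (h : 2 * n < d + n * r) (v : Fin r → Hyp g)
    (hk : d + n * r - 2 * n = k) : kappa e c h v ∈ degreePart n 𝒱 e g k := by
  have := cls_mem_degreePart (e := e) v ⟨_, isLabelled_singleton c h⟩
  subst hk
  simpa [LabPart.degree, kappa] using this

variable [GradedAlgebra 𝒱] (hn : 0 < n)

theorem SmallPres.degreePart_mul {j k : ℕ} {x y : SmallPres hn e g}
    (hx : x ∈ SmallPres.degreePart hn e g j) (hy : y ∈ SmallPres.degreePart hn e g k) :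
    x * y ∈ SmallPres.degreePart hn e g (j + k) := by
  have := Submodule.mul_mem_mul hx hy
  rw [SmallPres.degreePart, SmallPres.degreePart, Submodule.span_mul_span] at this
  refine Submodule.span_mono ?_ this
  rintro _ ⟨_, ⟨l, rfl, rfl⟩, _, ⟨l', rfl, rfl⟩, rfl⟩
  exact ⟨l ++ l', by simp, by simp⟩

theorem SmallPres.gen_mem_degreePart (x : Gen n 𝒱 g) :
    SmallPres.gen hn e x ∈ SmallPres.degreePart hn e g x.deg :=
  Submodule.subset_span ⟨[x], by simp, by simp⟩

theorem SmallPres.one_mem_degreePart : (1 : SmallPres hn e g) ∈ SmallPres.degreePart hn e g 0 :=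
  Submodule.subset_span ⟨[], rfl, rfl⟩

theorem Gen.toRV_mem_degreePart (x : Gen n 𝒱 g) :
    x.toRV hn e ∈ degreePart n 𝒱 e g x.deg := by
  cases x with
  | k0 hd c => exact kappa_mem_degreePart (r := 0) c (by omega) Fin.elim0 (by simp [Gen.deg])
  | k1 hd c v => exact kappa_mem_degreePart (r := 1) c (by omega) ![v] (by simp only [Gen.deg]; omega)
  | k3 v => exact kappa_mem_degreePart (r := 3) (oneLabel 𝒱) (by omega) v (by simp only [Gen.deg]; omega)

variable (hodd : ∀ k, Odd k → 𝒱 k = ⊥)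

theorem toCoend_mem_degreePart {k : ℕ} {x : SmallPres hn e g}
    (hx : x ∈ SmallPres.degreePart hn e g k) :
    toCoend hn e g hodd x ∈ degreePart n 𝒱 e g k := by
  have : SmallPres.degreePart hn e g k ≤
      (degreePart n 𝒱 e g k).comap (toCoend hn e g hodd).toLinearMap := by
    rw [SmallPres.degreePart, Submodule.span_le]
    rintro _ ⟨l, rfl, rfl⟩
    change toCoend hn e g hodd _ ∈ degreePart n 𝒱 e g _
    clear hx
    induction l with
    | nil =>
      change toCoend hn e g hodd 1 ∈ degreePart n 𝒱 e g 0
      rw [map_one]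
      exact cls_mem_degreePart Fin.elim0 emptyPart
    | cons y l ih =>
      simp only [List.map_cons, List.prod_cons, List.sum_cons]
      rw [map_mul, toCoend_gen]
      exact degreePart_mul (y.toRV_mem_degreePart hn) ih
  exact this hx

variable (e g) in
/-- The image in `R^𝒱` of the degree `k` part of the small presentation. -/
def imagePart (k : ℕ) : Submodule ℚ (RV n 𝒱 e g) :=
  (SmallPres.degreePart hn e g k).map (toCoend hn e g hodd).toLinearMap

variable {hn hodd}

theorem imagePart_mul {j k : ℕ} {x y : RV n 𝒱 e g} (hx : x ∈ imagePart e g hn hodd j)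
    (hy : y ∈ imagePart e g hn hodd k) : x * y ∈ imagePart e g hn hodd (j + k) := by
  obtain ⟨x, hx, rfl⟩ := hx
  obtain ⟨y, hy, rfl⟩ := hy
  exact ⟨x * y, SmallPres.degreePart_mul hn hx hy, map_mul (toCoend hn e g hodd) x y⟩

theorem toRV_mem_imagePart (x : Gen n 𝒱 g) : x.toRV hn e ∈ imagePart e g hn hodd x.deg :=
  ⟨_, SmallPres.gen_mem_degreePart hn x, toCoend_gen hn e hodd x⟩

/-- Splitting off the last two vectors with a cubic class lowers the number of vectors by one and
accounts for degree `n`. Positivity of the degree stops the recursion exactly at the generators. -/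
theorem kappa_mem_imagePart (h0 : 𝒱 0 = Submodule.span ℚ {1})
    (hlow : ∀ k, 0 < k → k ≤ n → 𝒱 k = ⊥) {d : ℕ} (c : 𝒱 d) (r : ℕ) (h : 2 * n < d + n * r)
    (v : Fin r → Hyp g) : kappa e c h v ∈ imagePart e g hn hodd (d + n * r - 2 * n) := by
  have step : ∀ s (h : 2 * n < d + n * (s + 2)) (v : Fin (s + 2) → Hyp g),
      2 * n < d + n * (s + 1) → (∀ (h : 2 * n < d + n * (s + 1)) (v : Fin (s + 1) → Hyp g),
        kappa e c h v ∈ imagePart e g hn hodd (d + n * (s + 1) - 2 * n)) →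
      kappa e c h v ∈ imagePart e g hn hodd (d + n * (s + 2) - 2 * n) := by
    intro s h v h1 ih
    have h2 := kappa_merge (e := e) c (oneLabel 𝒱) (r := s) (s := 2) h1 (by omega) h
      (fun i => v (Fin.castAdd 2 i)) (fun i => v (Fin.natAdd s i))
    rw [Fin.append_castAdd_natAdd] at h2
    have h3 : kappa e c h v = kappa e (d := d + 0) ⟨(c : V) * (oneLabel 𝒱 : 𝒱 0),
        SetLike.GradedMul.mul_mem c.2 (oneLabel 𝒱).2⟩ h v :=
      kappa_congr rfl (mul_one _).symm rfl rfl
    rw [h3, ← h2]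
    refine Submodule.sum_mem _ fun i _ => ?_
    have h4 : d + n * (s + 2) - 2 * n = (d + n * (s + 1) - 2 * n) + n := by
      have e1 : n * (s + 2) = n * (s + 1) + n := by ring
      omega
    rw [h4]
    exact imagePart_mul (ih _ _) (toRV_mem_imagePart (.k3 _))
  rcases label_cases h0 hlow c.2 with ⟨rfl, q, hq⟩ | hd | hc
  -- A scalar label needs at least three vectors, and the base case is the cubic generator; a label
  -- of degree `> n` descends to one vector, or has none.
  · obtain ⟨s, rfl⟩ : ∃ s, r = s + 3 := by
      refine Nat.exists_eq_add_of_le' ?_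
      by_contra hr
      have : n * r ≤ n * 2 := Nat.mul_le_mul_left n (by omega)
      omega
    induction s with
    | zero =>
      obtain rfl : c = q • oneLabel 𝒱 := Subtype.ext hq
      rw [kappa_smul]
      have := toRV_mem_imagePart (hn := hn) (hodd := hodd) (e := e) (.k3 v)
      rw [show 0 + n * (0 + 3) - 2 * n = n by omega]
      exact Submodule.smul_mem _ q this
    | succ s ih =>
      refine step (s + 2) h v ?_ (fun h v => ih v h)
      have : n * 3 ≤ n * (s + 2 + 1) := Nat.mul_le_mul_left n (by omega)
      omega
  · match r with
    | 0 =>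
      have := toRV_mem_imagePart (hn := hn) (hodd := hodd) (e := e) (g := g)
        (.k0 (by simpa using h) c)
      rw [show v = Fin.elim0 from Subsingleton.elim _ _]
      exact this
    | r + 1 =>
      induction r with
      | zero =>
        have := toRV_mem_imagePart (hn := hn) (hodd := hodd) (e := e) (.k1 hd c (v 0))
        rw [show v = ![v 0] by funext i; fin_cases i; rfl]
        rw [show d + n * (0 + 1) - 2 * n = d - n by omega]
        exact this
      | succ r ih =>
        refine step r h v ?_ (fun h v => ih h v)
        have : n * 1 ≤ n * (r + 1) := Nat.mul_le_mul_left n (by omega)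
        omega
  · rw [kappa_zero (Subtype.ext hc)]
    exact Submodule.zero_mem _

end Degree

/-! ### Restricting labelled parts to a subset -/

section Comap

variable {V : Type u}

/-- The preimage of a labelled part under an injection. -/
def Part.comap {S T : Type} [Fintype T] [DecidableEq S] (f : T ↪ S) (Q : Part V S) : Part V T :=
  ⟨Finset.univ.filter fun t => f t ∈ Q.carrier, Q.deg, Q.label⟩

theorem Part.map_comap {S T : Type} [Fintype T] [DecidableEq S] {f : T ↪ S} {Q : Part V S}
    (h : ∀ s ∈ Q.carrier, ∃ t, f t = s) : (Q.comap f).map f = Q := by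
  refine Part.ext ?_ rfl rfl
  ext s
  simp only [Part.map, Part.comap, Finset.mem_map, Finset.mem_filter, Finset.mem_univ, true_and]
  constructor
  · rintro ⟨t, ht, rfl⟩
    exact ht
  · intro hs
    obtain ⟨t, rfl⟩ := h s hs
    exact ⟨t, hs, rfl⟩

theorem multiset_map_comap {S T : Type} [Fintype T] [DecidableEq S] {f : T ↪ S}
    {X : Multiset (Part V S)} (h : ∀ Q ∈ X, ∀ s ∈ Q.carrier, ∃ t, f t = s) :
    (X.map (Part.comap f)).map (Part.map f) = X := by
  rw [Multiset.map_map]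
  exact (Multiset.map_congr rfl fun Q hQ => Part.map_comap (h Q hQ)).trans (Multiset.map_id X)

end Comap

/-! ### Splitting off one part, and surjectivity in each degree -/

section Surjective

variable {V : Type u} [CommRing V] [Algebra ℚ V] {n : ℕ} {𝒱 : ℕ → Submodule ℚ V}
  {e : 𝒱 (2 * n)} {g : ℕ}

/-- The range of `f` is the complement of `P`, and the other parts are disjoint from `P`, so
restricting along `f` loses none of their elements. -/
theorem isLabelled_comap {S T : Type} [Fintype T] [DecidableEq S] [DecidableEq T] {f : T ↪ S}
    {P : Part V S} {X : Multiset (Part V S)} (hX : IsLabelled n 𝒱 (P ::ₘ X))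
    (hf : ∀ s, (∃ t, f t = s) ↔ s ∉ P.carrier) : IsLabelled n 𝒱 (X.map (Part.comap f)) := by
  have hmap := multiset_map_comap (f := f) (X := X) fun Q hQ s hs =>
    (hf s).2 fun hsP => hX.notMem_of_cons hsP hQ hs
  refine ⟨fun t => ?_, fun R hR => ?_, fun R hR => ?_⟩
  · have h := hX.partition (f t)
    rw [Multiset.countP_cons_of_neg (p := fun P : Part V S => f t ∈ P.carrier) _
      ((hf _).1 ⟨t, rfl⟩)] at h
    rw [← h, Multiset.countP_map, Multiset.countP_eq_card_filter]
    congr 2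
    ext Q
    simp [Part.comap]
  · obtain ⟨Q, hQ, rfl⟩ := Multiset.mem_map.1 hR
    exact hX.homogeneous Q (Multiset.mem_cons_of_mem hQ)
  · obtain ⟨Q, hQ, rfl⟩ := Multiset.mem_map.1 hR
    have h := hX.allowed Q (Multiset.mem_cons_of_mem hQ)
    rw [← Part.map_comap (f := f) (Q := Q) fun s hs =>
      (hf s).2 fun hsP => hX.notMem_of_cons hsP hQ hs] at h
    simpa [Part.map] using h

/-- A permutation which moves the first `r` elements to a given set of `r` elements. -/
theorem exists_perm_map_castAdd {r s : ℕ} (P : Finset (Fin (r + s))) (hP : P.card = r) :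
    ∃ σ : Equiv.Perm (Fin (r + s)),
      (Finset.univ.map (Fin.castAddEmb s)).map σ.toEmbedding = P := by
  have hPc : Pᶜ.card = s := by rw [Finset.card_compl, hP, Fintype.card_fin]; omega
  refine ⟨finSumFinEquiv.symm.trans (finSumEquivOfFinset hP hPc), ?_⟩
  refine Finset.eq_of_subset_of_card_le (fun i hi => ?_) (by simp [hP])
  simp only [Finset.mem_map, Finset.mem_univ, true_and, exists_exists_eq_and] at hi
  obtain ⟨j, rfl⟩ := hi
  simp [Finset.orderEmbOfFin_mem]

/-- A permutation brings the elements of `P` to the front, at the cost of the scalar `q =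
sign(σ)^n`. The partition then is the disjoint union of a single part and the restriction of the
others. -/
theorem exists_cls_eq_kappa_mul [GradedAlgebra 𝒱] {m : ℕ} (v : Fin m → Hyp g)
    (X : LabPart n 𝒱 (Fin m)) {P : Part V (Fin m)} {X' : Multiset (Part V (Fin m))}
    (hX : X.1 = P ::ₘ X') :
    ∃ (r s : ℕ) (c : 𝒱 P.deg) (h : 2 * n < P.deg + n * r) (w : Fin r → Hyp g) (w' : Fin s → Hyp g)
      (Y : LabPart n 𝒱 (Fin s)) (q : ℚ), cls e v X = q • (kappa e c h w * cls e w' Y) ∧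
      Y.1.card = X'.card ∧ X.degree = P.deg + n * r - 2 * n + Y.degree := by
  generalize hr : P.carrier.card = r
  obtain ⟨s, rfl⟩ : ∃ s, m = r + s := by
    refine Nat.exists_eq_add_of_le ?_
    rw [← hr]
    simpa using P.carrier.card_le_univ
  have hXl := X.2
  rw [hX] at hXl
  obtain ⟨σ, hσ⟩ := exists_perm_map_castAdd P.carrier hr
  set f : Fin s ↪ Fin (r + s) := (Fin.natAddEmb r).trans σ.toEmbedding with hfdef
  have hf : ∀ i, (∃ t, f t = i) ↔ i ∉ P.carrier := by
    intro i
    rw [← hσ, ← σ.apply_symm_apply i]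
    generalize σ.symm i = j
    refine Fin.addCases (fun j => ?_) (fun j => ?_) j
    · simp [hfdef, Fin.ext_iff]
      intro x
      omega
    · simp [hfdef, Fin.ext_iff]
      intro x
      omega
  have hPl : P.label ∈ 𝒱 P.deg := hXl.homogeneous P (Multiset.mem_cons_self _ _)
  have hPa : 2 * n < P.deg + n * r := by
    have h := hXl.allowed P (Multiset.mem_cons_self _ _)
    rwa [hr] at h
  set Y : LabPart n 𝒱 (Fin s) := ⟨_, isLabelled_comap hXl hf⟩ with hY
  set Z : LabPart n 𝒱 (Fin r) := ⟨_, isLabelled_singleton (⟨P.label, hPl⟩ : 𝒱 P.deg) hPa⟩ with hZ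
  have hmap : (Z.union Y).1.map (Part.map σ.toEmbedding) = X.1 := by
    have h1 : (Z.1.map (Part.map (Fin.castAddEmb s))).map (Part.map σ.toEmbedding) = {P} := by
      simp only [hZ, Multiset.map_singleton]
      exact congrArg _ (Part.ext hσ rfl rfl)
    have h2 : (Y.1.map (Part.map (Fin.natAddEmb r))).map (Part.map σ.toEmbedding) = X' := by
      rw [Multiset.map_map, ← multiset_map_comap (f := f) (X := X') fun Q hQ s hs =>
        (hf s).2 fun hsP => hXl.notMem_of_cons hsP hQ hs]
      exact Multiset.map_congr rfl fun Q _ => Part.map_map _ _ Q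
    rw [hX, LabPart.union, Multiset.map_add, h1, h2, Multiset.singleton_add]
  refine ⟨r, s, ⟨P.label, hPl⟩, hPa, fun i => v (σ (Fin.castAdd s i)),
    fun i => v (σ (Fin.natAdd r i)), Y, ((Equiv.Perm.sign σ : ℤ) : ℚ) ^ n, ?_, ?_, ?_⟩
  · rw [kappa, cls_mul]
    have h1 := cls_bij (e := e) σ v _ _ hmap
    have h2 : Fin.append (fun i => v (σ (Fin.castAdd s i))) (fun i => v (σ (Fin.natAdd r i))) =
        v ∘ σ := Fin.append_castAdd_natAdd (f := v ∘ σ)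
    -- The sign of `σ` is its own inverse, so the factor from the bijection relation cancels `q`.
    rw [h2, h1, smul_smul, ← mul_pow, ← Int.cast_mul, ← Units.val_mul, Int.units_mul_self,
      Units.val_one, Int.cast_one, one_pow, one_smul]
  · simp [hY]
  · have h1 : X.degree = (Z.union Y).degree := by
      rw [LabPart.degree, ← hmap, Multiset.map_map]
      simp [LabPart.degree, Part.map]
    rw [h1, LabPart.degree_union]
    simp [LabPart.degree, hZ]

variable [GradedAlgebra 𝒱] {hn : 0 < n} {hodd : ∀ k, Odd k → 𝒱 k = ⊥}

/-- Induction on the number of parts; without parts there are no elements either, and the class is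
`1`. -/
theorem cls_mem_imagePart (h0 : 𝒱 0 = Submodule.span ℚ {1})
    (hlow : ∀ k, 0 < k → k ≤ n → 𝒱 k = ⊥) {m : ℕ} (v : Fin m → Hyp g) (X : LabPart n 𝒱 (Fin m)) :
    cls e v X ∈ imagePart e g hn hodd X.degree := by
  generalize hN : X.1.card = N
  induction N generalizing m with
  | zero =>
    have hX : X.1 = 0 := Multiset.card_eq_zero.1 hN
    obtain rfl : m = 0 := by
      by_contra hm
      have := X.2.partition ⟨0, Nat.pos_of_ne_zero hm⟩
      rw [hX, Multiset.countP_zero] at this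
      omega
    obtain rfl : X = emptyPart := Subtype.ext hX
    rw [Subsingleton.elim v Fin.elim0]
    exact ⟨1, SmallPres.one_mem_degreePart hn, map_one (toCoend hn e g hodd)⟩
  | succ N ih =>
    obtain ⟨P, X', hX⟩ : ∃ P X', X.1 = P ::ₘ X' := by
      obtain ⟨P, hP⟩ := Multiset.card_pos_iff_exists_mem.1 (by omega : 0 < X.1.card)
      exact ⟨P, Multiset.exists_cons_of_mem hP⟩
    obtain ⟨r, s, c, h, w, w', Y, q, h1, h2, h3⟩ := exists_cls_eq_kappa_mul (e := e) v X hX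
    rw [h1, h3]
    refine Submodule.smul_mem _ q (imagePart_mul (kappa_mem_imagePart h0 hlow c r h w) (ih w' Y ?_))
    rw [hX, Multiset.card_cons] at hN
    omega

/-- Injectivity is global, by the left inverse. Only surjectivity has to keep track of degrees, so
no grading on the small presentation has to be shown to be direct. -/
theorem bijOn_toCoend [Nontrivial V] (hn : 0 < n) (e : 𝒱 (2 * n)) (g : ℕ)
    (hodd : ∀ k, Odd k → 𝒱 k = ⊥) (h0 : 𝒱 0 = Submodule.span ℚ {1})
    (hlow : ∀ k, 0 < k → k ≤ n → 𝒱 k = ⊥) (k : ℕ) :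
    Set.BijOn (toCoend hn e g hodd) (SmallPres.degreePart hn e g k) (degreePart n 𝒱 e g k) := by
  refine ⟨fun x hx => toCoend_mem_degreePart hn hodd hx,
    (Function.LeftInverse.injective (smallInv_toCoend hn e hodd h0 hlow)).injOn, ?_⟩
  have : degreePart n 𝒱 e g k ≤ imagePart e g hn hodd k := by
    rw [degreePart, Submodule.span_le]
    rintro _ ⟨m, v, X, rfl, rfl⟩
    exact cls_mem_imagePart h0 hlow v X
  exact fun x hx => this hx

end Surjective

end TwistedMMM

end

theorem mainTheorem5 (n : ℕ) (hn : 0 < n) (d : ℕ) :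
    ∃ g₀ : ℕ, ∀ g ≥ g₀, ∀ (V : Type*) [CommRing V] [Algebra ℚ V] [Nontrivial V]
      (𝒱 : ℕ → Submodule ℚ V) [GradedAlgebra 𝒱],
      (∀ k, Odd k → 𝒱 k = ⊥) → 𝒱 0 = Submodule.span ℚ {1} →
      (∀ k, 0 < k → k ≤ n → 𝒱 k = ⊥) → ∀ e : 𝒱 (2 * n),
      ∃ φ : TwistedMMM.SmallPres hn e g →ₐ[ℚ] TwistedMMM.RV n 𝒱 e g,
        (∀ x : TwistedMMM.Gen n 𝒱 g, φ (TwistedMMM.SmallPres.gen hn e x) = x.toRV hn e) ∧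
        ∀ k ≤ d, Set.BijOn φ (TwistedMMM.SmallPres.degreePart hn e g k)
          (TwistedMMM.degreePart n 𝒱 e g k) :=
  -- The bijection holds for all `g` and `k`, so `g₀ = 0` serves for every `d`.
  ⟨0, fun g _ _ _ _ _ _ _ hodd h0 hlow e => ⟨TwistedMMM.toCoend hn e g hodd,
    TwistedMMM.toCoend_gen hn e hodd, fun k _ => TwistedMMM.bijOn_toCoend hn e g hodd h0 hlow k⟩⟩
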